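/- **Proposition I.1.** Let $\Sigma$ be a non-empty compact oriented smooth surface without boundary. Call $\vec\Phi:\Sigma\to\mathbb R^3$ a *weak immersion* if $\vec\Phi\in W^{1,\infty}(\Sigma,\mathbb R^3)$, if there is a constant $C>1$ with $C^{-1}g_0(X,X)\le|d\vec\Phi(X)|^2\le C\,g_0(X,X)$ for almost every $x\in\Sigma$ and all $X\in T_x\Sigma$ ($g_0$ a smooth reference metric on $\Sigma$), and if the Gauss map $\vec n=\partial_{x_1}\vec\Phi\times\partial_{x_2}\vec\Phi/|\partial_{x_1}\vec\Phi\times\partial_{x_2}\vec\Phi|$ (in positive coordinates) belongs to $W^{1,2}(\Sigma,\mathbb R^3)$. The conformal class defined by $\vec\Phi$ is the Riemann surface structure on $\Sigma$ whose charts $z=x_1+ix_2$ are locally bi-Lipschitz and satisfy $g_{\vec\Phi}:=\vec\Phi^*g_{\mathbb R^3}=e^{2\lambda}(dx_1^2+dx_2^2)$ almost everywhere. In such a chart put $\mathbb I_{ij}=-\partial_{x_i}\vec n\cdot\partial_{x_j}\vec\Phi$, $H=\tfrac12e^{-2\lambda}(\mathbb I_{11}+\mathbb I_{22})$ and $h^0=\left(\tfrac12(\mathbb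 I_{11}-\mathbb I_{22})-i\,\mathbb I_{12}\right)dz^2$ (that is, $h^0=2\,\vec n\cdot\partial^2_{z^2}\vec\Phi\,dz^2$), and let $\langle\cdot,\cdot\rangle_{g_{\vec\Phi}}$ be the Hermitian product with $|dz^2|^2_{g_{\vec\Phi}}=4e^{-4\lambda}$. Then there are no weak immersion $\vec\Phi:\Sigma\to\mathbb R^3$ and holomorphic quadratic form $Q$ on $\Sigma$, equipped with the conformal class defined by $\vec\Phi$, such that $$H=\Re\langle Q,h^0\rangle_{g_{\vec\Phi}}\qquad\text{and}\qquad 2\,|Q|_{g_{\vec\Phi}}<1\qquad\text{almost everywhere on }\Sigma .$$ In other words, there is no compact strictly elliptic conformally constrained minimal surface in $\mathbb R^3$. -/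

import Mathlib

open MeasureTheory
open scoped Manifold ContDiff ComplexConjugate

namespace CCM

/-- The parameter plane `ℝ²` of the smooth reference charts of a surface. -/
abbrev Plane : Type := EuclideanSpace ℝ (Fin 2)

/-- Euclidean three-space. -/
abbrev Space : Type := EuclideanSpace ℝ (Fin 3)

/-- The cross product of `ℝ³`. -/
noncomputable def cross (a b : Space) : Space :=
  WithLp.toLp 2 (crossProduct (WithLp.ofLp a) (WithLp.ofLp b))

/-- The unit normal (Gauss map) of a parametrised surface `u : E → ℝ³`, where `E` is a plane
with oriented basis `e₁, e₂`: the normalised cross product of `∂₁u` and `∂₂u`. It is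
meaningful at the points where `u` is differentiable and immersive, which are almost all points
for the maps considered below. -/
noncomputable def unitNormal {E : Type*} [NormedAddCommGroup E] [NormedSpace ℝ E]
    (e₁ e₂ : E) (u : E → Space) (z : E) : Space :=
  ‖cross (fderiv ℝ u z e₁) (fderiv ℝ u z e₂)‖⁻¹ • cross (fderiv ℝ u z e₁) (fderiv ℝ u z e₂)

/-- `f'` is the weak (distributional) differential of `f` on the open set `U`. -/
def IsWeakFDerivOn {E F : Type*} [NormedAddCommGroup E] [NormedSpace ℝ E] [MeasureSpace E]
    [NormedAddCommGroup F] [NormedSpace ℝ F] (U : Set E) (f : E → F) (f' : E → E →L[ℝ] F) :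
    Prop :=
  LocallyIntegrableOn f U ∧ LocallyIntegrableOn f' U ∧
    ∀ χ : E → ℝ, ContDiff ℝ ∞ χ → HasCompactSupport χ → tsupport χ ⊆ U → ∀ v : E,
      ∫ z, (fderiv ℝ χ z v) • f z = - ∫ z, χ z • f' z v

/-- `f` is locally square integrable on `U`. -/
def MemL2LocOn {E F : Type*} [NormedAddCommGroup E] [MeasureSpace E] [NormedAddCommGroup F]
    (U : Set E) (f : E → F) : Prop :=
  ∀ K : Set E, IsCompact K → K ⊆ U → MemLp f 2 (volume.restrict K)

/-- `f ∈ W^{1,2}_loc(U)`, with weak differential `f'`. -/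
structure HasW12LocDerivOn {E F : Type*} [NormedAddCommGroup E] [NormedSpace ℝ E]
    [MeasureSpace E] [NormedAddCommGroup F] [NormedSpace ℝ F] (U : Set E) (f : E → F)
    (f' : E → E →L[ℝ] F) : Prop where
  memL2 : MemL2LocOn U f
  isWeakFDeriv : IsWeakFDerivOn U f f'
  memL2_deriv : MemL2LocOn U f'

/-- `Φ : S → ℝ³` is a weak immersion of the smooth surface `S`:
`Φ ∈ W^{1,∞}`, the pulled back metric is equivalent to a smooth reference metric, and the Gauss
map is in `W^{1,2}`. All three conditions are written in the charts of `S`, locally; on a compact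
surface this is the same as asking them globally with respect to one smooth reference metric,
because any such metric is comparable with the Euclidean one on compact pieces of a chart. The
third condition does not depend on the orientation of the chart, which only changes the sign of
the Gauss map. -/
structure IsWeakImmersion {S : Type*} [TopologicalSpace S] [ChartedSpace Plane S]
    (Φ : S → Space) : Prop where
  lipschitz : ∀ e ∈ atlas Plane S, LocallyLipschitzOn e.target (Φ ∘ e.symm)
  metric_equiv : ∀ e ∈ atlas Plane S, ∀ K : Set Plane, IsCompact K → K ⊆ e.target →
    ∃ C : ℝ, 1 < C ∧ ∀ᵐ x ∂(volume.restrict K), ∀ X : Plane,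
      C⁻¹ * ‖X‖ ^ 2 ≤ ‖fderiv ℝ (Φ ∘ e.symm) x X‖ ^ 2 ∧
        ‖fderiv ℝ (Φ ∘ e.symm) x X‖ ^ 2 ≤ C * ‖X‖ ^ 2
  gauss : ∀ e ∈ atlas Plane S, ∃ n' : Plane → Plane →L[ℝ] Space,
    HasW12LocDerivOn e.target
      (unitNormal (EuclideanSpace.single 0 1) (EuclideanSpace.single 1 1) (Φ ∘ e.symm)) n'

/-- The Riemann surface structure on `S` given by the complex charts is the conformal class
defined by `Φ`: its charts are locally bi-Lipschitz with respect to the smooth structure, and in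
each of them `Φ` is conformal almost everywhere, i.e. `g_Φ = e^{2λ} (dx₁² + dx₂²)`. -/
structure IsInducedConformalStructure {S : Type*} [TopologicalSpace S] [ChartedSpace Plane S]
    [ChartedSpace ℂ S] (Φ : S → Space) : Prop where
  lipschitz : ∀ e ∈ atlas Plane S, ∀ φ ∈ atlas ℂ S,
    LocallyLipschitzOn (e.symm.trans φ).source (e.symm.trans φ) ∧
      LocallyLipschitzOn (φ.symm.trans e).source (φ.symm.trans e)
  conformal : ∀ φ ∈ atlas ℂ S, ∀ᵐ z ∂(volume.restrict φ.target), ConformalAt (Φ ∘ φ.symm) z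

/-- A holomorphic quadratic form `Q` on a Riemann surface: in the chart `φ` it reads
`Q = f_φ(z) dz²` with `f_φ = coeff φ` holomorphic, and the local expressions agree under changes
of coordinates. -/
structure HolomorphicQuadraticForm (S : Type*) [TopologicalSpace S] [ChartedSpace ℂ S] where
  coeff : OpenPartialHomeomorph S ℂ → ℂ → ℂ
  holomorphic : ∀ φ ∈ atlas ℂ S, DifferentiableOn ℂ (coeff φ) φ.target
  transform : ∀ φ ∈ atlas ℂ S, ∀ ψ ∈ atlas ℂ S, ∀ z ∈ (φ.symm.trans ψ).source,
    coeff φ z = coeff ψ (ψ (φ.symm z)) * (deriv (fun w => ψ (φ.symm w)) z) ^ 2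

/-- The conformal factor `e^{2λ} = |∂₁u|²` of a parametrisation `u` in conformal coordinates
`z = x₁ + i x₂`. -/
noncomputable def conformalFactor (u : ℂ → Space) (z : ℂ) : ℝ :=
  ‖fderiv ℝ u z 1‖ ^ 2

/-- The second fundamental form `𝕀(v, w) = - ⟨dn(v), du(w)⟩` of a parametrisation `u` whose
Gauss map has (weak) differential `n'`. -/
noncomputable def secondForm (u : ℂ → Space) (n' : ℂ → ℂ →L[ℝ] Space) (z v w : ℂ) : ℝ :=
  - inner ℝ (n' z v) (fderiv ℝ u z w)

/-- The mean curvature `H = (1/2) g^{ij} 𝕀_{ij}` in conformal coordinates. -/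
noncomputable def meanCurvature (u : ℂ → Space) (n' : ℂ → ℂ →L[ℝ] Space) (z : ℂ) : ℝ :=
  (secondForm u n' z 1 1 + secondForm u n' z Complex.I Complex.I) / (2 * conformalFactor u z)

/-- The coefficient of `dz²` in the Weingarten form `h⁰ = 2 π_n(∂²_{zz} u) dz²`, that is
`2 𝕀(∂_z, ∂_z)` for the complex bilinear extension of `𝕀`, where `∂_z = (∂₁ - i ∂₂) / 2`. -/
noncomputable def weingartenCoeff (u : ℂ → Space) (n' : ℂ → ℂ →L[ℝ] Space) (z : ℂ) : ℂ :=
  (((secondForm u n' z 1 1 - secondForm u n' z Complex.I Complex.I : ℝ) : ℂ)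
    - Complex.I *
      ((secondForm u n' z 1 Complex.I + secondForm u n' z Complex.I 1 : ℝ) : ℂ)) / 2

/-- The real part of the Hermitian product `⟨a dz², b dz²⟩_g`, for the metric
`g = E (dx₁² + dx₂²)`, for which `|dz²|_g² = 4 E⁻²`. -/
noncomputable def rePairing (E : ℝ) (a b : ℂ) : ℝ :=
  4 / E ^ 2 * (conj a * b).re

/-- The norm `|a dz²|_g` for the metric `g = E (dx₁² + dx₂²)`. -/
noncomputable def formNorm (E : ℝ) (a : ℂ) : ℝ :=
  Real.sqrt (rePairing E a a)

/-- The conformally constrained minimal surface equation `H = Re ⟨Q, h⁰⟩_g`, required almost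
everywhere in each complex chart; the second fundamental form is the one given by the weak
`L²_loc` differential of the Gauss map in that chart. -/
def SolvesEquation {S : Type*} [TopologicalSpace S] [ChartedSpace ℂ S] (Φ : S → Space)
    (Q : HolomorphicQuadraticForm S) : Prop :=
  ∀ φ ∈ atlas ℂ S, ∃ n' : ℂ → ℂ →L[ℝ] Space,
    HasW12LocDerivOn φ.target (unitNormal 1 Complex.I (Φ ∘ φ.symm)) n' ∧
      ∀ᵐ z ∂(volume.restrict φ.target),
        meanCurvature (Φ ∘ φ.symm) n' z =
          rePairing (conformalFactor (Φ ∘ φ.symm) z) (Q.coeff φ z)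
            (weingartenCoeff (Φ ∘ φ.symm) n' z)

/-- Strict ellipticity, `2 |Q|_g < 1` on the whole surface. The induced metric is only given
almost everywhere, and so is the inequality. -/
def StrictlyElliptic {S : Type*} [TopologicalSpace S] [ChartedSpace ℂ S] (Φ : S → Space)
    (Q : HolomorphicQuadraticForm S) : Prop :=
  ∀ φ ∈ atlas ℂ S, ∀ᵐ z ∂(volume.restrict φ.target),
    2 * formNorm (conformalFactor (Φ ∘ φ.symm) z) (Q.coeff φ z) < 1

/-- `Φ : S → ℝ³` is a strictly elliptic conformally constrained minimal surface: it is a weak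
immersion which satisfies `H = Re ⟨Q, h⁰⟩_g` and `2 |Q|_g < 1` for some holomorphic quadratic
form `Q` on `S` equipped with the conformal class defined by `Φ`. -/
def IsStrictlyEllipticCCMinimal {S : Type*} [TopologicalSpace S] [ChartedSpace Plane S]
    (Φ : S → Space) : Prop :=
  IsWeakImmersion Φ ∧
    ∃ _ : ChartedSpace ℂ S, IsManifold 𝓘(ℂ) 1 S ∧ IsInducedConformalStructure Φ ∧
      ∃ Q : HolomorphicQuadraticForm S, SolvesEquation Φ Q ∧ StrictlyElliptic Φ Q

end CCM

/-! ### Calculus for bounded functions with L¹ derivatives, through smooth approximation. -/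

namespace CCM

open Filter Topology

/-! The equation is a conservation law, and pairing it with the position vector computes the area.
In a conformal chart write p = ∂₁u, q = ∂₂u, E = |p|² = |q|², Q = (a + ib) dz², and let M be the
symmetric trace-free matrix with rows (a, -b), (-b, -a). Then div((1 - 4M/E)∇u) = 0. Its tangential
part vanishes by conformality, its normal part is exactly H = Re⟨Q, h⁰⟩, and the derivatives of a
and b drop out by the Cauchy–Riemann equations. Pairing with u gives div(u · (1 - 4M/E)∇u) = 2E,
because M is trace free. The flux on the left is intrinsic: it transforms as a density between
conformal charts. On a closed surface its divergence integrates to zero, so twice the area is zero,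
which is absurd on a non-empty surface. Ellipticity serves to make 4M/E, hence the flux, bounded.

The analytic difficulty is that u is only Lipschitz and its Gauss map n only W^{1,2}. From ∇^⊥u = n
× ∇u one gets Δu = ∇n × ∇^⊥u weakly (`IsConformalSurface.exists_laplacian`), an L² function, and the
L² identity relating the full gradient to divergence and curl gives L² second derivatives
(`exists_hasApproxDeriv_of_div_curl`, `exists_hasApproxDeriv_fderiv_of_laplacian`). Products and
smooth functions of first derivatives are then differentiated in the sense of `HasApproxDeriv`, a
class of bounded functions closed under these operations. The factor 1/E is regularised as E/(E² +
δ), and δ → 0 is taken with bounds that use no positive lower bound on E.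

The pointwise algebra is `divergence_term_eq_zero`, the integrated identity is
`integral_flux_of_divergence`, its form in a chart is `integral_fluxDensity`, invariance is
`fluxDensity_comp`, and `isEmpty_of_flux` adds up the charts with a partition of unity. -/

theorem tendsto_integral_abs_mul_sub {α : Type*} [MeasurableSpace α] {μ : Measure α}
    {G : ℕ → α → ℝ} {g : α → ℝ} {C : ℝ} {B : ℕ → α → ℝ} {b : α → ℝ}
    (hGm : ∀ k, AEStronglyMeasurable (G k) μ) (hGC : ∀ k, ∀ᵐ z ∂μ, |G k z| ≤ C)
    (hG : ∀ᵐ z ∂μ, Tendsto (fun k => G k z) atTop (𝓝 (g z)))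
    (hB : ∀ k, Integrable (B k) μ) (hb : Integrable b μ)
    (hlim : Tendsto (fun k => ∫ z, |B k z - b z| ∂μ) atTop (𝓝 0)) :
    Tendsto (fun k => ∫ z, |G k z * B k z - g z * b z| ∂μ) atTop (𝓝 0) := by
  have hgm : AEStronglyMeasurable g μ := aestronglyMeasurable_of_tendsto_ae atTop hGm hG
  have hGC' : ∀ᵐ z ∂μ, ∀ k, |G k z| ≤ C := ae_all_iff.2 hGC
  have hgC : ∀ᵐ z ∂μ, |g z| ≤ C := by
    filter_upwards [hG, hGC'] with z h1 h2
    exact le_of_tendsto h1.abs (Eventually.of_forall h2)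
  -- The splitting is GB - gb = G(B - b) + (G - g)b. The first term is controlled by the bound on G,
  -- the second by domination with 2C|b|.
  have key : Tendsto (fun k => ∫ z, |(G k z - g z) * b z| ∂μ) atTop (𝓝 0) := by
    have h0 : (0 : ℝ) = ∫ z, (0 : ℝ) ∂μ := by simp
    rw [h0]
    apply tendsto_integral_of_dominated_convergence (fun z => 2 * C * |b z|)
    · intro k
      exact (((hGm k).sub hgm).mul hb.1).norm
    · exact hb.abs.const_mul _
    · intro k
      filter_upwards [hGC', hgC] with z h1 h2
      rw [Real.norm_eq_abs, abs_abs, abs_mul]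
      gcongr
      calc |G k z - g z| ≤ |G k z| + |g z| := abs_sub _ _
        _ ≤ 2 * C := by linarith [h1 k]
    · filter_upwards [hG] with z h1
      have : Tendsto (fun k => |(G k z - g z) * b z|) atTop (𝓝 (|(g z - g z) * b z|)) :=
        ((h1.sub_const _).mul_const _).abs
      simpa using this
  have hsum : Tendsto (fun k => C * ∫ z, |B k z - b z| ∂μ + ∫ z, |(G k z - g z) * b z| ∂μ)
      atTop (𝓝 0) := by
    simpa using (hlim.const_mul C).add key
  refine squeeze_zero (fun k => integral_nonneg fun z => abs_nonneg _) (fun k => ?_) hsum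
  have hi1 : Integrable (fun z => C * |B k z - b z|) μ := ((hB k).sub hb).abs.const_mul _
  have hi2 : Integrable (fun z => |(G k z - g z) * b z|) μ := by
    refine Integrable.abs (hb.bdd_mul (c := 2 * C) ((hGm k).sub hgm) ?_)
    filter_upwards [hGC', hgC] with z h1 h2
    calc |G k z - g z| ≤ |G k z| + |g z| := abs_sub _ _
        _ ≤ 2 * C := by linarith [h1 k]
  rw [← integral_const_mul, ← integral_add hi1 hi2]
  apply integral_mono_of_nonneg (Eventually.of_forall fun z => abs_nonneg _) (hi1.add hi2)
  filter_upwards [hGC'] with z h1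
  have : G k z * B k z - g z * b z = G k z * (B k z - b z) + (G k z - g z) * b z := by ring
  rw [this]
  refine (abs_add_le _ _).trans ?_
  simp only [Pi.add_apply]
  gcongr
  rw [abs_mul]
  gcongr
  exact h1 k

theorem tendsto_integral_of_tendsto_integral_abs_sub {α : Type*} [MeasurableSpace α]
    {μ : Measure α} {B : ℕ → α → ℝ} {b : α → ℝ}
    (hB : ∀ k, Integrable (B k) μ) (hb : Integrable b μ)
    (hlim : Tendsto (fun k => ∫ z, |B k z - b z| ∂μ) atTop (𝓝 0)) :
    Tendsto (fun k => ∫ z, B k z ∂μ) atTop (𝓝 (∫ z, b z ∂μ)) := by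
  rw [tendsto_iff_dist_tendsto_zero]
  refine squeeze_zero (fun k => dist_nonneg) (fun k => ?_) hlim
  rw [Real.dist_eq, ← integral_sub (hB k) hb]
  exact abs_integral_le_integral_abs

/-- `G` is a sequence of smooth functions on `V`, uniformly bounded by `C`, which converges almost
everywhere to `g`, and whose derivatives in the direction `e` converge to `g'` in `L¹(V)`. -/
structure IsApproxSeq (V : Set ℂ) (e : ℂ) (g g' : ℂ → ℝ) (G : ℕ → ℂ → ℝ) (C : ℝ) : Prop where
  nonneg : 0 ≤ C
  smooth : ∀ k, ContDiffOn ℝ ∞ (G k) V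
  bound : ∀ k, ∀ z ∈ V, |G k z| ≤ C
  lim : ∀ᵐ z ∂(volume.restrict V), Tendsto (fun k => G k z) atTop (𝓝 (g z))
  integrable : IntegrableOn g' V
  integrable_fderiv : ∀ k, IntegrableOn (fun z => fderiv ℝ (G k) z e) V
  lim_fderiv : Tendsto (fun k => ∫ z in V, |fderiv ℝ (G k) z e - g' z|) atTop (𝓝 0)

/-- `g'` is the derivative of the bounded function `g` on `V` in the direction `e`, in the sense of
approximation by smooth functions. -/
def HasApproxDeriv (V : Set ℂ) (e : ℂ) (g g' : ℂ → ℝ) : Prop :=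
  ∃ G C, IsApproxSeq V e g g' G C

section

variable {V : Set ℂ} {e : ℂ} {g g' h h' : ℂ → ℝ} {G H : ℕ → ℂ → ℝ} {C D : ℝ}

namespace IsApproxSeq

theorem aestronglyMeasurable_seq (hV : IsOpen V) (hg : IsApproxSeq V e g g' G C) (k : ℕ) :
    AEStronglyMeasurable (G k) (volume.restrict V) :=
  (hg.smooth k).continuousOn.aestronglyMeasurable hV.measurableSet

theorem ae_bound_seq (hV : IsOpen V) (hg : IsApproxSeq V e g g' G C) (k : ℕ) :
    ∀ᵐ z ∂(volume.restrict V), |G k z| ≤ C :=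
  (ae_restrict_iff' hV.measurableSet).2 (Eventually.of_forall fun z hz => hg.bound k z hz)

theorem aestronglyMeasurable (hV : IsOpen V) (hg : IsApproxSeq V e g g' G C) :
    AEStronglyMeasurable g (volume.restrict V) :=
  aestronglyMeasurable_of_tendsto_ae atTop (hg.aestronglyMeasurable_seq hV) hg.lim

theorem ae_bound (hV : IsOpen V) (hg : IsApproxSeq V e g g' G C) :
    ∀ᵐ z ∂(volume.restrict V), |g z| ≤ C := by
  filter_upwards [hg.lim, ae_all_iff.2 (hg.ae_bound_seq hV)] with z h1 h2
  exact le_of_tendsto h1.abs (Eventually.of_forall h2)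

theorem differentiableAt (hV : IsOpen V) (hg : IsApproxSeq V e g g' G C) (k : ℕ) {z : ℂ}
    (hz : z ∈ V) : DifferentiableAt ℝ (G k) z :=
  ((hg.smooth k).contDiffAt (hV.mem_nhds hz)).differentiableAt (by simp)

theorem integrable_bdd_mul (hV : IsOpen V) (hg : IsApproxSeq V e g g' G C)
    (hh : IntegrableOn h V) : IntegrableOn (fun z => g z * h z) V :=
  Integrable.bdd_mul hh (hg.aestronglyMeasurable hV) (hg.ae_bound hV)

theorem integrable_seq_mul (hV : IsOpen V) (hg : IsApproxSeq V e g g' G C)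
    (hh : IntegrableOn h V) (k : ℕ) : IntegrableOn (fun z => G k z * h z) V :=
  Integrable.bdd_mul hh (hg.aestronglyMeasurable_seq hV k) (hg.ae_bound_seq hV k)

/-- Each Leibniz term is a bounded, almost everywhere convergent factor times an L¹ convergent one.
This is why `IsApproxSeq` asks for a uniform bound and pointwise convergence of the functions but
only L¹ convergence of the derivatives. -/
theorem mul (hV : IsOpen V) (hg : IsApproxSeq V e g g' G C) (hh : IsApproxSeq V e h h' H D) :
    IsApproxSeq V e (fun z => g z * h z) (fun z => g z * h' z + h z * g' z)
      (fun k z => G k z * H k z) (C * D) where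
  nonneg := mul_nonneg hg.nonneg hh.nonneg
  smooth k := (hg.smooth k).mul (hh.smooth k)
  bound k z hz := by
    rw [abs_mul]
    exact mul_le_mul (hg.bound k z hz) (hh.bound k z hz) (abs_nonneg _) hg.nonneg
  lim := by
    filter_upwards [hg.lim, hh.lim] with z h1 h2 using h1.mul h2
  integrable := (hg.integrable_bdd_mul hV hh.integrable).add
    (hh.integrable_bdd_mul hV hg.integrable)
  integrable_fderiv k := by
    refine IntegrableOn.congr_fun ((hg.integrable_seq_mul hV (hh.integrable_fderiv k) k).add
      (hh.integrable_seq_mul hV (hg.integrable_fderiv k) k)) (fun z hz => ?_) hV.measurableSet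
    rw [fderiv_fun_mul (hg.differentiableAt hV k hz) (hh.differentiableAt hV k hz)]
    simp
  lim_fderiv := by
    have h1 := tendsto_integral_abs_mul_sub (hg.aestronglyMeasurable_seq hV) (hg.ae_bound_seq hV)
      hg.lim hh.integrable_fderiv hh.integrable hh.lim_fderiv
    have h2 := tendsto_integral_abs_mul_sub (hh.aestronglyMeasurable_seq hV) (hh.ae_bound_seq hV)
      hh.lim hg.integrable_fderiv hg.integrable hg.lim_fderiv
    have h3 := h1.add h2
    rw [add_zero] at h3
    refine squeeze_zero (fun k => integral_nonneg fun z => abs_nonneg _) (fun k => ?_) h3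
    have i1 : IntegrableOn (fun z => |G k z * fderiv ℝ (H k) z e - g z * h' z|) V :=
      ((hg.integrable_seq_mul hV (hh.integrable_fderiv k) k).sub
        (hg.integrable_bdd_mul hV hh.integrable)).abs
    have i2 : IntegrableOn (fun z => |H k z * fderiv ℝ (G k) z e - h z * g' z|) V :=
      ((hh.integrable_seq_mul hV (hg.integrable_fderiv k) k).sub
        (hh.integrable_bdd_mul hV hg.integrable)).abs
    rw [← integral_add i1 i2]
    apply integral_mono_of_nonneg (Eventually.of_forall fun z => abs_nonneg _) (i1.add i2)
    filter_upwards [ae_restrict_mem hV.measurableSet] with z hz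
    rw [fderiv_fun_mul (hg.differentiableAt hV k hz) (hh.differentiableAt hV k hz)]
    refine le_trans (le_of_eq ?_) (abs_add_le _ _)
    simp only [add_apply, smul_apply, smul_eq_mul]
    ring_nf

theorem add (hV : IsOpen V) (hg : IsApproxSeq V e g g' G C) (hh : IsApproxSeq V e h h' H D) :
    IsApproxSeq V e (fun z => g z + h z) (fun z => g' z + h' z)
      (fun k z => G k z + H k z) (C + D) where
  nonneg := add_nonneg hg.nonneg hh.nonneg
  smooth k := (hg.smooth k).add (hh.smooth k)
  bound k z hz := (abs_add_le _ _).trans (add_le_add (hg.bound k z hz) (hh.bound k z hz))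
  lim := by
    filter_upwards [hg.lim, hh.lim] with z h1 h2 using h1.add h2
  integrable := hg.integrable.add hh.integrable
  integrable_fderiv k := by
    refine IntegrableOn.congr_fun ((hg.integrable_fderiv k).add
      (hh.integrable_fderiv k)) (fun z hz => ?_) hV.measurableSet
    rw [fderiv_fun_add (hg.differentiableAt hV k hz) (hh.differentiableAt hV k hz)]
    simp
  lim_fderiv := by
    have h3 := hg.lim_fderiv.add hh.lim_fderiv
    rw [add_zero] at h3
    refine squeeze_zero (fun k => integral_nonneg fun z => abs_nonneg _) (fun k => ?_) h3
    have i1 := (hg.integrable_fderiv k |>.sub hg.integrable).abs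
    have i2 := (hh.integrable_fderiv k |>.sub hh.integrable).abs
    simp only [Pi.sub_apply] at i1 i2
    rw [← integral_add i1 i2]
    apply integral_mono_of_nonneg (Eventually.of_forall fun z => abs_nonneg _) (i1.add i2)
    filter_upwards [ae_restrict_mem hV.measurableSet] with z hz
    rw [fderiv_fun_add (hg.differentiableAt hV k hz) (hh.differentiableAt hV k hz)]
    refine le_trans (le_of_eq ?_) (abs_add_le _ _)
    simp only [add_apply]
    ring_nf

/-- All values stay in the compact interval [-C, C], so θ and its derivative are bounded there and
no growth condition on θ is needed. -/
theorem comp (hV : IsOpen V) (hg : IsApproxSeq V e g g' G C) {θ : ℝ → ℝ} (hθ : ContDiff ℝ ∞ θ) :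
    ∃ D, IsApproxSeq V e (fun z => θ (g z)) (fun z => deriv θ (g z) * g' z)
      (fun k z => θ (G k z)) D := by
  have hθ0 : Continuous θ := hθ.continuous
  have hθ1 : Continuous (deriv θ) := hθ.continuous_deriv (by simp)
  obtain ⟨D, hD⟩ := (isCompact_Icc (a := -C) (b := C)).exists_bound_of_continuousOn
    hθ0.continuousOn
  obtain ⟨D', hD'⟩ := (isCompact_Icc (a := -C) (b := C)).exists_bound_of_continuousOn
    hθ1.continuousOn
  have hmem : ∀ k, ∀ z ∈ V, G k z ∈ Set.Icc (-C) C := fun k z hz => abs_le.1 (hg.bound k z hz)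
  have hfd : ∀ k, ∀ z ∈ V, fderiv ℝ (fun z => θ (G k z)) z e
      = deriv θ (G k z) * fderiv ℝ (G k) z e := by
    intro k z hz
    have h1 : HasDerivAt θ (deriv θ (G k z)) (G k z) :=
      (hθ.differentiable (by simp) _).hasDerivAt
    have := h1.comp_hasFDerivAt z (hg.differentiableAt hV k hz).hasFDerivAt
    have h2 : fderiv ℝ (fun z => θ (G k z)) z = _ := this.fderiv
    rw [h2]; simp
  have hm : ∀ k, AEStronglyMeasurable (fun z => deriv θ (G k z)) (volume.restrict V) :=
    fun k => hθ1.comp_aestronglyMeasurable (hg.aestronglyMeasurable_seq hV k)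
  have hb : ∀ k, ∀ᵐ z ∂(volume.restrict V), |deriv θ (G k z)| ≤ D' := by
    intro k
    filter_upwards [ae_restrict_mem hV.measurableSet] with z hz using hD' _ (hmem k z hz)
  have hl : ∀ᵐ z ∂(volume.restrict V),
      Tendsto (fun k => deriv θ (G k z)) atTop (𝓝 (deriv θ (g z))) := by
    filter_upwards [hg.lim] with z h1 using (hθ1.tendsto _).comp h1
  have hmg : AEStronglyMeasurable (fun z => deriv θ (g z)) (volume.restrict V) :=
    hθ1.comp_aestronglyMeasurable (hg.aestronglyMeasurable hV)
  have hbg : ∀ᵐ z ∂(volume.restrict V), |deriv θ (g z)| ≤ D' := by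
    filter_upwards [hg.ae_bound hV] with z hz using hD' _ (abs_le.1 hz)
  refine ⟨max D 0, le_max_right _ _, fun k => hθ.comp_contDiffOn (hg.smooth k),
    fun k z hz => (hD _ (hmem k z hz)).trans (le_max_left _ _), ?_,
    Integrable.bdd_mul hg.integrable hmg hbg, fun k => ?_, ?_⟩
  · filter_upwards [hg.lim] with z h1 using (hθ0.tendsto _).comp h1
  · refine IntegrableOn.congr_fun
      (Integrable.bdd_mul (hg.integrable_fderiv k) (hm k) (hb k)) (fun z hz => ?_) hV.measurableSet
    rw [hfd k z hz]
  · refine (tendsto_integral_abs_mul_sub hm hb hl hg.integrable_fderiv hg.integrable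
      hg.lim_fderiv).congr fun k => ?_
    refine setIntegral_congr_fun hV.measurableSet fun z hz => ?_
    simp only [hfd k z hz]

end IsApproxSeq

theorem integrable_mul_of_tsupport_subset {χ w : ℂ → ℝ} (hχ : Continuous χ)
    (hc : HasCompactSupport χ) (hs : tsupport χ ⊆ V) (hw : IntegrableOn w V) :
    Integrable (fun z => χ z * w z) := by
  obtain ⟨M, hM⟩ := hc.exists_bound_of_continuous hχ
  have h1 : IntegrableOn (fun z => χ z * w z) (tsupport χ) :=
    Integrable.bdd_mul (hw.mono_set hs) hχ.aestronglyMeasurable (Eventually.of_forall hM)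
  refine (integrableOn_iff_integrable_of_support_subset fun z hz => ?_).1 h1
  by_contra hz'
  exact hz (by simp [image_eq_zero_of_notMem_tsupport hz'])

theorem setIntegral_mul_eq_integral {χ w : ℂ → ℝ} (hs : tsupport χ ⊆ V) :
    ∫ z in V, χ z * w z = ∫ z, χ z * w z := by
  refine setIntegral_eq_integral_of_forall_compl_eq_zero fun z hz => ?_
  rw [image_eq_zero_of_notMem_tsupport (fun h => hz (hs h)), zero_mul]

theorem tsupport_fderiv_apply_subset (χ : ℂ → ℝ) (e : ℂ) :
    tsupport (fun z => fderiv ℝ χ z e) ⊆ tsupport χ :=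
  (closure_minimal (fun z hz => by
    by_contra h
    have h2 : fderiv ℝ χ z = 0 := by
      by_contra h3
      exact h (tsupport_fderiv_subset ℝ (subset_tsupport _ h3))
    exact hz (by simp [h2])) (isClosed_tsupport _))

theorem hasCompactSupport_fderiv_apply {χ : ℂ → ℝ} (hc : HasCompactSupport χ) (e : ℂ) :
    HasCompactSupport (fun z => fderiv ℝ χ z e) :=
  HasCompactSupport.of_support_subset_isCompact hc
    ((subset_tsupport _).trans (tsupport_fderiv_apply_subset χ e))

theorem contDiff_fderiv_apply {χ : ℂ → ℝ} (hχ : ContDiff ℝ ∞ χ) (e : ℂ) :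
    ContDiff ℝ ∞ (fun z => fderiv ℝ χ z e) :=
  (hχ.fderiv_right (m := ∞) (by simp)).clm_apply contDiff_const

/-- The approximating functions are smooth only on `V`; multiplied by a test function they become
admissible test functions on the plane. -/
theorem contDiff_mul_of_tsupport_subset {χ f : ℂ → ℝ} (hV : IsOpen V) (hχ : ContDiff ℝ ∞ χ)
    (hs : tsupport χ ⊆ V) (hf : ContDiffOn ℝ ∞ f V) : ContDiff ℝ ∞ (fun z => χ z * f z) := by
  rw [contDiff_iff_contDiffAt]
  intro z
  by_cases hz : z ∈ tsupport χ
  · exact hχ.contDiffAt.mul (hf.contDiffAt (hV.mem_nhds (hs hz)))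
  · refine (contDiffAt_const (c := (0 : ℝ))).congr_of_eventuallyEq ?_
    filter_upwards [(isClosed_tsupport χ).isOpen_compl.mem_nhds hz] with w hw
    rw [image_eq_zero_of_notMem_tsupport hw, zero_mul]

/-- Integration by parts against a test function. -/
theorem HasApproxDeriv.integral_fderiv_mul (hV : IsOpen V) (hvol : volume V ≠ ⊤)
    (hg : HasApproxDeriv V e g g')
    {χ : ℂ → ℝ} (hχ : ContDiff ℝ ∞ χ) (hc : HasCompactSupport χ) (hs : tsupport χ ⊆ V) :
    ∫ z, fderiv ℝ χ z e * g z = - ∫ z, χ z * g' z := by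
  obtain ⟨G, C, hG⟩ := hg
  have : IsFiniteMeasure (volume.restrict V) := ⟨by simpa using hvol.lt_top⟩
  have hs' := (tsupport_fderiv_apply_subset χ e).trans hs
  have hc' := hasCompactSupport_fderiv_apply hc e
  have hχ' := (contDiff_fderiv_apply hχ e).continuous
  have hGi : ∀ k, IntegrableOn (G k) V := fun k =>
    Integrable.of_bound (hG.aestronglyMeasurable_seq hV k) C (hG.ae_bound_seq hV k)
  have key : ∀ k, ∫ z, fderiv ℝ χ z e * G k z = - ∫ z, χ z * fderiv ℝ (G k) z e := by
    intro k
    rw [integral_mul_fderiv_eq_neg_fderiv_mul_of_integrable, neg_neg]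
    · exact integrable_mul_of_tsupport_subset hχ' hc' hs' (hGi k)
    · exact integrable_mul_of_tsupport_subset hχ.continuous hc hs (hG.integrable_fderiv k)
    · exact integrable_mul_of_tsupport_subset hχ.continuous hc hs (hGi k)
    · exact fun z _ => hχ.differentiable (by simp) z
    · exact fun z hz => hG.differentiableAt hV k (hs hz)
  obtain ⟨M, hM⟩ := hc.exists_bound_of_continuous hχ.continuous
  obtain ⟨M', hM'⟩ := hc'.exists_bound_of_continuous hχ'
  have l1 : Tendsto (fun k => ∫ z, χ z * fderiv ℝ (G k) z e) atTop (𝓝 (∫ z, χ z * g' z)) := by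
    simp_rw [← setIntegral_mul_eq_integral (w := g') hs,
      fun k => (setIntegral_mul_eq_integral (w := fun z => fderiv ℝ (G k) z e) hs).symm]
    refine tendsto_integral_of_tendsto_integral_abs_sub ?_ ?_
      (tendsto_integral_abs_mul_sub (G := fun _ => χ) (C := M) ?_ ?_ ?_
        hG.integrable_fderiv hG.integrable hG.lim_fderiv)
    · exact fun k => (integrable_mul_of_tsupport_subset hχ.continuous hc hs
        (hG.integrable_fderiv k)).integrableOn
    · exact (integrable_mul_of_tsupport_subset hχ.continuous hc hs hG.integrable).integrableOn
    · exact fun k => hχ.continuous.aestronglyMeasurable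
    · exact fun k => Eventually.of_forall hM
    · exact Eventually.of_forall fun z => tendsto_const_nhds
  have l2 : Tendsto (fun k => ∫ z, fderiv ℝ χ z e * G k z) atTop
      (𝓝 (∫ z, fderiv ℝ χ z e * g z)) := by
    simp_rw [← setIntegral_mul_eq_integral (w := g) hs',
      fun k => (setIntegral_mul_eq_integral (w := G k) hs').symm]
    refine tendsto_integral_of_dominated_convergence (fun _ => M' * C) ?_ ?_ ?_ ?_
    · exact fun k => hχ'.aestronglyMeasurable.mul (hG.aestronglyMeasurable_seq hV k)
    · exact integrable_const _
    · intro k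
      filter_upwards [hG.ae_bound_seq hV k] with z hz
      rw [norm_mul]
      exact mul_le_mul (hM' z) hz (norm_nonneg _) ((norm_nonneg _).trans (hM' z))
    · filter_upwards [hG.lim] with z hz using hz.const_mul _
  simp_rw [key] at l2
  exact tendsto_nhds_unique l2 l1.neg

namespace HasApproxDeriv

theorem mul (hV : IsOpen V) (hg : HasApproxDeriv V e g g') (hh : HasApproxDeriv V e h h') :
    HasApproxDeriv V e (fun z => g z * h z) (fun z => g z * h' z + h z * g' z) := by
  obtain ⟨G, C, hG⟩ := hg
  obtain ⟨H, D, hH⟩ := hh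
  exact ⟨_, _, hG.mul hV hH⟩

theorem add (hV : IsOpen V) (hg : HasApproxDeriv V e g g') (hh : HasApproxDeriv V e h h') :
    HasApproxDeriv V e (fun z => g z + h z) (fun z => g' z + h' z) := by
  obtain ⟨G, C, hG⟩ := hg
  obtain ⟨H, D, hH⟩ := hh
  exact ⟨_, _, hG.add hV hH⟩

theorem comp (hV : IsOpen V) (hg : HasApproxDeriv V e g g') {θ : ℝ → ℝ} (hθ : ContDiff ℝ ∞ θ) :
    HasApproxDeriv V e (fun z => θ (g z)) (fun z => deriv θ (g z) * g' z) := by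
  obtain ⟨G, C, hG⟩ := hg
  obtain ⟨D, hD⟩ := hG.comp hV hθ
  exact ⟨_, _, hD⟩

theorem const_mul (hV : IsOpen V) (hg : HasApproxDeriv V e g g') (c : ℝ) :
    HasApproxDeriv V e (fun z => c * g z) (fun z => c * g' z) := by
  have := hg.comp hV (θ := fun t => c * t) (by fun_prop)
  simpa [deriv_const_mul_field] using this

theorem sum (hV : IsOpen V) {ι : Type*} (s : Finset ι) {f f' : ι → ℂ → ℝ}
    (h : ∀ i ∈ s, HasApproxDeriv V e (f i) (f' i)) :
    HasApproxDeriv V e (fun z => ∑ i ∈ s, f i z) (fun z => ∑ i ∈ s, f' i z) := by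
  classical
  induction s using Finset.induction_on with
  | empty =>
    refine ⟨fun _ _ => 0, 0, le_rfl, fun k => contDiffOn_const, by simp, by simp,
      by simp, by simp, by simp⟩
  | insert a s ha ih =>
    simp only [Finset.sum_insert ha]
    exact (h a (Finset.mem_insert_self _ _)).add hV
      (ih fun i hi => h i (Finset.mem_insert_of_mem hi))

theorem congr (hg : HasApproxDeriv V e g g') (h1 : ∀ᵐ z ∂(volume.restrict V), h z = g z)
    (h2 : ∀ᵐ z ∂(volume.restrict V), h' z = g' z) : HasApproxDeriv V e h h' := by
  obtain ⟨G, C, hG⟩ := hg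
  refine ⟨G, C, hG.nonneg, hG.smooth, hG.bound, ?_, ?_, hG.integrable_fderiv, ?_⟩
  · filter_upwards [hG.lim, h1] with z a b
    rwa [b]
  · exact hG.integrable.congr (by filter_upwards [h2] with z a using a.symm)
  · refine hG.lim_fderiv.congr fun k => integral_congr_ae ?_
    filter_upwards [h2] with z a
    rw [a]

theorem mono {V' : Set ℂ} (hV : V' ⊆ V) (hg : HasApproxDeriv V e g g') :
    HasApproxDeriv V' e g g' := by
  obtain ⟨G, C, hG⟩ := hg
  refine ⟨G, C, hG.nonneg, fun k => (hG.smooth k).mono hV, fun k z hz => hG.bound k z (hV hz),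
    ae_restrict_of_ae_restrict_of_subset hV hG.lim, hG.integrable.mono_set hV,
    fun k => (hG.integrable_fderiv k).mono_set hV, ?_⟩
  refine squeeze_zero (fun k => integral_nonneg fun z => abs_nonneg _) (fun k => ?_) hG.lim_fderiv
  exact setIntegral_mono_set ((hG.integrable_fderiv k).sub hG.integrable).abs
    (Eventually.of_forall fun z => abs_nonneg _) hV.eventuallyLE

theorem of_contDiffOn (hg : ContDiffOn ℝ ∞ g V) (hb : ∀ z ∈ V, |g z| ≤ C)
    (hi : IntegrableOn (fun z => fderiv ℝ g z e) V) :
    HasApproxDeriv V e g (fun z => fderiv ℝ g z e) := by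
  refine ⟨fun _ => g, max C 0, le_max_right _ _, fun _ => hg,
    fun _ z hz => (hb z hz).trans (le_max_left _ _),
    Eventually.of_forall fun z => tendsto_const_nhds, hi, fun _ => hi, by simp⟩

theorem integrable (hg : HasApproxDeriv V e g g') : IntegrableOn g' V := by
  obtain ⟨G, C, hG⟩ := hg
  exact hG.integrable

theorem integrable_mul (hV : IsOpen V) (hg : HasApproxDeriv V e g g') (hh : IntegrableOn h V) :
    IntegrableOn (fun z => g z * h z) V := by
  obtain ⟨G, C, hG⟩ := hg
  exact hG.integrable_bdd_mul hV hh

theorem integrableOn (hV : IsOpen V) (hvol : volume V ≠ ⊤) (hg : HasApproxDeriv V e g g') :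
    IntegrableOn g V := by
  have : IsFiniteMeasure (volume.restrict V) := ⟨by simpa using hvol.lt_top⟩
  simpa using hg.integrable_mul hV (integrable_const (1 : ℝ))

/-- The derivative in the sense of approximation is unique. -/
theorem ae_eq (hV : IsOpen V) (hvol : volume V ≠ ⊤) (hg : HasApproxDeriv V e g g')
    (hh : HasApproxDeriv V e h h') (hgh : ∀ᵐ z ∂(volume.restrict V), g z = h z) :
    ∀ᵐ z ∂(volume.restrict V), g' z = h' z := by
  have hi : IntegrableOn (fun z => g' z - h' z) V := hg.integrable.sub hh.integrable
  have := hV.ae_eq_zero_of_integral_contDiff_smul_eq_zero (μ := volume)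
    (f := fun z => g' z - h' z) hi.locallyIntegrableOn (fun χ hχ hc hs => by
      have e1 := hg.integral_fderiv_mul hV hvol hχ hc hs
      have e2 := hh.integral_fderiv_mul hV hvol hχ hc hs
      have e3 : ∫ z, fderiv ℝ χ z e * g z = ∫ z, fderiv ℝ χ z e * h z := by
        have hs' := (tsupport_fderiv_apply_subset χ e).trans hs
        rw [← setIntegral_mul_eq_integral (w := g) hs', ← setIntegral_mul_eq_integral (w := h) hs']
        refine integral_congr_ae ?_
        filter_upwards [hgh] with z hz
        rw [hz]
      simp only [smul_eq_mul, mul_sub]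
      rw [integral_sub (integrable_mul_of_tsupport_subset hχ.continuous hc hs hg.integrable)
        (integrable_mul_of_tsupport_subset hχ.continuous hc hs hh.integrable)]
      linarith)
  rw [ae_restrict_iff' hV.measurableSet]
  filter_upwards [this] with z hz hzV
  linarith [hz hzV]

end HasApproxDeriv

/-- Product rule for a weakly differentiable bounded function `n` and a function which is
differentiable in the sense of approximation, tested against `χ`. -/
theorem HasApproxDeriv.integral_fderiv_mul_mul (hV : IsOpen V) (hvol : volume V ≠ ⊤)
    (hg : HasApproxDeriv V e g g') {n n' : ℂ → ℝ}
    (hnm : AEStronglyMeasurable n (volume.restrict V)) {N : ℝ}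
    (hnb : ∀ z, |n z| ≤ N) (hn' : IntegrableOn n' V)
    (hn : ∀ χ : ℂ → ℝ, ContDiff ℝ ∞ χ → HasCompactSupport χ → tsupport χ ⊆ V →
      ∫ z, fderiv ℝ χ z e * n z = - ∫ z, χ z * n' z)
    {χ : ℂ → ℝ} (hχ : ContDiff ℝ ∞ χ) (hc : HasCompactSupport χ) (hs : tsupport χ ⊆ V) :
    ∫ z, fderiv ℝ χ z e * (n z * g z) = - ∫ z, χ z * (n' z * g z + n z * g' z) := by
  obtain ⟨G, C, hG⟩ := hg
  have : IsFiniteMeasure (volume.restrict V) := ⟨by simpa using hvol.lt_top⟩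
  have hs' := (tsupport_fderiv_apply_subset χ e).trans hs
  have hc' := hasCompactSupport_fderiv_apply hc e
  have hχ' := (contDiff_fderiv_apply hχ e).continuous
  have bm : ∀ {w : ℂ → ℝ}, IntegrableOn w V → IntegrableOn (fun z => n z * w z) V :=
    fun hw => Integrable.bdd_mul hw hnm (Eventually.of_forall hnb)
  have hGi : ∀ k, IntegrableOn (G k) V := fun k =>
    Integrable.of_bound (hG.aestronglyMeasurable_seq hV k) C (hG.ae_bound_seq hV k)
  have hgi : IntegrableOn g V :=
    Integrable.of_bound (hG.aestronglyMeasurable hV) C (hG.ae_bound hV)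
  -- The weak derivative of `n` is tested against χ G_k, so `n` itself never has to be approximated.
  have key : ∀ k, ∫ z, fderiv ℝ χ z e * (n z * G k z)
      = - ((∫ z, χ z * (G k z * n' z)) + ∫ z, χ z * (n z * fderiv ℝ (G k) z e)) := by
    intro k
    have hp := hn (fun z => χ z * G k z)
      (contDiff_mul_of_tsupport_subset hV hχ hs (hG.smooth k)) hc.mul_right
      ((tsupport_mul_subset_left).trans hs)
    have i1 := integrable_mul_of_tsupport_subset hχ' hc' hs' (bm (hGi k))
    have i2 := integrable_mul_of_tsupport_subset hχ.continuous hc hs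
      (bm (hG.integrable_fderiv k))
    have e1 : ∀ z, fderiv ℝ (fun z => χ z * G k z) z e * n z
        = fderiv ℝ χ z e * (n z * G k z) + χ z * (n z * fderiv ℝ (G k) z e) := by
      intro z
      by_cases hz : z ∈ tsupport χ
      · rw [fderiv_fun_mul (hχ.differentiable (by simp) z) (hG.differentiableAt hV k (hs hz))]
        simp only [add_apply, smul_apply, smul_eq_mul]
        ring
      · have h1 : fderiv ℝ (fun z => χ z * G k z) z e = 0 :=
          image_eq_zero_of_notMem_tsupport (f := fun w => fderiv ℝ (fun z => χ z * G k z) w e)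
            fun h => hz (tsupport_mul_subset_left (tsupport_fderiv_apply_subset _ e h))
        have h2 : fderiv ℝ χ z e = 0 := image_eq_zero_of_notMem_tsupport
          (f := fun w => fderiv ℝ χ w e) fun h => hz (tsupport_fderiv_apply_subset _ e h)
        rw [h1, h2, image_eq_zero_of_notMem_tsupport hz]; ring
    simp_rw [e1] at hp
    rw [integral_add i1 i2] at hp
    simp_rw [mul_assoc] at hp
    linarith
  obtain ⟨M, hM⟩ := hc.exists_bound_of_continuous hχ.continuous
  obtain ⟨M', hM'⟩ := hc'.exists_bound_of_continuous hχ'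
  have hN : 0 ≤ N := (abs_nonneg _).trans (hnb 0)
  have l1 : Tendsto (fun k => ∫ z, χ z * (n z * fderiv ℝ (G k) z e)) atTop
      (𝓝 (∫ z, χ z * (n z * g' z))) := by
    rw [← setIntegral_mul_eq_integral (w := fun z => n z * g' z) hs]
    simp_rw [fun k => (setIntegral_mul_eq_integral
      (w := fun z => n z * fderiv ℝ (G k) z e) hs).symm, ← mul_assoc]
    refine tendsto_integral_of_tendsto_integral_abs_sub ?_ ?_
      (tendsto_integral_abs_mul_sub (G := fun _ z => χ z * n z) (C := M * N) ?_ ?_ ?_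
        hG.integrable_fderiv hG.integrable hG.lim_fderiv)
    · intro k
      simp_rw [mul_assoc]
      exact (integrable_mul_of_tsupport_subset hχ.continuous hc hs
        (bm (hG.integrable_fderiv k))).integrableOn
    · simp_rw [mul_assoc]
      exact (integrable_mul_of_tsupport_subset hχ.continuous hc hs (bm hG.integrable)).integrableOn
    · exact fun k => hχ.continuous.aestronglyMeasurable.mul hnm
    · intro k
      refine Eventually.of_forall fun z => ?_
      rw [abs_mul]
      exact mul_le_mul (hM z) (hnb z) (abs_nonneg _) ((norm_nonneg _).trans (hM z))
    · exact Eventually.of_forall fun z => tendsto_const_nhds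
  have l2 : Tendsto (fun k => ∫ z, fderiv ℝ χ z e * (n z * G k z)) atTop
      (𝓝 (∫ z, fderiv ℝ χ z e * (n z * g z))) := by
    rw [← setIntegral_mul_eq_integral (w := fun z => n z * g z) hs']
    simp_rw [fun k => (setIntegral_mul_eq_integral (w := fun z => n z * G k z) hs').symm]
    refine tendsto_integral_of_dominated_convergence (fun _ => M' * (N * C)) ?_ ?_ ?_ ?_
    · exact fun k => hχ'.aestronglyMeasurable.mul (hnm.mul (hG.aestronglyMeasurable_seq hV k))
    · exact integrable_const _
    · intro k
      filter_upwards [hG.ae_bound_seq hV k] with z hz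
      rw [norm_mul, norm_mul]
      exact mul_le_mul (hM' z) (mul_le_mul (hnb z) hz (norm_nonneg _) hN) (by positivity)
        ((norm_nonneg _).trans (hM' z))
    · filter_upwards [hG.lim] with z hz using (hz.const_mul _).const_mul _
  have l3 : Tendsto (fun k => ∫ z, χ z * (G k z * n' z)) atTop
      (𝓝 (∫ z, χ z * (g z * n' z))) := by
    rw [← setIntegral_mul_eq_integral (w := fun z => g z * n' z) hs]
    simp_rw [fun k => (setIntegral_mul_eq_integral (w := fun z => G k z * n' z) hs).symm]
    refine tendsto_integral_of_dominated_convergence (fun z => M * (C * |n' z|)) ?_ ?_ ?_ ?_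
    · exact fun k => hχ.continuous.aestronglyMeasurable.mul
        ((hG.aestronglyMeasurable_seq hV k).mul hn'.1)
    · exact (hn'.abs.const_mul _).const_mul _
    · intro k
      filter_upwards [hG.ae_bound_seq hV k] with z hz
      rw [norm_mul, norm_mul]
      exact mul_le_mul (hM z) (mul_le_mul hz le_rfl (norm_nonneg _) hG.nonneg) (by positivity)
        ((norm_nonneg _).trans (hM z))
    · filter_upwards [hG.lim] with z hz using (hz.mul_const _).const_mul _
  simp_rw [key] at l2
  rw [tendsto_nhds_unique l2 (l3.add l1).neg, ← integral_add]
  · congr 1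
    refine integral_congr_ae (Eventually.of_forall fun z => ?_)
    simp only
    ring
  · exact integrable_mul_of_tsupport_subset hχ.continuous hc hs (hG.integrable_bdd_mul hV hn')
  · exact integrable_mul_of_tsupport_subset hχ.continuous hc hs (bm hG.integrable)

end

end CCM


/-! ### Mollification in the plane. -/

namespace CCM

open Filter Topology ContinuousLinearMap

/-- A sequence of smooth bumps shrinking to the origin of `ℂ`. -/
noncomputable def bump (k : ℕ) : ContDiffBump (0 : ℂ) where
  rIn := 1 / (k + 1)
  rOut := 2 / (k + 1)
  rIn_pos := by positivity
  rIn_lt_rOut := by gcongr; norm_num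

/-- All kernels live in one fixed ball, so mollifying moves supports and local bounds by at most
distance 2, uniformly in `k`. -/
theorem bump_rOut_le (k : ℕ) : (bump k).rOut ≤ 2 := by
  have : (0 : ℝ) ≤ k := k.cast_nonneg
  exact div_le_self (by norm_num) (by linarith)

theorem tendsto_bump_rOut : Tendsto (fun k => (bump k).rOut) atTop (𝓝 0) := by
  have := (tendsto_one_div_add_atTop_nhds_zero_nat (𝕜 := ℝ)).const_mul 2
  simpa [bump, div_eq_mul_inv] using this

/-- The mollification of `g` by the `k`-th bump. -/
noncomputable def moll (k : ℕ) (g : ℂ → ℝ) : ℂ → ℝ :=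
  convolution ((bump k).normed volume) g (lsmul ℝ ℝ) volume

section

variable {g : ℂ → ℝ} (k : ℕ)

theorem moll_apply (g : ℂ → ℝ) (z : ℂ) :
    moll k g z = ∫ y, (bump k).normed volume (z - y) * g y :=
  convolution_lsmul_swap

theorem contDiff_moll (hg : LocallyIntegrable g) : ContDiff ℝ ∞ (moll k g) :=
  (bump k).hasCompactSupport_normed.contDiff_convolution_left _ (bump k).contDiff_normed hg

/-- This is Lebesgue differentiation. It needs the outer radius of the bumps to be at most a fixed
multiple of the inner one; here the ratio is always 2. -/
theorem ae_tendsto_moll (hg : LocallyIntegrable g) :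
    ∀ᵐ z, Tendsto (fun k => moll k g z) atTop (𝓝 (g z)) :=
  ContDiffBump.ae_convolution_tendsto_right_of_locallyIntegrable (K := 2) tendsto_bump_rOut
    (Eventually.of_forall fun k => le_of_eq (by simp [bump, div_eq_mul_inv])) hg

theorem tendsto_moll_of_continuous (hg : Continuous g) (z : ℂ) :
    Tendsto (fun k => moll k g z) atTop (𝓝 (g z)) :=
  ContDiffBump.convolution_tendsto_right_of_continuous tendsto_bump_rOut hg z

theorem hasCompactSupport_moll (hg : HasCompactSupport g) : HasCompactSupport (moll k g) :=
  (bump k).hasCompactSupport_normed.convolution _ hg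

theorem integral_bump_sub (z : ℂ) : ∫ y, (bump k).normed volume (z - y) = 1 := by
  rw [integral_sub_left_eq_self (fun y => (bump k).normed volume y)]
  exact (bump k).integral_normed

theorem contDiff_bump_sub (z : ℂ) : ContDiff ℝ ∞ fun y => (bump k).normed volume (z - y) :=
  ContDiff.comp ((bump k).contDiff_normed) (contDiff_const.sub contDiff_id)

theorem hasCompactSupport_bump_sub (z : ℂ) :
    HasCompactSupport fun y => (bump k).normed volume (z - y) :=
  (bump k).hasCompactSupport_normed.comp_homeomorph (Homeomorph.subLeft z)

theorem integrable_bump_sub_mul (hg : LocallyIntegrable g) (z : ℂ) :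
    Integrable fun y => (bump k).normed volume (z - y) * g y :=
  hg.integrable_smul_left_of_hasCompactSupport (contDiff_bump_sub k z).continuous
    (hasCompactSupport_bump_sub k z)

theorem abs_moll_le {C : ℝ} (hg : LocallyIntegrable g) (hC : ∀ᵐ z, |g z| ≤ C) (z : ℂ) :
    |moll k g z| ≤ C := by
  rw [moll_apply]
  refine abs_integral_le_integral_abs.trans ?_
  have h1 : ∫ y, (bump k).normed volume (z - y) * C = C := by
    rw [integral_mul_const, integral_bump_sub, one_mul]
  rw [← h1]
  refine integral_mono_ae (integrable_bump_sub_mul k hg z).abs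
    (((contDiff_bump_sub k z).continuous.integrable_of_hasCompactSupport
      (hasCompactSupport_bump_sub k z)).mul_const _) ?_
  filter_upwards [hC] with y hy
  rw [abs_mul, abs_of_nonneg ((bump k).nonneg_normed _)]
  exact mul_le_mul_of_nonneg_left hy ((bump k).nonneg_normed _)

/-- The derivative falls on the kernel, and passing from z to y as variable in ρ(z - y) costs a
sign. In this form `g` is tested against the derivative of y ↦ ρ(z - y), which is the shape in which
weak derivatives are given. -/
theorem fderiv_moll (hg : LocallyIntegrable g) (z e : ℂ) :
    fderiv ℝ (moll k g) z e
      = - ∫ y, fderiv ℝ (fun y => (bump k).normed volume (z - y)) y e * g y := by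
  have hρ : ContDiff ℝ 1 ((bump k).normed (volume : Measure ℂ)) := (bump k).contDiff_normed
  have h1 := (bump k).hasCompactSupport_normed.hasFDerivAt_convolution_left (lsmul ℝ ℝ) hρ hg z
  have h2 : fderiv ℝ (moll k g) z = _ := h1.fderiv
  rw [h2, convolution_eq_swap, ContinuousLinearMap.integral_apply, ← integral_neg]
  · refine integral_congr_ae (Eventually.of_forall fun y => ?_)
    have h3 : HasFDerivAt (fun y => (bump k).normed volume (z - y))
        ((fderiv ℝ ((bump k).normed volume) (z - y)).comp (-ContinuousLinearMap.id ℝ ℂ)) y :=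
      (hρ.differentiable (by simp) (z - y)).hasFDerivAt.comp y
        ((hasFDerivAt_id y).const_sub z)
    simp only [h3.fderiv]
    simp [ContinuousLinearMap.precompL_apply]
  · have := ((bump k).hasCompactSupport_normed.fderiv ℝ).convolutionExists_left
      ((lsmul ℝ ℝ).precompL ℂ) (hρ.continuous_fderiv (by simp)) hg z
    exact this.integrable_swap

/-- A mollification differentiates a weak derivative. -/
theorem fderiv_moll_of_weak {g' : ℂ → ℝ} {e : ℂ} (hg : LocallyIntegrable g)
    (h : ∀ χ : ℂ → ℝ, ContDiff ℝ ∞ χ → HasCompactSupport χ →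
      ∫ z, fderiv ℝ χ z e * g z = - ∫ z, χ z * g' z) (z : ℂ) :
    fderiv ℝ (moll k g) z e = moll k g' z := by
  rw [fderiv_moll k hg, h _ (contDiff_bump_sub k z) (hasCompactSupport_bump_sub k z), neg_neg,
    moll_apply]

/-- Jensen's inequality, proved as non-negativity of a variance: the kernel is a probability density
and the mollified value is the mean m, so one expands the average of (g - m)². -/
theorem sq_moll_le (hg : LocallyIntegrable g) (hg2 : LocallyIntegrable fun z => g z ^ 2) (z : ℂ) :
    moll k g z ^ 2 ≤ moll k (fun z => g z ^ 2) z := by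
  set m := moll k g z with hm
  have i0 := (contDiff_bump_sub k z).continuous.integrable_of_hasCompactSupport (μ := volume)
      (hasCompactSupport_bump_sub k z)
  have i1 := integrable_bump_sub_mul k hg z
  have i2 := integrable_bump_sub_mul k hg2 z
  have h : 0 ≤ ∫ y, (bump k).normed volume (z - y) * (g y - m) ^ 2 :=
    integral_nonneg fun y => mul_nonneg ((bump k).nonneg_normed _) (sq_nonneg _)
  have e : ∀ y, (bump k).normed volume (z - y) * (g y - m) ^ 2
      = (bump k).normed volume (z - y) * g y ^ 2
        - 2 * m * ((bump k).normed volume (z - y) * g y)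
        + m ^ 2 * (bump k).normed volume (z - y) := fun y => by ring
  simp_rw [e] at h
  have i3 : Integrable fun y => (bump k).normed volume (z - y) * g y ^ 2
      - 2 * m * ((bump k).normed volume (z - y) * g y) := i2.sub (i1.const_mul _)
  rw [integral_add i3 (i0.const_mul _), integral_sub i2 (i1.const_mul _),
    integral_const_mul, integral_const_mul, integral_bump_sub, ← moll_apply, ← moll_apply,
    ← hm] at h
  nlinarith

theorem memLp_two_locallyIntegrable (hg : MemLp g 2) : LocallyIntegrable g :=
  hg.locallyIntegrable (by norm_num)

theorem integrable_moll (hg : Integrable g) : Integrable (moll k g) :=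
  Integrable.integrable_convolution (lsmul ℝ ℝ) (bump k).integrable_normed hg

theorem integrable_sq_moll (hg : MemLp g 2) : Integrable fun z => moll k g z ^ 2 := by
  have hg2 : Integrable fun z => g z ^ 2 := hg.integrable_sq
  have hl := memLp_two_locallyIntegrable hg
  refine (integrable_moll k hg2).mono' ((contDiff_moll k hl).continuous.pow 2).aestronglyMeasurable
    (Eventually.of_forall fun z => ?_)
  rw [Real.norm_of_nonneg (sq_nonneg _)]
  exact sq_moll_le k hl hg2.locallyIntegrable z

theorem memLp_moll (hg : MemLp g 2) : MemLp (moll k g) 2 :=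
  (memLp_two_iff_integrable_sq
    (contDiff_moll k (memLp_two_locallyIntegrable hg)).continuous.aestronglyMeasurable).2
    (integrable_sq_moll k hg)

theorem integral_sq_moll_le (hg : MemLp g 2) :
    ∫ z, moll k g z ^ 2 ≤ ∫ z, g z ^ 2 := by
  have hg2 : Integrable fun z => g z ^ 2 := hg.integrable_sq
  have hl := memLp_two_locallyIntegrable hg
  have h1 : ∫ z, moll k (fun z => g z ^ 2) z = ∫ z, g z ^ 2 := by
    unfold moll
    rw [integral_convolution (lsmul ℝ ℝ) (bump k).integrable_normed hg2,
      (bump k).integral_normed]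
    simp
  rw [← h1]
  exact integral_mono (integrable_sq_moll k hg) (integrable_moll k hg2)
    fun z => sq_moll_le k hl hg2.locallyIntegrable z

theorem moll_sub {h : ℂ → ℝ} (hg : LocallyIntegrable g) (hh : LocallyIntegrable h) (z : ℂ) :
    moll k (fun z => g z - h z) z = moll k g z - moll k h z := by
  simp_rw [moll_apply, mul_sub]
  exact integral_sub (integrable_bump_sub_mul k hg z) (integrable_bump_sub_mul k hh z)

/-- Everything vanishes outside the 2-neighbourhood of the support, where a constant dominates, and
convergence is pointwise by continuity. -/
theorem tendsto_integral_sq_moll_sub_of_continuous (hg : Continuous g)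
    (hc : HasCompactSupport g) :
    Tendsto (fun k => ∫ z, (moll k g z - g z) ^ 2) atTop (𝓝 0) := by
  obtain ⟨M, hM⟩ := hc.exists_bound_of_continuous hg
  set K : Set ℂ := Metric.cthickening 2 (tsupport g)
  have hK : IsCompact K := hc.isCompact.cthickening
  have hl : LocallyIntegrable g := hg.locallyIntegrable
  have hout : ∀ k, ∀ z, z ∉ K → moll k g z - g z = 0 := by
    intro k z hz
    have h1 : g z = 0 := by
      by_contra h
      exact hz (Metric.self_subset_cthickening _ (subset_tsupport _ h))
    have h2 : moll k g z = 0 := by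
      rw [moll_apply]
      refine integral_eq_zero_of_ae (Eventually.of_forall fun y => ?_)
      simp only [Pi.zero_apply, mul_eq_zero]
      by_contra! h
      have hy : z - y ∈ Metric.ball (0 : ℂ) (bump k).rOut := by
        rw [← (bump k).support_normed_eq (μ := volume)]
        exact h.1
      refine hz (Metric.mem_cthickening_of_dist_le z y 2 _ (subset_tsupport _ h.2) ?_)
      rw [dist_eq_norm]
      exact (mem_ball_zero_iff.1 hy).le.trans (bump_rOut_le k)
    rw [h1, h2, sub_zero]
  have h0 : (0 : ℝ) = ∫ _z : ℂ, (0 : ℝ) := by simp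
  rw [h0]
  refine tendsto_integral_of_dominated_convergence (K.indicator fun _ => (2 * M) ^ 2) ?_ ?_ ?_ ?_
  · exact fun k => (((contDiff_moll k hl).continuous.sub hg).pow 2).aestronglyMeasurable
  · rw [integrable_indicator_iff hK.measurableSet]
    exact integrableOn_const hK.measure_lt_top.ne
  · intro k
    refine Eventually.of_forall fun z => ?_
    by_cases hz : z ∈ K
    · rw [Set.indicator_of_mem hz, norm_pow]
      gcongr
      calc ‖moll k g z - g z‖ ≤ ‖moll k g z‖ + ‖g z‖ := norm_sub_le _ _
        _ ≤ M + M := add_le_add (abs_moll_le k hl (Eventually.of_forall hM) z) (hM z)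
        _ = 2 * M := by ring
    · rw [Set.indicator_of_notMem hz, hout k z hz]; simp
  · refine Eventually.of_forall fun z => ?_
    have := ((tendsto_moll_of_continuous hg z).sub_const (g z)).pow 2
    simpa using this

/-- Mollifications converge in `L²`. -/
theorem tendsto_integral_sq_moll_sub (hg : MemLp g 2) :
    Tendsto (fun k => ∫ z, (moll k g z - g z) ^ 2) atTop (𝓝 0) := by
  rw [Metric.tendsto_atTop]
  intro ε hε
  -- The three errors (mollified g - h, mollification of h, and g - h) each contribute at most ε/12.
  -- The square of a three-term sum is at most three times the sum of squares, so the total is below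
  -- 9ε/12 < ε.
  obtain ⟨h, hc, hle, hcont, hh⟩ := MemLp.exists_hasCompactSupport_integral_rpow_sub_le
    (μ := (volume : Measure ℂ)) (p := 2) (by norm_num) (f := g) (by simpa using hg)
    (ε := ε / 12) (by positivity)
  have hh2 : MemLp h 2 := by simpa using hh
  have hle' : ∫ z, (g z - h z) ^ 2 ≤ ε / 12 := by
    refine le_trans (le_of_eq ?_) hle
    refine integral_congr_ae (Eventually.of_forall fun z => ?_)
    simp
  have hgl := memLp_two_locallyIntegrable hg
  have hhl := memLp_two_locallyIntegrable hh2
  obtain ⟨N, hN⟩ := Metric.tendsto_atTop.1 (tendsto_integral_sq_moll_sub_of_continuous hcont hc)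
    (ε / 12) (by positivity)
  refine ⟨N, fun k hk => ?_⟩
  have hNk := hN k hk
  rw [Real.dist_0_eq_abs, abs_of_nonneg (integral_nonneg fun z => sq_nonneg _)] at hNk ⊢
  have hgh : MemLp (fun z => g z - h z) 2 := hg.sub hh2
  have i1 : Integrable fun z => moll k (fun z => g z - h z) z ^ 2 := integrable_sq_moll k hgh
  have i2 : Integrable fun z => (moll k h z - h z) ^ 2 :=
    ((memLp_moll k hh2).sub hh2).integrable_sq
  have i3 : Integrable fun z => (g z - h z) ^ 2 := hgh.integrable_sq
  have i4 : Integrable fun z => (moll k g z - g z) ^ 2 :=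
    ((memLp_moll k hg).sub hg).integrable_sq
  have i5 : Integrable fun z => moll k (fun z => g z - h z) z ^ 2 + (moll k h z - h z) ^ 2 :=
    i1.add i2
  have hb := integral_sq_moll_le k hgh
  calc ∫ z, (moll k g z - g z) ^ 2
      ≤ ∫ z, 3 * (moll k (fun z => g z - h z) z ^ 2 + (moll k h z - h z) ^ 2
          + (g z - h z) ^ 2) := by
        refine integral_mono i4 ((i5.add i3).const_mul _) fun z => ?_
        simp only [moll_sub k hgl hhl]
        nlinarith [sq_nonneg (moll k g z - moll k h z - (moll k h z - h z)),
          sq_nonneg (moll k g z - moll k h z + (g z - h z)),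
          sq_nonneg ((moll k h z - h z) + (g z - h z))]
    _ = 3 * ((∫ z, moll k (fun z => g z - h z) z ^ 2) + (∫ z, (moll k h z - h z) ^ 2)
          + ∫ z, (g z - h z) ^ 2) := by
        rw [integral_const_mul, integral_add i5 i3, integral_add i1 i2]
    _ < ε := by linarith

end

/-- A Lipschitz function is differentiable in the sense of approximation. -/
theorem hasApproxDeriv_of_lipschitz {v : ℂ → ℝ} {L : NNReal} (hv : LipschitzWith L v) {V : Set ℂ}
    (hb : Bornology.IsBounded V) (e : ℂ) :
    HasApproxDeriv V e v (fun z => fderiv ℝ v z e) ∧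
      (∀ χ : ℂ → ℝ, ContDiff ℝ ∞ χ → HasCompactSupport χ →
        ∫ z, fderiv ℝ χ z e * v z = - ∫ z, χ z * fderiv ℝ v z e) := by
  have hweak : ∀ χ : ℂ → ℝ, ContDiff ℝ ∞ χ → HasCompactSupport χ →
        ∫ z, fderiv ℝ χ z e * v z = - ∫ z, χ z * fderiv ℝ v z e := by
    intro χ hχ hc
    obtain ⟨D, hD⟩ := hχ.lipschitzWith_of_hasCompactSupport hc (by simp)
    have h := hv.integral_lineDeriv_mul_eq (μ := volume) hD hc e
    have e1 : ∫ z, lineDeriv ℝ v z e * χ z = ∫ z, χ z * fderiv ℝ v z e := by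
      refine integral_congr_ae ?_
      filter_upwards [hv.ae_differentiableAt] with z hz
      rw [hz.lineDeriv_eq_fderiv, mul_comm]
    have e2 : ∫ z, lineDeriv ℝ χ z (-e) * v z = - ∫ z, fderiv ℝ χ z e * v z := by
      rw [← integral_neg]
      refine integral_congr_ae (Eventually.of_forall fun z => ?_)
      simp only
      rw [(hχ.differentiable (by simp) z).lineDeriv_eq_fderiv, map_neg, neg_mul]
    rw [e1, e2] at h
    linarith
  refine ⟨?_, hweak⟩
  have hvl : LocallyIntegrable v := hv.continuous.locallyIntegrable
  have hbd : ∀ z, |fderiv ℝ v z e| ≤ L * ‖e‖ := fun z =>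
    ((fderiv ℝ v z).le_opNorm e).trans
      (mul_le_mul_of_nonneg_right (norm_fderiv_le_of_lipschitz ℝ hv) (norm_nonneg _))
  have hdm : AEStronglyMeasurable (fun z => fderiv ℝ v z e) volume :=
    (measurable_fderiv_apply_const ℝ v e).aestronglyMeasurable
  have hdl : LocallyIntegrable (fun z => fderiv ℝ v z e) :=
    (memLp_top_of_bound hdm (L * ‖e‖) (Eventually.of_forall hbd)).locallyIntegrable le_top
  have hfin : IsFiniteMeasure (volume.restrict V) := ⟨by simpa using hb.measure_lt_top⟩
  have hfd : ∀ k z, fderiv ℝ (moll k v) z e = moll k (fun z => fderiv ℝ v z e) z := fun k z =>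
    fderiv_moll_of_weak k hvl hweak z
  have hfb : ∀ k z, |fderiv ℝ (moll k v) z e| ≤ L * ‖e‖ := fun k z => by
    rw [hfd]
    exact abs_moll_le k hdl (Eventually.of_forall hbd) z
  have hfm : ∀ k, AEStronglyMeasurable (fun z => fderiv ℝ (moll k v) z e) volume := fun k =>
    (measurable_fderiv_apply_const ℝ (moll k v) e).aestronglyMeasurable
  obtain ⟨R, hR⟩ := hb.subset_closedBall 0
  obtain ⟨M, hM⟩ := (isCompact_closedBall (0 : ℂ) (R + 2)).exists_bound_of_continuousOn
    hv.continuous.continuousOn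
  -- `v` need not be bounded on the plane. For z in `V`, inside the ball of radius R, the average
  -- only sees points of the ball of radius R + 2, where continuity gives the bound M.
  have hmb : ∀ k, ∀ z ∈ V, |moll k v z| ≤ max M 0 := by
    intro k z hz
    rw [moll_apply]
    refine abs_integral_le_integral_abs.trans ?_
    have h1 : ∫ y, (bump k).normed volume (z - y) * max M 0 = max M 0 := by
      rw [integral_mul_const, integral_bump_sub, one_mul]
    rw [← h1]
    refine integral_mono_ae (integrable_bump_sub_mul k hvl z).abs
      (((contDiff_bump_sub k z).continuous.integrable_of_hasCompactSupport
        (hasCompactSupport_bump_sub k z)).mul_const _) (Eventually.of_forall fun y => ?_)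
    simp only
    rw [abs_mul, abs_of_nonneg ((bump k).nonneg_normed _)]
    by_cases hy : z - y ∈ Metric.ball (0 : ℂ) (bump k).rOut
    · refine mul_le_mul_of_nonneg_left ((hM y ?_).trans (le_max_left _ _))
        ((bump k).nonneg_normed _)
      rw [mem_closedBall_zero_iff]
      have h1 : ‖z - y‖ ≤ 2 := (mem_ball_zero_iff.1 hy).le.trans (bump_rOut_le k)
      have h2 : ‖z‖ ≤ R := mem_closedBall_zero_iff.1 (hR hz)
      calc ‖y‖ = ‖z - (z - y)‖ := by simp
        _ ≤ ‖z‖ + ‖z - y‖ := norm_sub_le _ _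
        _ ≤ R + 2 := add_le_add h2 h1
    · have : (bump k).normed volume (z - y) = 0 := by
        rw [← (bump k).support_normed_eq (μ := volume)] at hy
        simpa using hy
      simp [this]
  refine ⟨fun k => moll k v, max M 0, le_max_right _ _, fun k => (contDiff_moll k hvl).contDiffOn,
    hmb, ae_restrict_of_ae (ae_tendsto_moll hvl), ?_, fun k => ?_, ?_⟩
  · exact Integrable.of_bound hdm.restrict _ (Eventually.of_forall hbd)
  · exact Integrable.of_bound (hfm k).restrict _ (Eventually.of_forall (hfb k))
  · have h0 : (0 : ℝ) = ∫ z in V, (0 : ℝ) := by simp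
    rw [h0]
    refine tendsto_integral_of_dominated_convergence (fun _ => 2 * (L * ‖e‖)) ?_ ?_ ?_ ?_
    · exact fun k => ((hfm k).sub hdm).norm.restrict
    · exact integrable_const _
    · intro k
      refine Eventually.of_forall fun z => ?_
      rw [Real.norm_eq_abs, abs_abs]
      refine (abs_sub _ _).trans ?_
      linarith [hfb k z, hbd z]
    · refine ae_restrict_of_ae ?_
      filter_upwards [ae_tendsto_moll hdl] with z hz
      simp_rw [hfd]
      have := (hz.sub_const (fderiv ℝ v z e)).abs
      simpa using this

end CCM


/-! ### The div–curl estimate in L². -/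

namespace CCM

open Filter Topology ContinuousLinearMap

theorem norm_toLp_sq {f : ℂ → ℝ} (hf : MemLp f 2) : ‖hf.toLp f‖ ^ 2 = ∫ z, f z ^ 2 := by
  rw [← real_inner_self_eq_norm_sq, L2.inner_def]
  refine integral_congr_ae ?_
  filter_upwards [hf.coeFn_toLp] with z hz
  rw [hz]
  simp [sq]

/-- `L²` is complete, and `L²` convergence implies `L¹` convergence on sets of finite measure. -/
theorem exists_tendsto_of_integral_sq_sub_le {f : ℕ → ℂ → ℝ} {c : ℕ → ℝ}
    (hf : ∀ k, MemLp (f k) 2) (hc : Tendsto c atTop (𝓝 0))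
    (hle : ∀ k l, ∫ z, (f k z - f l z) ^ 2 ≤ c k + c l) :
    ∃ b : ℂ → ℝ, MemLp b 2 ∧ ∀ V : Set ℂ, volume V ≠ ⊤ →
      Tendsto (fun k => ∫ z in V, |f k z - b z|) atTop (𝓝 0) := by
  have hcau : CauchySeq fun k => (hf k).toLp (f k) := by
    rw [Metric.cauchySeq_iff]
    intro ε hε
    obtain ⟨N, hN⟩ := Metric.tendsto_atTop.1 hc (ε ^ 2 / 2) (by positivity)
    refine ⟨N, fun k hk l hl => ?_⟩
    have hk' := (le_abs_self _).trans_lt (by simpa using hN k hk)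
    have hl' := (le_abs_self _).trans_lt (by simpa using hN l hl)
    rw [dist_eq_norm, ← MemLp.toLp_sub]
    refine lt_of_pow_lt_pow_left₀ 2 hε.le ?_
    rw [norm_toLp_sq]
    refine lt_of_le_of_lt (hle k l) ?_
    linarith
  obtain ⟨b, hb⟩ := cauchySeq_tendsto_of_complete hcau
  refine ⟨b, Lp.memLp b, fun V hV => ?_⟩
  have h1 : Tendsto (fun k => eLpNorm (fun z => f k z - b z) 2 volume) atTop (𝓝 0) := by
    have := (Lp.tendsto_Lp_iff_tendsto_eLpNorm' _ _).1 hb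
    refine this.congr fun k => eLpNorm_congr_ae ?_
    filter_upwards [(hf k).coeFn_toLp] with z hz
    simp [hz]
  have hm : ∀ k, AEStronglyMeasurable (fun z => f k z - b z) volume :=
    fun k => ((hf k).sub (Lp.memLp b)).1
  have h2 : Tendsto (fun k => eLpNorm (fun z => f k z - b z) 1 (volume.restrict V)) atTop
      (𝓝 0) := by
    have h3 : Tendsto (fun k => eLpNorm (fun z => f k z - b z) 2 volume *
        (volume.restrict V) Set.univ ^ (1 / (1 : ENNReal).toReal - 1 / (2 : ENNReal).toReal))
        atTop (𝓝 0) := by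
      have := ENNReal.Tendsto.mul_const (b := (volume.restrict V) Set.univ ^
        (1 / (1 : ENNReal).toReal - 1 / (2 : ENNReal).toReal)) h1
        (Or.inr (ENNReal.rpow_ne_top_of_nonneg (by norm_num) (by simpa using hV)))
      simpa using this
    refine tendsto_of_tendsto_of_tendsto_of_le_of_le tendsto_const_nhds h3 (fun k => zero_le)
      fun k => ?_
    refine (eLpNorm_le_eLpNorm_mul_rpow_measure_univ (p := 1) (q := 2) (by norm_num)
      (hm k).restrict).trans ?_
    gcongr
    exact Measure.restrict_le_self
  have h4 := (ENNReal.tendsto_toReal ENNReal.zero_ne_top).comp h2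
  refine h4.congr fun k => ?_
  simp only [Function.comp_apply, eLpNorm_one_eq_lintegral_enorm]
  rw [← integral_norm_eq_lintegral_enorm (hm k).restrict]
  rfl

theorem fderiv_fderiv_apply_comm {a : ℂ → ℝ} (ha : ContDiff ℝ ∞ a) (z v w : ℂ) :
    fderiv ℝ (fun z => fderiv ℝ a z v) z w = fderiv ℝ (fun z => fderiv ℝ a z w) z v := by
  have hd : DifferentiableAt ℝ (fderiv ℝ a) z :=
    ((ha.fderiv_right (m := ∞) (by simp)).differentiable (by simp)) z
  have hsymm : IsSymmSndFDerivAt ℝ a z :=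
    ha.contDiffAt.isSymmSndFDerivAt (by simpa using WithTop.coe_le_coe.2 (le_top (a := (2 : ℕ∞))))
  rw [fderiv_clm_apply hd (by fun_prop), fderiv_clm_apply hd (by fun_prop)]
  simpa using hsymm w v

/-- The Jacobian determinant is a null Lagrangian: after one integration by parts both sides contain
a mixed second derivative of b, and these agree. -/
theorem integral_fderiv_mul_fderiv_comm {a b : ℂ → ℝ} (ha : ContDiff ℝ ∞ a)
    (hb : ContDiff ℝ ∞ b) (hca : HasCompactSupport a) (v w : ℂ) :
    ∫ z, fderiv ℝ a z v * fderiv ℝ b z w = ∫ z, fderiv ℝ a z w * fderiv ℝ b z v := by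
  have hd : ∀ {f : ℂ → ℝ}, ContDiff ℝ ∞ f → Differentiable ℝ f :=
    fun hf => hf.differentiable (by simp)
  have hi : ∀ {f g : ℂ → ℝ}, ContDiff ℝ ∞ f → ContDiff ℝ ∞ g → HasCompactSupport f →
      Integrable fun z => f z * g z := fun hf hg hcf =>
    (hf.continuous.mul hg.continuous).integrable_of_hasCompactSupport hcf.mul_right
  have h : ∀ v w : ℂ, ∫ z, fderiv ℝ a z v * fderiv ℝ b z w
      = - ∫ z, a z * fderiv ℝ (fun z => fderiv ℝ b z w) z v := by
    intro v w
    have hbw := contDiff_fderiv_apply hb w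
    rw [integral_mul_fderiv_eq_neg_fderiv_mul_of_integrable (f := a)
      (hi (contDiff_fderiv_apply ha v) hbw (hasCompactSupport_fderiv_apply hca v))
      (hi ha (contDiff_fderiv_apply hbw v) hca) (hi ha hbw hca) (fun z _ => hd ha z)
      (fun z _ => hd hbw z), neg_neg]
  rw [h v w, h w v]
  simp_rw [fderiv_fderiv_apply_comm hb]

/-- The `L²` norm of the full differential of a compactly supported vector field is controlled by
divergence and curl. -/
theorem integral_sq_fderiv_le {a b : ℂ → ℝ} (ha : ContDiff ℝ ∞ a)
    (hb : ContDiff ℝ ∞ b) (hca : HasCompactSupport a) (hcb : HasCompactSupport b) :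
    (∫ z, fderiv ℝ a z 1 ^ 2) + (∫ z, fderiv ℝ a z Complex.I ^ 2) + (∫ z, fderiv ℝ b z 1 ^ 2)
        + (∫ z, fderiv ℝ b z Complex.I ^ 2)
      = (∫ z, (fderiv ℝ a z 1 + fderiv ℝ b z Complex.I) ^ 2)
        + ∫ z, (fderiv ℝ b z 1 - fderiv ℝ a z Complex.I) ^ 2 := by
  have hi : ∀ {f g : ℂ → ℝ}, ContDiff ℝ ∞ f → ContDiff ℝ ∞ g → HasCompactSupport f →
      HasCompactSupport g → ∀ v w, Integrable fun z => fderiv ℝ f z v * fderiv ℝ g z w :=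
    fun hf hg hcf hcg v w => ((contDiff_fderiv_apply hf v).continuous.mul
      (contDiff_fderiv_apply hg w).continuous).integrable_of_hasCompactSupport
        (hasCompactSupport_fderiv_apply hcf v).mul_right
  have e1 : ∀ z, (fderiv ℝ a z 1 + fderiv ℝ b z Complex.I) ^ 2
      = fderiv ℝ a z 1 * fderiv ℝ a z 1
        + 2 * (fderiv ℝ a z 1 * fderiv ℝ b z Complex.I)
        + fderiv ℝ b z Complex.I * fderiv ℝ b z Complex.I := fun z => by ring
  have e2 : ∀ z, (fderiv ℝ b z 1 - fderiv ℝ a z Complex.I) ^ 2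
      = fderiv ℝ b z 1 * fderiv ℝ b z 1
        - 2 * (fderiv ℝ a z Complex.I * fderiv ℝ b z 1)
        + fderiv ℝ a z Complex.I * fderiv ℝ a z Complex.I := fun z => by ring
  have i1 := hi ha ha hca hca 1 1
  have i2 := (hi ha hb hca hcb 1 Complex.I).const_mul 2
  have i3 := hi hb hb hcb hcb Complex.I Complex.I
  have i4 := hi hb hb hcb hcb 1 1
  have i5 := (hi ha hb hca hcb Complex.I 1).const_mul 2
  have i6 := hi ha ha hca hca Complex.I Complex.I
  have i12 : Integrable fun z => fderiv ℝ a z 1 * fderiv ℝ a z 1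
        + 2 * (fderiv ℝ a z 1 * fderiv ℝ b z Complex.I) := i1.add i2
  have i45 : Integrable fun z => fderiv ℝ b z 1 * fderiv ℝ b z 1
        - 2 * (fderiv ℝ a z Complex.I * fderiv ℝ b z 1) := i4.sub i5
  simp_rw [e1, e2]
  -- The cross terms 2 ∂₁a ∂₂b from the divergence and -2 ∂₂a ∂₁b from the curl cancel after
  -- integration.
  rw [integral_add i12 i3, integral_add i1 i2, integral_add i45 i6, integral_sub i4 i5,
    integral_const_mul, integral_const_mul,
    integral_fderiv_mul_fderiv_comm ha hb hca 1 Complex.I]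
  simp_rw [sq]
  ring

/-- Two free directions let one lemma serve both the divergence, with directions 1 and i, and the
curl, with directions 1 and -i and the components swapped. -/
theorem fderiv_moll_add_fderiv_moll {q₁ q₂ g : ℂ → ℝ} (hq₁ : LocallyIntegrable q₁)
    (hq₂ : LocallyIntegrable q₂) {v w : ℂ}
    (h : ∀ χ : ℂ → ℝ, ContDiff ℝ ∞ χ → HasCompactSupport χ →
      ∫ z, (fderiv ℝ χ z v * q₁ z + fderiv ℝ χ z w * q₂ z) = - ∫ z, χ z * g z) (k : ℕ) (z : ℂ) :
    fderiv ℝ (moll k q₁) z v + fderiv ℝ (moll k q₂) z w = moll k g z := by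
  have hρ := contDiff_bump_sub k z
  have hρc := hasCompactSupport_bump_sub k z
  have hi : ∀ {q : ℂ → ℝ} (v : ℂ), LocallyIntegrable q → Integrable fun y =>
      fderiv ℝ (fun y => (bump k).normed volume (z - y)) y v * q y := fun v hq =>
    hq.integrable_smul_left_of_hasCompactSupport (contDiff_fderiv_apply hρ v).continuous
      (hasCompactSupport_fderiv_apply hρc v)
  have h1 := h _ hρ hρc
  rw [integral_add (hi v hq₁) (hi w hq₂), ← moll_apply] at h1
  rw [fderiv_moll k hq₁, fderiv_moll k hq₂]
  linarith

/-- A bounded, compactly supported vector field whose weak divergence and curl are in `L²` is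
differentiable in the sense of approximation. -/
theorem exists_hasApproxDeriv_of_div_curl {q₁ q₂ gd gc : ℂ → ℝ} {C : ℝ}
    (hm₁ : AEStronglyMeasurable q₁ volume) (hm₂ : AEStronglyMeasurable q₂ volume)
    (hb₁ : ∀ z, |q₁ z| ≤ C) (hb₂ : ∀ z, |q₂ z| ≤ C)
    (hc₁ : HasCompactSupport q₁) (hc₂ : HasCompactSupport q₂)
    (hgd : MemLp gd 2) (hgc : MemLp gc 2)
    (hdiv : ∀ χ : ℂ → ℝ, ContDiff ℝ ∞ χ → HasCompactSupport χ →
      ∫ z, (fderiv ℝ χ z 1 * q₁ z + fderiv ℝ χ z Complex.I * q₂ z) = - ∫ z, χ z * gd z)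
    (hcurl : ∀ χ : ℂ → ℝ, ContDiff ℝ ∞ χ → HasCompactSupport χ →
      ∫ z, (fderiv ℝ χ z 1 * q₂ z + fderiv ℝ χ z (-Complex.I) * q₁ z) = - ∫ z, χ z * gc z) :
    ∃ b₁₁ b₂₁ b₁₂ b₂₂ : ℂ → ℝ, ∀ V : Set ℂ, volume V ≠ ⊤ →
      HasApproxDeriv V 1 q₁ b₁₁ ∧ HasApproxDeriv V Complex.I q₁ b₂₁ ∧
      HasApproxDeriv V 1 q₂ b₁₂ ∧ HasApproxDeriv V Complex.I q₂ b₂₂ := by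
  have hl₁ : LocallyIntegrable q₁ :=
    (memLp_top_of_bound hm₁ C (Eventually.of_forall hb₁)).locallyIntegrable le_top
  have hl₂ : LocallyIntegrable q₂ :=
    (memLp_top_of_bound hm₂ C (Eventually.of_forall hb₂)).locallyIntegrable le_top
  have hs₁ := fun k => contDiff_moll k hl₁
  have hs₂ := fun k => contDiff_moll k hl₂
  have hk₁ := fun k => hasCompactSupport_moll k hc₁
  have hk₂ := fun k => hasCompactSupport_moll k hc₂
  set c : ℕ → ℝ := fun k => 2 * (∫ z, (moll k gd z - gd z) ^ 2)
    + 2 * ∫ z, (moll k gc z - gc z) ^ 2 with hc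
  have hc0 : Tendsto c atTop (𝓝 0) := by
    have := ((tendsto_integral_sq_moll_sub hgd).const_mul 2).add
      ((tendsto_integral_sq_moll_sub hgc).const_mul 2)
    simpa using this
  have hsub : ∀ {g : ℂ → ℝ}, MemLp g 2 → ∀ k l, ∫ z, (moll k g z - moll l g z) ^ 2
      ≤ 2 * (∫ z, (moll k g z - g z) ^ 2) + 2 * ∫ z, (moll l g z - g z) ^ 2 := by
    intro g hg k l
    have i : ∀ k, Integrable fun z => (moll k g z - g z) ^ 2 :=
      fun k => ((memLp_moll k hg).sub hg).integrable_sq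
    rw [← integral_const_mul, ← integral_const_mul,
      ← integral_add ((i k).const_mul _) ((i l).const_mul _)]
    refine integral_mono ((memLp_moll k hg).sub (memLp_moll l hg)).integrable_sq
      (((i k).const_mul _).add ((i l).const_mul _)) fun z => ?_
    simp only
    nlinarith [sq_nonneg (moll k g z - g z + (moll l g z - g z))]
  have hml : ∀ {q : ℂ → ℝ}, ContDiff ℝ ∞ q → HasCompactSupport q → ∀ e,
      MemLp (fun z => fderiv ℝ q z e) 2 := fun hq hcq e =>
    (contDiff_fderiv_apply hq e).continuous.memLp_of_hasCompactSupport
      (hasCompactSupport_fderiv_apply hcq e)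
  have hfs : ∀ {p q : ℂ → ℝ}, ContDiff ℝ ∞ p → ContDiff ℝ ∞ q → ∀ z e,
      fderiv ℝ (fun z => p z - q z) z e = fderiv ℝ p z e - fderiv ℝ q z e := by
    intro p q hp hq z e
    rw [fderiv_fun_sub (hp.differentiable (by simp) z) (hq.differentiable (by simp) z)]
    rfl
  -- Only the divergence and the curl of the mollified field are known to converge. The integral
  -- identity, applied to the difference of two mollifications, makes each of the four partial
  -- derivatives Cauchy in L²; completeness then produces the derivatives of the limit.
  have hmain : ∀ k l,
      (∫ z, (fderiv ℝ (moll k q₁) z 1 - fderiv ℝ (moll l q₁) z 1) ^ 2)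
      + (∫ z, (fderiv ℝ (moll k q₁) z Complex.I - fderiv ℝ (moll l q₁) z Complex.I) ^ 2)
      + (∫ z, (fderiv ℝ (moll k q₂) z 1 - fderiv ℝ (moll l q₂) z 1) ^ 2)
      + (∫ z, (fderiv ℝ (moll k q₂) z Complex.I - fderiv ℝ (moll l q₂) z Complex.I) ^ 2)
      ≤ c k + c l := by
    intro k l
    have h := integral_sq_fderiv_le ((hs₁ k).sub (hs₁ l)) ((hs₂ k).sub (hs₂ l))
      ((hk₁ k).sub (hk₁ l)) ((hk₂ k).sub (hk₂ l))
    simp only [hfs (hs₁ k) (hs₁ l), hfs (hs₂ k) (hs₂ l)] at h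
    have e1 : ∀ z, fderiv ℝ (moll k q₁) z 1 - fderiv ℝ (moll l q₁) z 1
        + (fderiv ℝ (moll k q₂) z Complex.I - fderiv ℝ (moll l q₂) z Complex.I)
        = moll k gd z - moll l gd z := by
      intro z
      rw [← fderiv_moll_add_fderiv_moll hl₁ hl₂ hdiv k z,
        ← fderiv_moll_add_fderiv_moll hl₁ hl₂ hdiv l z]
      ring
    have e2 : ∀ z, fderiv ℝ (moll k q₂) z 1 - fderiv ℝ (moll l q₂) z 1
        - (fderiv ℝ (moll k q₁) z Complex.I - fderiv ℝ (moll l q₁) z Complex.I)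
        = moll k gc z - moll l gc z := by
      intro z
      rw [← fderiv_moll_add_fderiv_moll hl₂ hl₁ hcurl k z,
        ← fderiv_moll_add_fderiv_moll hl₂ hl₁ hcurl l z]
      simp only [map_neg]
      ring
    simp only [e1, e2] at h
    rw [h]
    have := hsub hgd k l
    have := hsub hgc k l
    simp only [hc]
    linarith
  have nn : ∀ f : ℂ → ℝ, 0 ≤ ∫ z, f z ^ 2 := fun f => integral_nonneg fun z => sq_nonneg _
  obtain ⟨b₁₁, m₁₁, l₁₁⟩ := exists_tendsto_of_integral_sq_sub_le
    (fun k => hml (hs₁ k) (hk₁ k) 1) hc0 fun k l => by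
      have := hmain k l
      have := nn fun z => fderiv ℝ (moll k q₁) z Complex.I - fderiv ℝ (moll l q₁) z Complex.I
      have := nn fun z => fderiv ℝ (moll k q₂) z 1 - fderiv ℝ (moll l q₂) z 1
      have := nn fun z => fderiv ℝ (moll k q₂) z Complex.I - fderiv ℝ (moll l q₂) z Complex.I
      linarith
  obtain ⟨b₂₁, m₂₁, l₂₁⟩ := exists_tendsto_of_integral_sq_sub_le
    (fun k => hml (hs₁ k) (hk₁ k) Complex.I) hc0 fun k l => by
      have := hmain k l
      have := nn fun z => fderiv ℝ (moll k q₁) z 1 - fderiv ℝ (moll l q₁) z 1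
      have := nn fun z => fderiv ℝ (moll k q₂) z 1 - fderiv ℝ (moll l q₂) z 1
      have := nn fun z => fderiv ℝ (moll k q₂) z Complex.I - fderiv ℝ (moll l q₂) z Complex.I
      linarith
  obtain ⟨b₁₂, m₁₂, l₁₂⟩ := exists_tendsto_of_integral_sq_sub_le
    (fun k => hml (hs₂ k) (hk₂ k) 1) hc0 fun k l => by
      have := hmain k l
      have := nn fun z => fderiv ℝ (moll k q₁) z 1 - fderiv ℝ (moll l q₁) z 1
      have := nn fun z => fderiv ℝ (moll k q₁) z Complex.I - fderiv ℝ (moll l q₁) z Complex.I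
      have := nn fun z => fderiv ℝ (moll k q₂) z Complex.I - fderiv ℝ (moll l q₂) z Complex.I
      linarith
  obtain ⟨b₂₂, m₂₂, l₂₂⟩ := exists_tendsto_of_integral_sq_sub_le
    (fun k => hml (hs₂ k) (hk₂ k) Complex.I) hc0 fun k l => by
      have := hmain k l
      have := nn fun z => fderiv ℝ (moll k q₁) z 1 - fderiv ℝ (moll l q₁) z 1
      have := nn fun z => fderiv ℝ (moll k q₁) z Complex.I - fderiv ℝ (moll l q₁) z Complex.I
      have := nn fun z => fderiv ℝ (moll k q₂) z 1 - fderiv ℝ (moll l q₂) z 1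
      linarith
  have hC : 0 ≤ C := (abs_nonneg _).trans (hb₁ 0)
  have fin : ∀ {q b : ℂ → ℝ} {e : ℂ}, LocallyIntegrable q → HasCompactSupport q →
      (∀ z, |q z| ≤ C) → MemLp b 2 →
      (∀ V : Set ℂ, volume V ≠ ⊤ →
        Tendsto (fun k => ∫ z in V, |fderiv ℝ (moll k q) z e - b z|) atTop (𝓝 0)) →
      ∀ V : Set ℂ, volume V ≠ ⊤ → HasApproxDeriv V e q b := by
    intro q b e hq hcq hbq hb hl V hV
    have : IsFiniteMeasure (volume.restrict V) := ⟨by simpa using hV.lt_top⟩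
    refine ⟨fun k => moll k q, C, hC, fun k => (contDiff_moll k hq).contDiffOn,
      fun k z _ => abs_moll_le k hq (Eventually.of_forall hbq) z,
      ae_restrict_of_ae (ae_tendsto_moll hq), ?_, fun k => ?_, hl V hV⟩
    · exact (hb.restrict V).integrable (by norm_num)
    · exact ((hml (contDiff_moll k hq) (hasCompactSupport_moll k hcq) e).restrict V).integrable
        (by norm_num)
  exact ⟨b₁₁, b₂₁, b₁₂, b₂₂, fun V hV => ⟨fin hl₁ hc₁ hb₁ m₁₁ l₁₁ V hV,
    fin hl₁ hc₁ hb₁ m₂₁ l₂₁ V hV, fin hl₂ hc₂ hb₂ m₁₂ l₁₂ V hV, fin hl₂ hc₂ hb₂ m₂₂ l₂₂ V hV⟩⟩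

end CCM


/-! ### Weak curl, weak Laplacian and local L² second derivatives. -/

namespace CCM

open Filter Topology ContinuousLinearMap

/-- The cutoff equals 1 on an open neighbourhood of `K`, not merely on `K`: the calculus of
approximate derivatives is applied on open sets, and there the localised function must agree with
the original. -/
theorem exists_cutoff {K V : Set ℂ} (hK : IsCompact K) (hV : IsOpen V) (hKV : K ⊆ V) :
    ∃ ζ : ℂ → ℝ, ∃ W : Set ℂ, ContDiff ℝ ∞ ζ ∧ HasCompactSupport ζ ∧ tsupport ζ ⊆ V ∧
      IsOpen W ∧ K ⊆ W ∧ W ⊆ V ∧ ∀ z ∈ W, ζ z = 1 := by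
  obtain ⟨t, ht, hKt, htV⟩ := exists_compact_between hK hV hKV
  obtain ⟨f, hf1, hf0, -⟩ := exists_contMDiffMap_one_nhds_of_subset_interior (n := ⊤) 𝓘(ℝ, ℂ)
    hK.isClosed hKt
  obtain ⟨W, hWo, hKW, hW⟩ := mem_nhdsSet_iff_exists.1 hf1
  have hts : tsupport f ⊆ t := closure_minimal (fun z hz => by
    by_contra h
    exact hz (hf0 z h)) ht.isClosed
  refine ⟨f, W ∩ V, f.contMDiff.contDiff, HasCompactSupport.of_support_subset_isCompact ht
    ((subset_tsupport _).trans hts), hts.trans htV, hWo.inter hV, Set.subset_inter hKW hKV,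
    Set.inter_subset_right, fun z hz => hW hz.1⟩

section

variable {V : Set ℂ} {w : ℂ → ℝ} {L : NNReal}

theorem abs_fderiv_apply_le_of_lipschitz (hw : LipschitzWith L w) (z e : ℂ) :
    |fderiv ℝ w z e| ≤ L * ‖e‖ :=
  ((fderiv ℝ w z).le_opNorm e).trans
    (mul_le_mul_of_nonneg_right (norm_fderiv_le_of_lipschitz ℝ hw) (norm_nonneg _))

theorem integral_fderiv_mul_of_lipschitz (hw : LipschitzWith L w) (e : ℂ) {χ : ℂ → ℝ}
    (hχ : ContDiff ℝ ∞ χ) (hc : HasCompactSupport χ) :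
    ∫ z, fderiv ℝ χ z e * w z = - ∫ z, χ z * fderiv ℝ w z e :=
  (hasApproxDeriv_of_lipschitz hw (V := ∅) Bornology.isBounded_empty e).2 χ hχ hc

theorem aestronglyMeasurable_fderiv_apply (w : ℂ → ℝ) (e : ℂ) :
    AEStronglyMeasurable (fun z => fderiv ℝ w z e) volume :=
  (measurable_fderiv_apply_const ℝ w e).aestronglyMeasurable

theorem memLp_mul_fderiv_of_lipschitz (hw : LipschitzWith L w) (e : ℂ) {ζ : ℂ → ℝ}
    (hζ : Continuous ζ) (hc : HasCompactSupport ζ) : MemLp (fun z => ζ z * fderiv ℝ w z e) 2 := by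
  have h1 : MemLp ζ 2 := hζ.memLp_of_hasCompactSupport hc
  have h2 : MemLp (fun z => fderiv ℝ w z e) ⊤ := memLp_top_of_bound
    (aestronglyMeasurable_fderiv_apply w e) _
    (Eventually.of_forall (abs_fderiv_apply_le_of_lipschitz hw · e))
  exact h2.mul h1

/-- The differential of a Lipschitz function is weakly curl free. -/
theorem integral_curl_eq_zero (hw : LipschitzWith L w) (e f : ℂ) {χ : ℂ → ℝ}
    (hχ : ContDiff ℝ ∞ χ) (hc : HasCompactSupport χ) :
    ∫ z, fderiv ℝ χ z e * fderiv ℝ w z f = ∫ z, fderiv ℝ χ z f * fderiv ℝ w z e := by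
  have h1 := integral_fderiv_mul_of_lipschitz hw f (contDiff_fderiv_apply hχ e)
    (hasCompactSupport_fderiv_apply hc e)
  have h2 := integral_fderiv_mul_of_lipschitz hw e (contDiff_fderiv_apply hχ f)
    (hasCompactSupport_fderiv_apply hc f)
  simp_rw [fderiv_fderiv_apply_comm hχ _ e f] at h1
  linarith

/-- Products of a weakly differentiable function with the differential of a Lipschitz function:
the divergence of `n ∇^⊥ w` is `∇ n · ∇^⊥ w`. -/
theorem integral_mul_curl (hw : LipschitzWith L w) {n n₁ n₂ : ℂ → ℝ}
    (hvol : volume V ≠ ⊤)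
    (hnm : AEStronglyMeasurable n (volume.restrict V)) {N : ℝ} (hnb : ∀ z, |n z| ≤ N)
    (hn₁ : IntegrableOn n₁ V) (hn₂ : IntegrableOn n₂ V) {e f : ℂ}
    (h₁ : ∀ χ : ℂ → ℝ, ContDiff ℝ ∞ χ → HasCompactSupport χ → tsupport χ ⊆ V →
      ∫ z, fderiv ℝ χ z e * n z = - ∫ z, χ z * n₁ z)
    (h₂ : ∀ χ : ℂ → ℝ, ContDiff ℝ ∞ χ → HasCompactSupport χ → tsupport χ ⊆ V →
      ∫ z, fderiv ℝ χ z f * n z = - ∫ z, χ z * n₂ z)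
    {χ : ℂ → ℝ} (hχ : ContDiff ℝ ∞ χ) (hc : HasCompactSupport χ) (hs : tsupport χ ⊆ V) :
    ∫ z, n z * (fderiv ℝ χ z f * fderiv ℝ w z e - fderiv ℝ χ z e * fderiv ℝ w z f)
      = - ∫ z, χ z * (n₂ z * fderiv ℝ w z e - n₁ z * fderiv ℝ w z f) := by
  have : IsFiniteMeasure (volume.restrict V) := ⟨by simpa using hvol.lt_top⟩
  have hwl : LocallyIntegrable w := hw.continuous.locallyIntegrable
  have hN : 0 ≤ N := (abs_nonneg _).trans (hnb 0)
  have hdl : ∀ e, LocallyIntegrable (fun z => fderiv ℝ w z e) := fun e =>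
    (memLp_top_of_bound (aestronglyMeasurable_fderiv_apply w e) _ (Eventually.of_forall
      (abs_fderiv_apply_le_of_lipschitz hw · e))).locallyIntegrable le_top
  have hfd : ∀ k z e, fderiv ℝ (moll k w) z e = moll k (fun z => fderiv ℝ w z e) z :=
    fun k z e => fderiv_moll_of_weak k hwl
      (fun χ hχ hc => integral_fderiv_mul_of_lipschitz hw e hχ hc) z
  have hfb : ∀ k z e, |fderiv ℝ (moll k w) z e| ≤ L * ‖e‖ := fun k z e => by
    rw [hfd]
    exact abs_moll_le k (hdl e) (Eventually.of_forall (abs_fderiv_apply_le_of_lipschitz hw · e)) z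
  have hlim : ∀ e, ∀ᵐ z, Tendsto (fun k => fderiv ℝ (moll k w) z e) atTop
      (𝓝 (fderiv ℝ w z e)) := fun e => by
    simp_rw [hfd]
    exact ae_tendsto_moll (hdl e)
  have hsm : ∀ k e, ContDiff ℝ ∞ fun z => fderiv ℝ (moll k w) z e := fun k e =>
    contDiff_fderiv_apply (contDiff_moll k hwl) e
  obtain ⟨M, hM⟩ := hc.exists_bound_of_continuous hχ.continuous
  have hM0 : 0 ≤ M := (norm_nonneg _).trans (hM 0)
  -- the identity for the mollified function
  have key : ∀ k, ∫ z in V, n z * (fderiv ℝ χ z f * fderiv ℝ (moll k w) z e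
        - fderiv ℝ χ z e * fderiv ℝ (moll k w) z f)
      = - ∫ z in V, χ z * (n₂ z * fderiv ℝ (moll k w) z e - n₁ z * fderiv ℝ (moll k w) z f) := by
    intro k
    have hp : ∀ e, ContDiff ℝ ∞ (fun z => χ z * fderiv ℝ (moll k w) z e) := fun e =>
      hχ.mul (hsm k e)
    have hpc : ∀ e, HasCompactSupport (fun z => χ z * fderiv ℝ (moll k w) z e) := fun e =>
      hc.mul_right
    have hps : ∀ e, tsupport (fun z => χ z * fderiv ℝ (moll k w) z e) ⊆ V := fun e =>
      tsupport_mul_subset_left.trans hs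
    -- The derivatives of `n` are tested against χ ∂_e w_k and χ ∂_f w_k, with w_k the
    -- mollification. On subtraction the second derivatives of w_k cancel by symmetry, so only first
    -- derivatives, bounded uniformly in `k`, enter the limit.
    have k1 := h₂ _ (hp e) (hpc e) (hps e)
    have k2 := h₁ _ (hp f) (hpc f) (hps f)
    have ni : IntegrableOn n V := Integrable.of_bound hnm N (Eventually.of_forall hnb)
    have i1 := integrable_mul_of_tsupport_subset (contDiff_fderiv_apply (hp e) f).continuous
      (hasCompactSupport_fderiv_apply (hpc e) f)
      ((tsupport_fderiv_apply_subset _ f).trans (hps e)) ni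
    have i2 := integrable_mul_of_tsupport_subset (contDiff_fderiv_apply (hp f) e).continuous
      (hasCompactSupport_fderiv_apply (hpc f) e)
      ((tsupport_fderiv_apply_subset _ e).trans (hps f)) ni
    have i3 := integrable_mul_of_tsupport_subset (hp e).continuous (hpc e) (hps e) hn₂
    have i4 := integrable_mul_of_tsupport_subset (hp f).continuous (hpc f) (hps f) hn₁
    rw [setIntegral_eq_integral_of_forall_compl_eq_zero,
      setIntegral_eq_integral_of_forall_compl_eq_zero]
    · have e1 : ∀ z, n z * (fderiv ℝ χ z f * fderiv ℝ (moll k w) z e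
          - fderiv ℝ χ z e * fderiv ℝ (moll k w) z f)
          = fderiv ℝ (fun z => χ z * fderiv ℝ (moll k w) z e) z f * n z
            - fderiv ℝ (fun z => χ z * fderiv ℝ (moll k w) z f) z e * n z := by
        intro z
        rw [fderiv_fun_mul (hχ.differentiable (by simp) z) ((hsm k e).differentiable (by simp) z),
          fderiv_fun_mul (hχ.differentiable (by simp) z) ((hsm k f).differentiable (by simp) z)]
        simp only [add_apply, smul_apply, smul_eq_mul]
        rw [fderiv_fderiv_apply_comm (contDiff_moll k hwl) z e f]
        ring
      have e2 : ∀ z, χ z * (n₂ z * fderiv ℝ (moll k w) z e - n₁ z * fderiv ℝ (moll k w) z f)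
          = χ z * fderiv ℝ (moll k w) z e * n₂ z - χ z * fderiv ℝ (moll k w) z f * n₁ z :=
        fun z => by ring
      simp_rw [e1, e2]
      rw [integral_sub i1 i2, integral_sub i3 i4, k1, k2]
      ring
    · intro z hz
      rw [image_eq_zero_of_notMem_tsupport (fun h => hz (hs h)), zero_mul]
    · intro z hz
      have h0 : ∀ e, fderiv ℝ χ z e = 0 := fun e => image_eq_zero_of_notMem_tsupport
        (f := fun w => fderiv ℝ χ w e) fun h => hz (hs (tsupport_fderiv_apply_subset _ e h))
      rw [h0, h0]; ring
  have hχb : ∀ e, ∃ M', 0 ≤ M' ∧ ∀ z, |fderiv ℝ χ z e| ≤ M' := by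
    intro e
    obtain ⟨M', hM'⟩ := (hasCompactSupport_fderiv_apply hc e).exists_bound_of_continuous
      (contDiff_fderiv_apply hχ e).continuous
    exact ⟨M', (norm_nonneg _).trans (hM' 0), hM'⟩
  obtain ⟨Me, hMe0, hMe⟩ := hχb e
  obtain ⟨Mf, hMf0, hMf⟩ := hχb f
  have l1 : Tendsto (fun k => ∫ z in V, n z * (fderiv ℝ χ z f * fderiv ℝ (moll k w) z e
        - fderiv ℝ χ z e * fderiv ℝ (moll k w) z f)) atTop
      (𝓝 (∫ z in V, n z * (fderiv ℝ χ z f * fderiv ℝ w z e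
        - fderiv ℝ χ z e * fderiv ℝ w z f))) := by
    refine tendsto_integral_of_dominated_convergence
      (fun _ => N * (Mf * (L * ‖e‖) + Me * (L * ‖f‖))) ?_ ?_ ?_ ?_
    · exact fun k => hnm.mul (((contDiff_fderiv_apply hχ f).continuous.mul
        (hsm k e).continuous).sub ((contDiff_fderiv_apply hχ e).continuous.mul
        (hsm k f).continuous)).aestronglyMeasurable
    · exact integrable_const _
    · intro k
      refine Eventually.of_forall fun z => ?_
      rw [norm_mul]
      refine mul_le_mul (hnb z) ((norm_sub_le _ _).trans ?_) (norm_nonneg _) hN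
      rw [norm_mul, norm_mul]
      exact add_le_add (mul_le_mul (hMf z) (hfb k z e) (norm_nonneg _) hMf0)
        (mul_le_mul (hMe z) (hfb k z f) (norm_nonneg _) hMe0)
    · refine ae_restrict_of_ae ?_
      filter_upwards [hlim e, hlim f] with z h1 h2
      exact ((h1.const_mul _).sub (h2.const_mul _)).const_mul _
  have l2 : Tendsto (fun k => ∫ z in V, χ z * (n₂ z * fderiv ℝ (moll k w) z e
        - n₁ z * fderiv ℝ (moll k w) z f)) atTop
      (𝓝 (∫ z in V, χ z * (n₂ z * fderiv ℝ w z e - n₁ z * fderiv ℝ w z f))) := by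
    refine tendsto_integral_of_dominated_convergence
      (fun z => M * (|n₂ z| * (L * ‖e‖) + |n₁ z| * (L * ‖f‖))) ?_ ?_ ?_ ?_
    · exact fun k => hχ.continuous.aestronglyMeasurable.mul
        ((hn₂.1.mul (hsm k e).continuous.aestronglyMeasurable).sub
          (hn₁.1.mul (hsm k f).continuous.aestronglyMeasurable))
    · exact ((hn₂.abs.mul_const _).add (hn₁.abs.mul_const _)).const_mul _
    · intro k
      refine Eventually.of_forall fun z => ?_
      rw [norm_mul]
      refine mul_le_mul (hM z) ((norm_sub_le _ _).trans ?_) (norm_nonneg _) hM0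
      rw [norm_mul, norm_mul]
      exact add_le_add (mul_le_mul_of_nonneg_left (hfb k z e) (abs_nonneg _))
        (mul_le_mul_of_nonneg_left (hfb k z f) (abs_nonneg _))
    · refine ae_restrict_of_ae ?_
      filter_upwards [hlim e, hlim f] with z h1 h2
      exact ((h1.const_mul _).sub (h2.const_mul _)).const_mul _
  simp_rw [key] at l1
  have := tendsto_nhds_unique l1 l2.neg
  rwa [setIntegral_eq_integral_of_forall_compl_eq_zero,
      setIntegral_eq_integral_of_forall_compl_eq_zero] at this
  · intro z hz
    rw [image_eq_zero_of_notMem_tsupport (fun h => hz (hs h)), zero_mul]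
  · intro z hz
    have h0 : ∀ e, fderiv ℝ χ z e = 0 := fun e => image_eq_zero_of_notMem_tsupport
      (f := fun w => fderiv ℝ χ w e) fun h => hz (hs (tsupport_fderiv_apply_subset _ e h))
    rw [h0, h0]; ring

/-- Local version of the regularity statement for a function with weak Laplacian in `L²`. -/
theorem exists_hasApproxDeriv_fderiv_of_laplacian (hw : LipschitzWith L w) (hV : IsOpen V)
    (hvol : volume V ≠ ⊤) {Δ : ℂ → ℝ} (hΔ : MemLp Δ 2 (volume.restrict V))
    (hlap : ∀ χ : ℂ → ℝ, ContDiff ℝ ∞ χ → HasCompactSupport χ → tsupport χ ⊆ V →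
      ∫ z, (fderiv ℝ χ z 1 * fderiv ℝ w z 1 + fderiv ℝ χ z Complex.I * fderiv ℝ w z Complex.I)
        = - ∫ z, χ z * Δ z)
    {ζ : ℂ → ℝ} (hζ : ContDiff ℝ ∞ ζ) (hζc : HasCompactSupport ζ) (hζs : tsupport ζ ⊆ V)
    {W : Set ℂ} (hWo : IsOpen W) (hWV : W ⊆ V) (hζ1 : ∀ z ∈ W, ζ z = 1) :
    ∃ b₁₁ b₂₁ b₁₂ b₂₂ : ℂ → ℝ,
      HasApproxDeriv W 1 (fun z => fderiv ℝ w z 1) b₁₁ ∧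
      HasApproxDeriv W Complex.I (fun z => fderiv ℝ w z 1) b₂₁ ∧
      HasApproxDeriv W 1 (fun z => fderiv ℝ w z Complex.I) b₁₂ ∧
      HasApproxDeriv W Complex.I (fun z => fderiv ℝ w z Complex.I) b₂₂ := by
  obtain ⟨M, hM⟩ := hζc.exists_bound_of_continuous hζ.continuous
  have hM0 : 0 ≤ M := (norm_nonneg _).trans (hM 0)
  have hqb : ∀ (z e : ℂ), ‖e‖ = 1 → |ζ z * fderiv ℝ w z e| ≤ M * L := by
    intro z e he
    rw [abs_mul]
    have := abs_fderiv_apply_le_of_lipschitz hw z e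
    rw [he, mul_one] at this
    exact mul_le_mul (hM z) this (abs_nonneg _) hM0
  have hζΔ : MemLp (fun z => ζ z * V.indicator Δ z) 2 :=
    ((memLp_indicator_iff_restrict hV.measurableSet).2 hΔ).mul
      (memLp_top_of_bound hζ.continuous.aestronglyMeasurable M (Eventually.of_forall hM))
  have hd : ∀ v e, MemLp (fun z => fderiv ℝ ζ z v * fderiv ℝ w z e) 2 := fun v e =>
    memLp_mul_fderiv_of_lipschitz hw e (contDiff_fderiv_apply hζ v).continuous
      (hasCompactSupport_fderiv_apply hζc v)
  have hint : ∀ {χ η : ℂ → ℝ} (e : ℂ), ContDiff ℝ ∞ χ → ContDiff ℝ ∞ η → HasCompactSupport η →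
      Integrable fun z => χ z * (η z * fderiv ℝ w z e) := by
    intro χ η e hχ hη hηc
    have hc : HasCompactSupport fun z => χ z * η z := hηc.mul_left
    have h1 := memLp_mul_fderiv_of_lipschitz hw e (hχ.continuous.mul hη.continuous) hc
    have h2 : LocallyIntegrable (fun z => fderiv ℝ w z e) :=
      (memLp_top_of_bound (aestronglyMeasurable_fderiv_apply w e) _ (Eventually.of_forall
      (abs_fderiv_apply_le_of_lipschitz hw · e))).locallyIntegrable le_top
    have h3 := h2.integrable_smul_left_of_hasCompactSupport (hχ.continuous.mul hη.continuous) hc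
    simpa [mul_assoc] using h3
  have hprod : ∀ {χ : ℂ → ℝ}, ContDiff ℝ ∞ χ → ∀ z e,
      fderiv ℝ (fun z => χ z * ζ z) z e = fderiv ℝ χ z e * ζ z + χ z * fderiv ℝ ζ z e := by
    intro χ hχ z e
    rw [fderiv_fun_mul (hχ.differentiable (by simp) z) (hζ.differentiable (by simp) z)]
    simp only [add_apply, smul_apply, smul_eq_mul]
    ring
  -- The field is ζ∇w. Its divergence is ζΔ + ∇ζ · ∇w, and its curl is the cross term of ∇ζ and ∇w
  -- since ∇w is curl free. Both are in L²; the indicator is there because Δ is controlled only on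
  -- `V`.
  obtain ⟨b₁₁, b₂₁, b₁₂, b₂₂, hb⟩ := exists_hasApproxDeriv_of_div_curl
    (q₁ := fun z => ζ z * fderiv ℝ w z 1) (q₂ := fun z => ζ z * fderiv ℝ w z Complex.I)
    (gd := fun z => ζ z * V.indicator Δ z + (fderiv ℝ ζ z 1 * fderiv ℝ w z 1
      + fderiv ℝ ζ z Complex.I * fderiv ℝ w z Complex.I))
    (gc := fun z => fderiv ℝ ζ z 1 * fderiv ℝ w z Complex.I
      - fderiv ℝ ζ z Complex.I * fderiv ℝ w z 1) (C := M * L)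
    (hζ.continuous.aestronglyMeasurable.mul (aestronglyMeasurable_fderiv_apply w _))
    (hζ.continuous.aestronglyMeasurable.mul (aestronglyMeasurable_fderiv_apply w _))
    (fun z => hqb z 1 (by simp)) (fun z => hqb z Complex.I (by simp)) hζc.mul_right hζc.mul_right
    (hζΔ.add ((hd _ _).add (hd _ _))) ((hd _ _).sub (hd _ _))
    (fun χ hχ hc => by
      have h := hlap (fun z => χ z * ζ z) (hχ.mul hζ) hc.mul_right
        (tsupport_mul_subset_right.trans hζs)
      simp_rw [hprod hχ] at h
      have i1 : Integrable fun z => fderiv ℝ χ z 1 * (ζ z * fderiv ℝ w z 1)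
          + fderiv ℝ χ z Complex.I * (ζ z * fderiv ℝ w z Complex.I) :=
        (hint 1 (contDiff_fderiv_apply hχ 1) hζ hζc).add
          (hint Complex.I (contDiff_fderiv_apply hχ Complex.I) hζ hζc)
      have i2 : Integrable fun z => χ z * (fderiv ℝ ζ z 1 * fderiv ℝ w z 1)
          + χ z * (fderiv ℝ ζ z Complex.I * fderiv ℝ w z Complex.I) :=
        (hint 1 hχ (contDiff_fderiv_apply hζ 1) (hasCompactSupport_fderiv_apply hζc 1)).add
          (hint Complex.I hχ (contDiff_fderiv_apply hζ Complex.I)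
            (hasCompactSupport_fderiv_apply hζc Complex.I))
      have e1 : ∀ z, (fderiv ℝ χ z 1 * ζ z + χ z * fderiv ℝ ζ z 1) * fderiv ℝ w z 1
          + (fderiv ℝ χ z Complex.I * ζ z + χ z * fderiv ℝ ζ z Complex.I)
            * fderiv ℝ w z Complex.I
          = (fderiv ℝ χ z 1 * (ζ z * fderiv ℝ w z 1)
              + fderiv ℝ χ z Complex.I * (ζ z * fderiv ℝ w z Complex.I))
            + (χ z * (fderiv ℝ ζ z 1 * fderiv ℝ w z 1)
              + χ z * (fderiv ℝ ζ z Complex.I * fderiv ℝ w z Complex.I)) := fun z => by ring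
      simp_rw [e1] at h
      rw [integral_add i1 i2] at h
      have e2 : ∀ z, χ z * (ζ z * V.indicator Δ z + (fderiv ℝ ζ z 1 * fderiv ℝ w z 1
          + fderiv ℝ ζ z Complex.I * fderiv ℝ w z Complex.I))
          = χ z * ζ z * Δ z + (χ z * (fderiv ℝ ζ z 1 * fderiv ℝ w z 1)
          + χ z * (fderiv ℝ ζ z Complex.I * fderiv ℝ w z Complex.I)) := by
        intro z
        have : ζ z * V.indicator Δ z = ζ z * Δ z := by
          by_cases hz : z ∈ V
          · rw [Set.indicator_of_mem hz]
          · rw [image_eq_zero_of_notMem_tsupport (fun h => hz (hζs h)), zero_mul, zero_mul]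
        rw [this]; ring
      have : IsFiniteMeasure (volume.restrict V) := ⟨by simpa using hvol.lt_top⟩
      have i3 : Integrable fun z => χ z * ζ z * Δ z :=
        integrable_mul_of_tsupport_subset (hχ.continuous.mul hζ.continuous) hc.mul_right
          (tsupport_mul_subset_right.trans hζs) (hΔ.integrable (by norm_num))
      simp_rw [e2]
      rw [integral_add i3 i2]
      linarith)
    (fun χ hχ hc => by
      have h := integral_curl_eq_zero hw 1 Complex.I (hχ.mul hζ) hc.mul_right
      simp_rw [hprod hχ, add_mul] at h
      have j1 := hint Complex.I (contDiff_fderiv_apply hχ 1) hζ hζc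
      have j2 := hint Complex.I hχ (contDiff_fderiv_apply hζ 1)
        (hasCompactSupport_fderiv_apply hζc 1)
      have j3 := hint 1 (contDiff_fderiv_apply hχ Complex.I) hζ hζc
      have j4 := hint 1 hχ (contDiff_fderiv_apply hζ Complex.I)
        (hasCompactSupport_fderiv_apply hζc Complex.I)
      simp_rw [mul_assoc] at h
      rw [integral_add j1 j2, integral_add j3 j4] at h
      simp only [map_neg, neg_mul, mul_sub, ← sub_eq_add_neg]
      rw [integral_sub j1 j3, integral_sub j2 j4]
      linarith)
  have hWvol : volume W ≠ ⊤ := ne_top_of_le_ne_top hvol (measure_mono hWV)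
  have hcongr : ∀ e : ℂ, ∀ᵐ z ∂(volume.restrict W), fderiv ℝ w z e = ζ z * fderiv ℝ w z e := by
    intro e
    filter_upwards [ae_restrict_mem hWo.measurableSet] with z hz
    rw [hζ1 z hz, one_mul]
  obtain ⟨h1, h2, h3, h4⟩ := hb W hWvol
  exact ⟨b₁₁, b₂₁, b₁₂, b₂₂, h1.congr (hcongr _) (Eventually.of_forall fun _ => rfl),
    h2.congr (hcongr _) (Eventually.of_forall fun _ => rfl),
    h3.congr (hcongr _) (Eventually.of_forall fun _ => rfl),
    h4.congr (hcongr _) (Eventually.of_forall fun _ => rfl)⟩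

end

end CCM


/-! ### Conformal surfaces with W^{1,2} normal: second derivatives and the divergence equation. -/

namespace CCM

open Filter Topology

/-- A conformally parametrised Lipschitz surface `w` in `ℝ³` over `V ⊆ ℂ`, in components, with
unit normal `n`, whose weak derivatives `n₁`, `n₂` are square integrable. -/
structure IsConformalSurface (V : Set ℂ) (w n n₁ n₂ : Fin 3 → ℂ → ℝ) : Prop where
  isOpen : IsOpen V
  volume_ne_top : volume V ≠ ⊤
  lipschitz : ∃ L : NNReal, ∀ c, LipschitzWith L (w c)
  measurable_normal : ∀ c, AEStronglyMeasurable (n c) (volume.restrict V)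
  abs_normal_le : ∀ c z, |n c z| ≤ 1
  memLp₁ : ∀ c, MemLp (n₁ c) 2 (volume.restrict V)
  memLp₂ : ∀ c, MemLp (n₂ c) 2 (volume.restrict V)
  weak₁ : ∀ c, ∀ χ : ℂ → ℝ, ContDiff ℝ ∞ χ → HasCompactSupport χ → tsupport χ ⊆ V →
    ∫ z, fderiv ℝ χ z 1 * n c z = - ∫ z, χ z * n₁ c z
  weak₂ : ∀ c, ∀ χ : ℂ → ℝ, ContDiff ℝ ∞ χ → HasCompactSupport χ → tsupport χ ⊆ V →
    ∫ z, fderiv ℝ χ z Complex.I * n c z = - ∫ z, χ z * n₂ c z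
  pos : ∀ᵐ z ∂(volume.restrict V), 0 < ∑ c, fderiv ℝ (w c) z 1 * fderiv ℝ (w c) z 1
  conformal : ∀ᵐ z ∂(volume.restrict V),
    ∑ c, fderiv ℝ (w c) z 1 * fderiv ℝ (w c) z 1
      = ∑ c, fderiv ℝ (w c) z Complex.I * fderiv ℝ (w c) z Complex.I
  orthogonal : ∀ᵐ z ∂(volume.restrict V),
    ∑ c, fderiv ℝ (w c) z 1 * fderiv ℝ (w c) z Complex.I = 0
  normal₁ : ∀ᵐ z ∂(volume.restrict V), ∑ c, n c z * fderiv ℝ (w c) z 1 = 0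
  normal₂ : ∀ᵐ z ∂(volume.restrict V), ∑ c, n c z * fderiv ℝ (w c) z Complex.I = 0
  rotate₁ : ∀ᵐ z ∂(volume.restrict V), ∀ c, fderiv ℝ (w c) z Complex.I
    = n (c + 1) z * fderiv ℝ (w (c + 2)) z 1 - n (c + 2) z * fderiv ℝ (w (c + 1)) z 1
  rotate₂ : ∀ᵐ z ∂(volume.restrict V), ∀ c, - fderiv ℝ (w c) z 1
    = n (c + 1) z * fderiv ℝ (w (c + 2)) z Complex.I
      - n (c + 2) z * fderiv ℝ (w (c + 1)) z Complex.I

theorem ae_eq_zero_of_integral_mul_eq_zero {V : Set ℂ} (hV : IsOpen V) {f : ℂ → ℝ}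
    (hf : IntegrableOn f V)
    (h : ∀ χ : ℂ → ℝ, ContDiff ℝ ∞ χ → HasCompactSupport χ → tsupport χ ⊆ V →
      ∫ z, χ z * f z = 0) : ∀ᵐ z ∂(volume.restrict V), f z = 0 := by
  rw [ae_restrict_iff' hV.measurableSet]
  exact hV.ae_eq_zero_of_integral_contDiff_smul_eq_zero hf.locallyIntegrableOn h

/-- If `∑ n_c g_c = 0`, this identity can be differentiated. -/
theorem ae_sum_deriv_eq_zero {V : Set ℂ} (hV : IsOpen V) (hvol : volume V ≠ ⊤) {e : ℂ}
    {n n' g g' : Fin 3 → ℂ → ℝ} (hg : ∀ c, HasApproxDeriv V e (g c) (g' c))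
    (hnm : ∀ c, AEStronglyMeasurable (n c) (volume.restrict V)) (hnb : ∀ c z, |n c z| ≤ 1)
    (hn' : ∀ c, IntegrableOn (n' c) V)
    (hn : ∀ c, ∀ χ : ℂ → ℝ, ContDiff ℝ ∞ χ → HasCompactSupport χ → tsupport χ ⊆ V →
      ∫ z, fderiv ℝ χ z e * n c z = - ∫ z, χ z * n' c z)
    (h0 : ∀ᵐ z ∂(volume.restrict V), ∑ c, n c z * g c z = 0) :
    ∀ᵐ z ∂(volume.restrict V), ∑ c, (n' c z * g c z + n c z * g' c z) = 0 := by
  have i1 : ∀ c, IntegrableOn (fun z => n' c z * g c z + n c z * g' c z) V := fun c => by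
    have hi : IntegrableOn (fun z => n' c z * g c z) V := by
      simpa only [mul_comm] using (hg c).integrable_mul hV (hn' c)
    exact hi.add (Integrable.bdd_mul (hg c).integrable (hnm c) (Eventually.of_forall (hnb c)))
  have i2 : ∀ c, IntegrableOn (fun z => n c z * g c z) V := fun c =>
    Integrable.bdd_mul ((hg c).integrableOn hV hvol) (hnm c) (Eventually.of_forall (hnb c))
  refine ae_eq_zero_of_integral_mul_eq_zero hV (integrable_finsetSum _ fun c _ => i1 c)
    fun χ hχ hc hs => ?_
  have hs' := (tsupport_fderiv_apply_subset χ e).trans hs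
  have hc' := hasCompactSupport_fderiv_apply hc e
  have hχ' := (contDiff_fderiv_apply hχ e).continuous
  simp_rw [Finset.mul_sum]
  rw [integral_finsetSum _ fun c _ =>
    integrable_mul_of_tsupport_subset hχ.continuous hc hs (i1 c)]
  have h1 : ∑ c, ∫ z, fderiv ℝ χ z e * (n c z * g c z) = 0 := by
    rw [← integral_finsetSum _ fun c _ =>
      integrable_mul_of_tsupport_subset hχ' hc' hs' (i2 c)]
    simp_rw [← Finset.mul_sum]
    rw [← setIntegral_mul_eq_integral hs']
    refine integral_eq_zero_of_ae ?_
    filter_upwards [h0] with z hz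
    simp [hz]
  rw [← neg_eq_zero, ← Finset.sum_neg_distrib, ← h1]
  refine Finset.sum_congr rfl fun c _ => ?_
  rw [(hg c).integral_fderiv_mul_mul hV hvol (hnm c) (hnb c) (hn' c) (hn c) hχ hc hs]

namespace IsConformalSurface

variable {V : Set ℂ} {w n n₁ n₂ : Fin 3 → ℂ → ℝ}

theorem mono (h : IsConformalSurface V w n n₁ n₂) {W : Set ℂ} (hW : IsOpen W) (hWV : W ⊆ V) :
    IsConformalSurface W w n n₁ n₂ where
  isOpen := hW
  volume_ne_top := ne_top_of_le_ne_top h.volume_ne_top (measure_mono hWV)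
  lipschitz := h.lipschitz
  measurable_normal c := (h.measurable_normal c).mono_set hWV
  abs_normal_le := h.abs_normal_le
  memLp₁ c := (h.memLp₁ c).mono_measure (Measure.restrict_mono hWV le_rfl)
  memLp₂ c := (h.memLp₂ c).mono_measure (Measure.restrict_mono hWV le_rfl)
  weak₁ c χ h1 h2 h3 := h.weak₁ c χ h1 h2 (h3.trans hWV)
  weak₂ c χ h1 h2 h3 := h.weak₂ c χ h1 h2 (h3.trans hWV)
  pos := ae_restrict_of_ae_restrict_of_subset hWV h.pos
  conformal := ae_restrict_of_ae_restrict_of_subset hWV h.conformal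
  orthogonal := ae_restrict_of_ae_restrict_of_subset hWV h.orthogonal
  normal₁ := ae_restrict_of_ae_restrict_of_subset hWV h.normal₁
  normal₂ := ae_restrict_of_ae_restrict_of_subset hWV h.normal₂
  rotate₁ := ae_restrict_of_ae_restrict_of_subset hWV h.rotate₁
  rotate₂ := ae_restrict_of_ae_restrict_of_subset hWV h.rotate₂

theorem isFiniteMeasure (h : IsConformalSurface V w n n₁ n₂) :
    IsFiniteMeasure (volume.restrict V) :=
  ⟨by simpa using h.volume_ne_top.lt_top⟩

/-- The Laplacian of a conformal parametrisation, computed by differentiating `∇^⊥w = n × ∇w`. -/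
theorem exists_laplacian (h : IsConformalSurface V w n n₁ n₂) (c : Fin 3) :
    ∃ Δ : ℂ → ℝ, MemLp Δ 2 (volume.restrict V) ∧
      ∀ χ : ℂ → ℝ, ContDiff ℝ ∞ χ → HasCompactSupport χ → tsupport χ ⊆ V →
      ∫ z, (fderiv ℝ χ z 1 * fderiv ℝ (w c) z 1
        + fderiv ℝ χ z Complex.I * fderiv ℝ (w c) z Complex.I) = - ∫ z, χ z * Δ z := by
  obtain ⟨L, hL⟩ := h.lipschitz
  have := h.isFiniteMeasure
  have hm : ∀ (c : Fin 3) (e : ℂ) {m : ℂ → ℝ}, MemLp m 2 (volume.restrict V) →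
      MemLp (fun z => m z * fderiv ℝ (w c) z e) 2 (volume.restrict V) := by
    intro c e m hm
    have h2 : MemLp (fun z => fderiv ℝ (w c) z e) ⊤ (volume.restrict V) := memLp_top_of_bound
      (aestronglyMeasurable_fderiv_apply (w c) e).restrict _
      (Eventually.of_forall (abs_fderiv_apply_le_of_lipschitz (hL c) · e))
    exact h2.mul hm
  -- This is the rotated pairing of ∇n_i with ∇w_j, in L² because ∇n is square integrable and ∇w is
  -- bounded. The Laplacian of w is the cross product built from these terms.
  set D : Fin 3 → Fin 3 → ℂ → ℝ := fun i j z =>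
    n₂ i z * fderiv ℝ (w j) z 1 - n₁ i z * fderiv ℝ (w j) z Complex.I with hD
  have hDm : ∀ i j, MemLp (D i j) 2 (volume.restrict V) := fun i j =>
    (hm j 1 (h.memLp₂ i)).sub (hm j Complex.I (h.memLp₁ i))
  refine ⟨fun z => D (c + 1) (c + 2) z - D (c + 2) (c + 1) z, (hDm _ _).sub (hDm _ _),
    fun χ hχ hc hs => ?_⟩
  have hs' := fun e => (tsupport_fderiv_apply_subset χ e).trans hs
  have hc' := hasCompactSupport_fderiv_apply hc
  have hχ' := fun e => (contDiff_fderiv_apply hχ e).continuous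
  set G : Fin 3 → Fin 3 → ℂ → ℝ := fun i j z =>
    n i z * (fderiv ℝ χ z Complex.I * fderiv ℝ (w j) z 1
      - fderiv ℝ χ z 1 * fderiv ℝ (w j) z Complex.I) with hG
  have key : ∀ i j, ∫ z, G i j z = - ∫ z, χ z * D i j z := fun i j =>
    integral_mul_curl (hL j) h.volume_ne_top (h.measurable_normal i)
      (h.abs_normal_le i) ((h.memLp₁ i).integrable (by norm_num))
      ((h.memLp₂ i).integrable (by norm_num)) (h.weak₁ i) (h.weak₂ i) hχ hc hs
  have hni : ∀ (i j : Fin 3) (e : ℂ), IntegrableOn (fun z => n i z * fderiv ℝ (w j) z e) V := by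
    intro i j e
    refine Integrable.of_bound ((h.measurable_normal i).mul
      (aestronglyMeasurable_fderiv_apply (w j) e).restrict) (1 * (L * ‖e‖))
      (Eventually.of_forall fun z => ?_)
    rw [norm_mul]
    exact mul_le_mul (h.abs_normal_le i z) (abs_fderiv_apply_le_of_lipschitz (hL j) z e)
      (norm_nonneg _) zero_le_one
  have hGi : ∀ i j, Integrable (G i j) := by
    intro i j
    refine ((integrable_mul_of_tsupport_subset (hχ' Complex.I) (hc' Complex.I) (hs' Complex.I)
      (hni i j 1)).sub (integrable_mul_of_tsupport_subset (hχ' 1) (hc' 1) (hs' 1)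
      (hni i j Complex.I))).congr (Eventually.of_forall fun z => ?_)
    simp only [hG, Pi.sub_apply]
    ring
  have hDi : ∀ i j, Integrable fun z => χ z * D i j z := fun i j =>
    integrable_mul_of_tsupport_subset hχ.continuous hc hs ((hDm i j).integrable (by norm_num))
  -- The relations ∂₂w = n × ∂₁w and -∂₁w = n × ∂₂w replace ∇w. Indices in `Fin 3` are cyclic, so `c
  -- + 1` and `c + 2` spell out component `c` of the cross product.
  have e1 : ∫ z, (fderiv ℝ χ z 1 * fderiv ℝ (w c) z 1
        + fderiv ℝ χ z Complex.I * fderiv ℝ (w c) z Complex.I)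
      = ∫ z, (G (c + 1) (c + 2) z - G (c + 2) (c + 1) z) := by
    refine integral_congr_ae ?_
    have h1 := (ae_restrict_iff' h.isOpen.measurableSet).1 h.rotate₁
    have h2 := (ae_restrict_iff' h.isOpen.measurableSet).1 h.rotate₂
    filter_upwards [h1, h2] with z z1 z2
    by_cases hz : z ∈ V
    · simp only [hG]
      linear_combination fderiv ℝ χ z Complex.I * z1 hz c - fderiv ℝ χ z 1 * z2 hz c
    · have h0 : ∀ e, fderiv ℝ χ z e = 0 := fun e => image_eq_zero_of_notMem_tsupport
        (f := fun w => fderiv ℝ χ w e) fun h => hz (hs' e h)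
      simp [hG, h0]
  rw [e1, integral_sub (hGi _ _) (hGi _ _), key, key]
  simp_rw [mul_sub]
  rw [integral_sub (hDi _ _) (hDi _ _)]
  ring

/-- Second derivatives of a conformal parametrisation and their basic relations. -/
theorem exists_second_deriv (h : IsConformalSurface V w n n₁ n₂) {K : Set ℂ} (hK : IsCompact K)
    (hKV : K ⊆ V) :
    ∃ W : Set ℂ, IsOpen W ∧ K ⊆ W ∧ W ⊆ V ∧ ∃ b₁₁ b₂₁ b₁₂ b₂₂ : Fin 3 → ℂ → ℝ,
      (∀ c, HasApproxDeriv W 1 (fun z => fderiv ℝ (w c) z 1) (b₁₁ c)) ∧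
      (∀ c, HasApproxDeriv W Complex.I (fun z => fderiv ℝ (w c) z 1) (b₂₁ c)) ∧
      (∀ c, HasApproxDeriv W 1 (fun z => fderiv ℝ (w c) z Complex.I) (b₁₂ c)) ∧
      (∀ c, HasApproxDeriv W Complex.I (fun z => fderiv ℝ (w c) z Complex.I) (b₂₂ c)) := by
  obtain ⟨L, hL⟩ := h.lipschitz
  obtain ⟨ζ, W, h1, h2, h3, hWo, hKW, hWV, h6⟩ := exists_cutoff hK h.isOpen hKV
  have : ∀ c, ∃ b₁₁ b₂₁ b₁₂ b₂₂ : ℂ → ℝ,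
      HasApproxDeriv W 1 (fun z => fderiv ℝ (w c) z 1) b₁₁ ∧
      HasApproxDeriv W Complex.I (fun z => fderiv ℝ (w c) z 1) b₂₁ ∧
      HasApproxDeriv W 1 (fun z => fderiv ℝ (w c) z Complex.I) b₁₂ ∧
      HasApproxDeriv W Complex.I (fun z => fderiv ℝ (w c) z Complex.I) b₂₂ := by
    intro c
    obtain ⟨Δ, hΔ, hlap⟩ := h.exists_laplacian c
    exact exists_hasApproxDeriv_fderiv_of_laplacian (hL c) h.isOpen h.volume_ne_top hΔ hlap
      h1 h2 h3 hWo hWV h6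
  choose b₁₁ b₂₁ b₁₂ b₂₂ g1 g2 g3 g4 using this
  exact ⟨W, hWo, hKW, hWV, b₁₁, b₂₁, b₁₂, b₂₂, g1, g2, g3, g4⟩

variable {b₁₁ b₂₁ b₁₂ b₂₂ : Fin 3 → ℂ → ℝ}

/-- The differentiated forms of the conformality relations and of the orthogonality to the
normal, together with the symmetry of second derivatives. -/
theorem ae_relations (h : IsConformalSurface V w n n₁ n₂)
    (h₁₁ : ∀ c, HasApproxDeriv V 1 (fun z => fderiv ℝ (w c) z 1) (b₁₁ c))
    (h₂₁ : ∀ c, HasApproxDeriv V Complex.I (fun z => fderiv ℝ (w c) z 1) (b₂₁ c))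
    (h₁₂ : ∀ c, HasApproxDeriv V 1 (fun z => fderiv ℝ (w c) z Complex.I) (b₁₂ c))
    (h₂₂ : ∀ c, HasApproxDeriv V Complex.I (fun z => fderiv ℝ (w c) z Complex.I) (b₂₂ c)) :
    ∀ᵐ z ∂(volume.restrict V),
      (∀ c, b₁₂ c z = b₂₁ c z) ∧
      ∑ c, fderiv ℝ (w c) z 1 * b₁₁ c z = ∑ c, fderiv ℝ (w c) z Complex.I * b₁₂ c z ∧
      ∑ c, fderiv ℝ (w c) z 1 * b₂₁ c z = ∑ c, fderiv ℝ (w c) z Complex.I * b₂₂ c z ∧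
      ∑ c, (fderiv ℝ (w c) z 1 * b₁₂ c z + fderiv ℝ (w c) z Complex.I * b₁₁ c z) = 0 ∧
      ∑ c, (fderiv ℝ (w c) z 1 * b₂₂ c z + fderiv ℝ (w c) z Complex.I * b₂₁ c z) = 0 ∧
      ∑ c, (n₁ c z * fderiv ℝ (w c) z 1 + n c z * b₁₁ c z) = 0 ∧
      ∑ c, (n₂ c z * fderiv ℝ (w c) z 1 + n c z * b₂₁ c z) = 0 ∧
      ∑ c, (n₁ c z * fderiv ℝ (w c) z Complex.I + n c z * b₁₂ c z) = 0 ∧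
      ∑ c, (n₂ c z * fderiv ℝ (w c) z Complex.I + n c z * b₂₂ c z) = 0 := by
  obtain ⟨L, hL⟩ := h.lipschitz
  have := h.isFiniteMeasure
  have hV := h.isOpen
  have hvol := h.volume_ne_top
  have hn₁ : ∀ c, IntegrableOn (n₁ c) V := fun c => (h.memLp₁ c).integrable (by norm_num)
  have hn₂ : ∀ c, IntegrableOn (n₂ c) V := fun c => (h.memLp₂ c).integrable (by norm_num)
  -- The mixed second derivatives were produced as separate L² limits; they coincide because the
  -- differential of a Lipschitz function is weakly curl free.
  have hsymm : ∀ c, ∀ᵐ z ∂(volume.restrict V), b₁₂ c z - b₂₁ c z = 0 := by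
    intro c
    refine ae_eq_zero_of_integral_mul_eq_zero hV ((h₁₂ c).integrable.sub (h₂₁ c).integrable)
      fun χ hχ hc hs => ?_
    simp_rw [mul_sub]
    rw [integral_sub (integrable_mul_of_tsupport_subset hχ.continuous hc hs (h₁₂ c).integrable)
        (integrable_mul_of_tsupport_subset hχ.continuous hc hs (h₂₁ c).integrable)]
    have e1 := (h₁₂ c).integral_fderiv_mul hV hvol hχ hc hs
    have e2 := (h₂₁ c).integral_fderiv_mul hV hvol hχ hc hs
    have e3 := integral_curl_eq_zero (hL c) 1 Complex.I hχ hc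
    linarith
  have zero : ∀ e, HasApproxDeriv V e (fun _ => 0) (fun _ => 0) := fun e => by
    simpa using HasApproxDeriv.sum hV (∅ : Finset (Fin 3)) (e := e)
      (f := fun _ _ => 0) (f' := fun _ _ => 0) (by simp)
  have c1 := (HasApproxDeriv.sum hV Finset.univ fun c _ => (h₁₁ c).mul hV (h₁₁ c)).ae_eq hV hvol
    (HasApproxDeriv.sum hV Finset.univ fun c _ => (h₁₂ c).mul hV (h₁₂ c)) h.conformal
  have c2 := (HasApproxDeriv.sum hV Finset.univ fun c _ => (h₂₁ c).mul hV (h₂₁ c)).ae_eq hV hvol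
    (HasApproxDeriv.sum hV Finset.univ fun c _ => (h₂₂ c).mul hV (h₂₂ c)) h.conformal
  have c3 := (HasApproxDeriv.sum hV Finset.univ fun c _ => (h₁₁ c).mul hV (h₁₂ c)).ae_eq hV hvol
    (zero 1) h.orthogonal
  have c4 := (HasApproxDeriv.sum hV Finset.univ fun c _ => (h₂₁ c).mul hV (h₂₂ c)).ae_eq hV hvol
    (zero Complex.I) h.orthogonal
  have d1 := ae_sum_deriv_eq_zero hV hvol h₁₁ h.measurable_normal h.abs_normal_le hn₁ h.weak₁
    h.normal₁
  have d2 := ae_sum_deriv_eq_zero hV hvol h₂₁ h.measurable_normal h.abs_normal_le hn₂ h.weak₂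
    h.normal₁
  have d3 := ae_sum_deriv_eq_zero hV hvol h₁₂ h.measurable_normal h.abs_normal_le hn₁ h.weak₁
    h.normal₂
  have d4 := ae_sum_deriv_eq_zero hV hvol h₂₂ h.measurable_normal h.abs_normal_le hn₂ h.weak₂
    h.normal₂
  filter_upwards [ae_all_iff.2 hsymm, c1, c2, c3, c4, d1, d2, d3, d4] with z z0 z1 z2 z3 z4 z5 z6
    z7 z8
  simp only [← two_mul, ← Finset.mul_sum] at z1 z2
  exact ⟨fun c => by linarith [z0 c], by linarith, by linarith, z3, z4, z5, z6, z7, z8⟩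

end IsConformalSurface

/-- A vector orthogonal to `n`, `p` and `n × p` vanishes. -/
theorem eq_zero_of_orthogonal_frame {x p q n : Fin 3 → ℝ} (hq : 0 < ∑ c, q c * q c)
    (hc : ∀ c, q c = n (c + 1) * p (c + 2) - n (c + 2) * p (c + 1))
    (hn : ∑ c, n c * x c = 0) (hp : ∑ c, p c * x c = 0) (hqx : ∑ c, q c * x c = 0) (c : Fin 3) :
    x c = 0 := by
  have c0 : q 0 = n 1 * p 2 - n 2 * p 1 := hc 0
  have c1 : q 1 = n 2 * p 0 - n 0 * p 2 := hc 1
  have c2 : q 2 = n 0 * p 1 - n 1 * p 0 := hc 2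
  simp only [Fin.sum_univ_three] at *
  -- Since q = n × p, the triple product x × q = n (x · p) - p (x · n) vanishes. Together with x · q
  -- = 0, Lagrange's identity |x|²|q|² = |x × q|² + (x · q)² then gives x = 0.
  have e0 : x 1 * q 2 - x 2 * q 1 = 0 := by
    rw [c1, c2]; linear_combination n 0 * hp - p 0 * hn
  have e1 : x 2 * q 0 - x 0 * q 2 = 0 := by
    rw [c0, c2]; linear_combination n 1 * hp - p 1 * hn
  have e2 : x 0 * q 1 - x 1 * q 0 = 0 := by
    rw [c0, c1]; linear_combination n 2 * hp - p 2 * hn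
  have e3 : (x 0 ^ 2 + x 1 ^ 2 + x 2 ^ 2) * (q 0 * q 0 + q 1 * q 1 + q 2 * q 2) = 0 := by
    linear_combination (x 1 * q 2 - x 2 * q 1) * e0 + (x 2 * q 0 - x 0 * q 2) * e1
      + (x 0 * q 1 - x 1 * q 0) * e2 + (q 0 * x 0 + q 1 * x 1 + q 2 * x 2) * hqx
  have e4 : x 0 ^ 2 + x 1 ^ 2 + x 2 ^ 2 = 0 := (mul_eq_zero.1 e3).resolve_right hq.ne'
  fin_cases c <;> simp only [Fin.zero_eta, Fin.mk_one, Fin.reduceFinMk] <;> nlinarith [sq_nonneg (x 0), sq_nonneg (x 1), sq_nonneg (x 2)]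

/-- The pointwise identity behind the divergence form of the equation `H = Re ⟨Q, h⁰⟩`: the
tangential part vanishes because of conformality, the normal part because of the equation. -/
theorem divergence_term_eq_zero {p q n n₁ n₂ b₁₁ b₂₁ b₁₂ b₂₂ : Fin 3 → ℝ} {a b E : ℝ}
    (hE : E = ∑ c, p c * p c) (hE' : E = ∑ c, q c * q c) (hpos : 0 < E)
    (hpq : ∑ c, p c * q c = 0) (hnp : ∑ c, n c * p c = 0) (hnq : ∑ c, n c * q c = 0)
    (hc : ∀ c, q c = n (c + 1) * p (c + 2) - n (c + 2) * p (c + 1))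
    (hs : ∀ c, b₁₂ c = b₂₁ c)
    (r1 : ∑ c, p c * b₁₁ c = ∑ c, q c * b₁₂ c) (r2 : ∑ c, p c * b₂₁ c = ∑ c, q c * b₂₂ c)
    (r3 : ∑ c, (p c * b₁₂ c + q c * b₁₁ c) = 0) (r4 : ∑ c, (p c * b₂₂ c + q c * b₂₁ c) = 0)
    (r5 : ∑ c, (n₁ c * p c + n c * b₁₁ c) = 0) (r6 : ∑ c, (n₂ c * p c + n c * b₂₁ c) = 0)
    (r7 : ∑ c, (n₁ c * q c + n c * b₁₂ c) = 0) (r8 : ∑ c, (n₂ c * q c + n c * b₂₂ c) = 0)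
    (heq : (-∑ c, n₁ c * p c + -∑ c, n₂ c * q c) / (2 * E)
      = 4 / E ^ 2 * (a * ((-∑ c, n₁ c * p c - -∑ c, n₂ c * q c) / 2)
        - b * ((-∑ c, n₁ c * q c + -∑ c, n₂ c * p c) / 2))) (c : Fin 3) :
    b₁₁ c + b₂₂ c - 4 / E * (a * (b₁₁ c - b₂₂ c) - b * (b₁₂ c + b₂₁ c))
      + 8 / E ^ 2 * ((∑ d, p d * b₁₁ d) * (a * p c - b * q c)
        - (∑ d, p d * b₂₁ d) * (b * p c + a * q c)) = 0 := by
  have hE0 : E ≠ 0 := hpos.ne'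
  obtain rfl : b₁₂ = b₂₁ := funext hs
  have heq' : (-∑ c, n₁ c * p c + -∑ c, n₂ c * q c) * E
      = 4 * (a * (-∑ c, n₁ c * p c - -∑ c, n₂ c * q c)
        - b * (-∑ c, n₁ c * q c + -∑ c, n₂ c * p c)) := by
    field_simp at heq
    linear_combination heq
  clear heq hs
  set s := ∑ d, p d * b₁₁ d with hs
  set t := ∑ d, p d * b₁₂ d with ht
  -- E² times the expanded divergence of (1 - 4M/E)∇w with a and b treated as constants. The terms
  -- in s and t come from differentiating 1/E, as ∂₁E = 2s and ∂₂E = 2t. It is tested against n, p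
  -- and q.
  set x : Fin 3 → ℝ := fun c => E ^ 2 * (b₁₁ c + b₂₂ c)
    - 4 * E * (a * (b₁₁ c - b₂₂ c) - b * (b₁₂ c + b₁₂ c))
      + 8 * (s * (a * p c - b * q c) - t * (b * p c + a * q c)) with hx
  have key : x c = 0 := by
    refine eq_zero_of_orthogonal_frame (hE' ▸ hpos) hc ?_ ?_ ?_ c
    · simp only [Fin.sum_univ_three, hx] at *
      -- Normal component: the differentiated orthogonality relations turn second derivatives of w
      -- into the second fundamental form, and what remains is the equation H = Re⟨Q, h⁰⟩.
      linear_combination (E ^ 2 - 4 * E * a) * r5 + (E ^ 2 + 4 * E * a) * r8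
        + (4 * E * b) * (r6 + r7) + E * heq' + 8 * (s * a - t * b) * hnp
        - 8 * (s * b + t * a) * hnq
    · have e1 : ∑ c, p c * b₂₂ c = - s := by
        simp only [Finset.sum_add_distrib] at r4; linarith
      clear_value s t
      simp only [Fin.sum_univ_three, hx] at *
      linear_combination (-(E ^ 2 - 4 * E * a)) * hs - 8 * E * b * ht
        + (E ^ 2 + 4 * E * a) * e1 - 8 * (s * a - t * b) * hE - 8 * (s * b + t * a) * hpq
    · have e1 : ∑ c, q c * b₁₁ c = - t := by
        simp only [Finset.sum_add_distrib] at r3; linarith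
      clear_value s t
      simp only [Fin.sum_univ_three, hx] at *
      linear_combination (E ^ 2 - 4 * E * a) * e1 - 8 * E * b * r1
        - (E ^ 2 + 4 * E * a) * r2 + 8 * (s * a - t * b) * hpq + 8 * (s * b + t * a) * hE'
  simp only [hx] at key
  field_simp
  linear_combination key

end CCM


/-! ### The integrated flux identity, by regularising 1/E. -/

namespace CCM

open Filter Topology

/-- A smooth regularisation of `t ↦ 1 / t`. -/
noncomputable def regInv (δ t : ℝ) : ℝ := t / (t ^ 2 + δ)

section

variable {δ : ℝ}

theorem contDiff_regInv (hδ : 0 < δ) : ContDiff ℝ ∞ (regInv δ) :=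
  contDiff_id.div (by fun_prop) fun t => by positivity

theorem deriv_regInv (hδ : 0 < δ) (t : ℝ) :
    deriv (regInv δ) t = (δ - t ^ 2) / (t ^ 2 + δ) ^ 2 := by
  have h0 : t ^ 2 + δ ≠ 0 := by positivity
  have h := (hasDerivAt_id t).div (((hasDerivAt_id t).pow 2).add_const δ) h0
  have h' : HasDerivAt (regInv δ) _ t := h
  rw [h'.deriv]
  simp
  ring

/-- The scale-invariant quantities θ(t)t and θ'(t)t² replace 1/t and its derivative. Their bounds
are uniform in δ and t, which supplies domination when δ → 0; their limits 1 and -1 for t ≠ 0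
recover 1/t and -1/t². -/
theorem abs_regInv_mul_le (hδ : 0 < δ) (t : ℝ) : |regInv δ t * t| ≤ 1 := by
  have h0 : 0 < t ^ 2 + δ := by positivity
  have : regInv δ t * t = t ^ 2 / (t ^ 2 + δ) := by rw [regInv]; ring
  rw [this, abs_of_nonneg (by positivity), div_le_one h0]
  linarith

theorem abs_deriv_regInv_mul_le (hδ : 0 < δ) (t : ℝ) : |deriv (regInv δ) t * t ^ 2| ≤ 1 := by
  have h0 : 0 < t ^ 2 + δ := by positivity
  rw [deriv_regInv hδ, div_mul_eq_mul_div, abs_div, abs_of_pos (pow_pos h0 2),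
    div_le_one (pow_pos h0 2), abs_le]
  constructor <;> nlinarith [sq_nonneg t, mul_nonneg (sq_nonneg t) hδ.le, sq_nonneg (t ^ 2)]

theorem tendsto_regInv_mul {t : ℝ} (ht : t ≠ 0) {d : ℕ → ℝ} (hd : Tendsto d atTop (𝓝 0)) :
    Tendsto (fun k => regInv (d k) t * t) atTop (𝓝 1) := by
  have h : Tendsto (fun k => t / (t ^ 2 + d k) * t) atTop (𝓝 (t / (t ^ 2 + 0) * t)) :=
    (tendsto_const_nhds.div (hd.const_add _) (by simpa using ht)).mul_const _
  have e : t / (t ^ 2 + 0) * t = 1 := by field_simp; simp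
  rwa [e] at h

theorem tendsto_deriv_regInv_mul {t : ℝ} (ht : t ≠ 0) {d : ℕ → ℝ} (hd0 : ∀ k, 0 < d k)
    (hd : Tendsto d atTop (𝓝 0)) :
    Tendsto (fun k => deriv (regInv (d k)) t * t ^ 2) atTop (𝓝 (-1)) := by
  simp_rw [fun k => deriv_regInv (hd0 k) t]
  have h : Tendsto (fun k => (d k - t ^ 2) / (t ^ 2 + d k) ^ 2 * t ^ 2) atTop
      (𝓝 ((0 - t ^ 2) / (t ^ 2 + 0) ^ 2 * t ^ 2)) :=
    ((hd.sub_const _).div ((hd.const_add _).pow 2) (by simpa using ht)).mul_const _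
  have e : (0 - t ^ 2) / (t ^ 2 + 0) ^ 2 * t ^ 2 = -1 := by field_simp; ring
  rwa [e] at h

end

/-- Quadratic expressions in the frame are bounded after division by E, however small E is. -/
theorem abs_mul_div_sum_le_one {p q : Fin 3 → ℝ} {E : ℝ} (hE : E = ∑ c, p c * p c)
    (hE' : E = ∑ c, q c * q c) (c d : Fin 3) : |p c * q d / E| ≤ 1 := by
  have h1 : p c * p c ≤ E := by
    rw [hE]
    exact Finset.single_le_sum (f := fun c => p c * p c) (fun i _ => mul_self_nonneg _)
      (Finset.mem_univ c)
  have h2 : q d * q d ≤ E := by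
    rw [hE']
    exact Finset.single_le_sum (f := fun c => q c * q c) (fun i _ => mul_self_nonneg _)
      (Finset.mem_univ d)
  have h0 : 0 ≤ E := (mul_self_nonneg _).trans h1
  rw [abs_div, abs_of_nonneg h0]
  refine div_le_one_of_le₀ ?_ h0
  rw [abs_le]
  constructor <;> nlinarith [sq_nonneg (p c - q d), sq_nonneg (p c + q d)]

/-- The hypothesis is 2|Q| < 1 written out, since |Q|² = 4(a² + b²)/E². -/
theorem abs_div_le_quarter {a b E : ℝ} (hE : 0 < E) (h : 16 * (a ^ 2 + b ^ 2) < E ^ 2) :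
    |a / E| ≤ 1 / 4 ∧ |b / E| ≤ 1 / 4 := by
  constructor
  · rw [abs_div, abs_of_pos hE, div_le_iff₀ hE]
    refine abs_le_of_sq_le_sq (by nlinarith [sq_nonneg b]) (by positivity)
  · rw [abs_div, abs_of_pos hE, div_le_iff₀ hE]
    refine abs_le_of_sq_le_sq (by nlinarith [sq_nonneg a]) (by positivity)

/-- Integrated form of `div (w · (1 - 4 M / E) ∇ w) = 2 E`, where `M` is the symmetric trace free
matrix with entries `a`, `-b`, `-b`, `-a`. -/
theorem integral_flux_of_divergence {W : Set ℂ} (hW : IsOpen W) (hvol : volume W ≠ ⊤)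
    {w p q b₁₁ b₂₁ b₁₂ b₂₂ : Fin 3 → ℂ → ℝ} {a b a₁ b₁ E : ℂ → ℝ} {L : ℝ}
    (hwc : ∀ c, Continuous (w c))
    (hw₁ : ∀ c, HasApproxDeriv W 1 (w c) (p c)) (hw₂ : ∀ c, HasApproxDeriv W Complex.I (w c) (q c))
    (h₁₁ : ∀ c, HasApproxDeriv W 1 (p c) (b₁₁ c))
    (h₂₁ : ∀ c, HasApproxDeriv W Complex.I (p c) (b₂₁ c))
    (h₁₂ : ∀ c, HasApproxDeriv W 1 (q c) (b₁₂ c))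
    (h₂₂ : ∀ c, HasApproxDeriv W Complex.I (q c) (b₂₂ c))
    (ha₁ : HasApproxDeriv W 1 a a₁) (hb₁ : HasApproxDeriv W 1 b b₁)
    (ha₂ : HasApproxDeriv W Complex.I a (fun z => -b₁ z)) (hb₂ : HasApproxDeriv W Complex.I b a₁)
    (hpL : ∀ c z, |p c z| ≤ L) (hqL : ∀ c z, |q c z| ≤ L)
    (hE : ∀ z, E z = ∑ c, p c z * p c z)
    (hpos : ∀ᵐ z ∂(volume.restrict W), 0 < E z)
    (hconf : ∀ᵐ z ∂(volume.restrict W), E z = ∑ c, q c z * q c z)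
    (horth : ∀ᵐ z ∂(volume.restrict W), ∑ c, p c z * q c z = 0)
    (hell : ∀ᵐ z ∂(volume.restrict W), 16 * (a z ^ 2 + b z ^ 2) < E z ^ 2)
    (hdiv : ∀ᵐ z ∂(volume.restrict W), ∀ c,
      b₁₁ c z + b₂₂ c z
        - 4 / E z * (a z * (b₁₁ c z - b₂₂ c z) - b z * (b₁₂ c z + b₂₁ c z))
        + 8 / E z ^ 2 * ((∑ d, p d z * b₁₁ d z) * (a z * p c z - b z * q c z)
          - (∑ d, p d z * b₂₁ d z) * (b z * p c z + a z * q c z)) = 0)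
    {χ : ℂ → ℝ} (hχ : ContDiff ℝ ∞ χ) (hc : HasCompactSupport χ) (hs : tsupport χ ⊆ W) :
    ∫ z, (fderiv ℝ χ z 1 * ∑ c, w c z * (p c z - 4 * (a z * p c z - b z * q c z) / E z)
        + fderiv ℝ χ z Complex.I
          * ∑ c, w c z * (q c z + 4 * (b z * p c z + a z * q c z) / E z))
      = - ∫ z, χ z * (2 * E z) := by
  have hfin : IsFiniteMeasure (volume.restrict W) := ⟨by simpa using hvol.lt_top⟩
  have hpm : ∀ c, AEStronglyMeasurable (p c) (volume.restrict W) := fun c => (hw₁ c).integrable.1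
  have hqm : ∀ c, AEStronglyMeasurable (q c) (volume.restrict W) := fun c => (hw₂ c).integrable.1
  have ham := (ha₁.integrableOn hW hvol).1
  have hbm := (hb₁.integrableOn hW hvol).1
  have hEm : AEStronglyMeasurable E (volume.restrict W) := by
    have : E = fun z => ∑ c, p c z * p c z := funext hE
    rw [this]
    exact Finset.aestronglyMeasurable_fun_sum _ fun c _ => (hpm c).mul (hpm c)
  have hEi : IntegrableOn E W := by
    have : E = fun z => ∑ c, p c z * p c z := funext hE
    rw [this]
    exact integrable_finsetSum _ fun c _ => (h₁₁ c).integrable_mul hW (hw₁ c).integrable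
  have hαm : AEStronglyMeasurable (fun z => a z / E z) (volume.restrict W) :=
    (ham.aemeasurable.div hEm.aemeasurable).aestronglyMeasurable
  have hβm : AEStronglyMeasurable (fun z => b z / E z) (volume.restrict W) :=
    (hbm.aemeasurable.div hEm.aemeasurable).aestronglyMeasurable
  have hα : ∀ᵐ z ∂(volume.restrict W), |a z / E z| ≤ 1 / 4 ∧ |b z / E z| ≤ 1 / 4 := by
    filter_upwards [hpos, hell] with z h1 h2 using abs_div_le_quarter h1 h2
  -- the limiting terms
  set A : Fin 3 → ℂ → ℝ := fun c z =>
    -4 * (a z / E z * (b₁₁ c z - b₂₂ c z) - b z / E z * (b₁₂ c z + b₂₁ c z)) with hA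
  set B : Fin 3 → ℂ → ℝ := fun c z =>
    -8 * ((∑ d, (a z / E z * (p d z * p c z / E z) - b z / E z * (p d z * q c z / E z)) * b₁₁ d z)
      - ∑ d, (b z / E z * (p d z * p c z / E z) + a z / E z * (p d z * q c z / E z)) * b₂₁ d z)
    with hB
  have hAi : ∀ c, IntegrableOn (A c) W := by
    intro c
    refine Integrable.const_mul (Integrable.sub ?_ ?_) _
    · exact Integrable.bdd_mul ((h₁₁ c).integrable.sub (h₂₂ c).integrable) hαm
        (by filter_upwards [hα] with z hz using hz.1)
    · exact Integrable.bdd_mul ((h₁₂ c).integrable.add (h₂₁ c).integrable) hβm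
        (by filter_upwards [hα] with z hz using hz.2)
  -- Each second derivative carries a weight that is a sum of two products of a ratio at most 1/4
  -- with one at most 1; hence the constant 1/2.
  have hBi : ∀ c, IntegrableOn (B c) W := by
    intro c
    have m1 : ∀ d, AEStronglyMeasurable (fun z => p d z * p c z / E z) (volume.restrict W) :=
      fun d => (((hpm d).mul (hpm c)).aemeasurable.div hEm.aemeasurable).aestronglyMeasurable
    have m2 : ∀ d, AEStronglyMeasurable (fun z => p d z * q c z / E z) (volume.restrict W) :=
      fun d => (((hpm d).mul (hqm c)).aemeasurable.div hEm.aemeasurable).aestronglyMeasurable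
    have bd : ∀ d, ∀ᵐ z ∂(volume.restrict W),
        |p d z * p c z / E z| ≤ 1 ∧ |p d z * q c z / E z| ≤ 1 := by
      intro d
      filter_upwards [hconf] with z hz
      exact ⟨abs_mul_div_sum_le_one (p := fun c => p c z) (q := fun c => p c z) (hE z) (hE z) d c,
        abs_mul_div_sum_le_one (p := fun c => p c z) (q := fun c => q c z) (hE z) hz d c⟩
    refine Integrable.const_mul (Integrable.sub ?_ ?_) _
    · refine integrable_finsetSum _ fun d _ => Integrable.bdd_mul (c := 1 / 2) (h₁₁ d).integrable
        ((hαm.mul (m1 d)).sub (hβm.mul (m2 d))) ?_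
      filter_upwards [hα, bd d] with z h1 h2
      have e1 := mul_le_mul h1.1 h2.1 (abs_nonneg _) (by norm_num)
      have e2 := mul_le_mul h1.2 h2.2 (abs_nonneg _) (by norm_num)
      rw [← abs_mul] at e1 e2
      refine (norm_sub_le _ _).trans ?_
      simp only [Real.norm_eq_abs]
      linarith
    · refine integrable_finsetSum _ fun d _ => Integrable.bdd_mul (c := 1 / 2) (h₂₁ d).integrable
        ((hβm.mul (m1 d)).add (hαm.mul (m2 d))) ?_
      filter_upwards [hα, bd d] with z h1 h2
      have e1 := mul_le_mul h1.2 h2.1 (abs_nonneg _) (by norm_num)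
      have e2 := mul_le_mul h1.1 h2.2 (abs_nonneg _) (by norm_num)
      rw [← abs_mul] at e1 e2
      refine (norm_add_le _ _).trans ?_
      simp only [Real.norm_eq_abs]
      linarith
  -- the regularised identity
  have reg : ∀ δ : ℝ, 0 < δ →
      ∫ z, (fderiv ℝ χ z 1 * ∑ c, w c z * (p c z - 4 * (regInv δ (E z) * E z)
          * (a z / E z * p c z - b z / E z * q c z))
        + fderiv ℝ χ z Complex.I * ∑ c, w c z * (q c z + 4 * (regInv δ (E z) * E z)
          * (b z / E z * p c z + a z / E z * q c z)))
      = - ∫ z, (χ z * (2 * E z) + χ z * ∑ c, w c z * (b₁₁ c z + b₂₂ c z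
          + (regInv δ (E z) * E z) * A c z + (deriv (regInv δ) (E z) * E z ^ 2) * B c z)) := by
    intro δ hδ
    have hθ := contDiff_regInv hδ
    have hEe₁ : HasApproxDeriv W 1 E (fun z => 2 * ∑ d, p d z * b₁₁ d z) :=
      (HasApproxDeriv.sum hW Finset.univ fun c _ => (h₁₁ c).mul hW (h₁₁ c)).congr
        (Eventually.of_forall hE)
        (Eventually.of_forall fun z => by simp only [← two_mul, Finset.mul_sum])
    have hEe₂ : HasApproxDeriv W Complex.I E (fun z => 2 * ∑ d, p d z * b₂₁ d z) :=
      (HasApproxDeriv.sum hW Finset.univ fun c _ => (h₂₁ c).mul hW (h₂₁ c)).congr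
        (Eventually.of_forall hE)
        (Eventually.of_forall fun z => by simp only [← two_mul, Finset.mul_sum])
    -- The two components of the regularised flux. The derivatives of a and b enter `g1` and `g2`
    -- through the same functions `a₁` and `b₁`, so by Cauchy–Riemann they cancel when the two are
    -- added.
    have g1 := HasApproxDeriv.sum hW Finset.univ fun c _ => (hw₁ c).mul hW ((h₁₁ c).add hW
      (((hEe₁.comp hW hθ).mul hW ((ha₁.mul hW (h₁₁ c)).add hW
        ((hb₁.mul hW (h₁₂ c)).const_mul hW (-1)))).const_mul hW (-4)))
    have g2 := HasApproxDeriv.sum hW Finset.univ fun c _ => (hw₂ c).mul hW ((h₂₂ c).add hW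
      (((hEe₂.comp hW hθ).mul hW ((hb₂.mul hW (h₂₁ c)).add hW
        (ha₂.mul hW (h₂₂ c)))).const_mul hW 4))
    have k1 := g1.integral_fderiv_mul hW hvol hχ hc hs
    have k2 := g2.integral_fderiv_mul hW hvol hχ hc hs
    have hs' := fun e => (tsupport_fderiv_apply_subset χ e).trans hs
    have hχ' := fun e => (contDiff_fderiv_apply hχ e).continuous
    have l1 := integrable_mul_of_tsupport_subset (hχ' 1) (hasCompactSupport_fderiv_apply hc 1)
      (hs' 1) (g1.integrableOn hW hvol)
    have l2 := integrable_mul_of_tsupport_subset (hχ' Complex.I)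
      (hasCompactSupport_fderiv_apply hc Complex.I) (hs' Complex.I) (g2.integrableOn hW hvol)
    have r1 := integrable_mul_of_tsupport_subset hχ.continuous hc hs g1.integrable
    have r2 := integrable_mul_of_tsupport_subset hχ.continuous hc hs g2.integrable
    have tot := congrArg₂ (· + ·) k1 k2
    rw [← integral_add l1 l2, ← neg_add, ← integral_add r1 r2] at tot
    have hposW := (ae_restrict_iff' hW.measurableSet).1 hpos
    have hconfW := (ae_restrict_iff' hW.measurableSet).1 hconf
    have horthW := (ae_restrict_iff' hW.measurableSet).1 horth
    refine Eq.trans ?_ (tot.trans (congrArg Neg.neg ?_))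
    · refine integral_congr_ae ?_
      filter_upwards [hposW] with z hz
      by_cases hzW : z ∈ W
      · have h0 := (hz hzW).ne'
        have ea : a z = a z / E z * E z := by field_simp
        have eb : b z = b z / E z * E z := by field_simp
        have e1 : ∀ c, p c z - 4 * (regInv δ (E z) * E z) * (a z / E z * p c z - b z / E z * q c z)
            = p c z + -4 * (regInv δ (E z) * (a z * p c z + -1 * (b z * q c z))) := by
          intro c
          field_simp
          ring
        have e2 : ∀ c, q c z + 4 * (regInv δ (E z) * E z) * (b z / E z * p c z + a z / E z * q c z)
            = q c z + 4 * (regInv δ (E z) * (b z * p c z + a z * q c z)) := by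
          intro c
          field_simp
        simp only [e1, e2]
      · have h0 : ∀ e, fderiv ℝ χ z e = 0 := fun e => image_eq_zero_of_notMem_tsupport
          (f := fun w => fderiv ℝ χ w e) fun h => hzW (hs' e h)
        simp [h0]
    · refine integral_congr_ae ?_
      filter_upwards [hposW, hconfW, horthW] with z hz1 hz2 hz3
      by_cases hzW : z ∈ W
      · have h0 := (hz1 hzW).ne'
        have hE1 := hE z
        have hE2 := hz2 hzW
        have hE3 := hz3 hzW
        rw [← mul_add, ← mul_add, ← Finset.sum_add_distrib]
        congr 1
        have hA' : ∀ c, regInv δ (E z) * E z * A c z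
            = regInv δ (E z) * (-4 * (a z * (b₁₁ c z - b₂₂ c z) - b z * (b₁₂ c z + b₂₁ c z))) := by
          intro c
          simp only [hA]
          field_simp
        have hB' : ∀ c, deriv (regInv δ) (E z) * E z ^ 2 * B c z
            = deriv (regInv δ) (E z) * (-8 * ((∑ d, p d z * b₁₁ d z) * (a z * p c z - b z * q c z)
              - (∑ d, p d z * b₂₁ d z) * (b z * p c z + a z * q c z))) := by
          intro c
          simp only [hB, Fin.sum_univ_three]
          field_simp
        simp only [hA', hB']
        generalize regInv δ (E z) = θ
        generalize deriv (regInv δ) (E z) = θ'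
        generalize ∑ d, p d z * b₁₁ d z = s
        generalize ∑ d, p d z * b₂₁ d z = t
        simp only [Fin.sum_univ_three] at *
        -- What is left is the contraction of ∇w with its own flux: conformality turns it into 2E,
        -- and the quadratic form contributes nothing because M is trace free.
        linear_combination (-1 + 4 * θ * a z) * hE1 + (-1 - 4 * θ * a z) * hE2
          + 8 * θ * b z * hE3
      · rw [image_eq_zero_of_notMem_tsupport (fun h => hzW (hs h))]
        simp
  -- passage to the limit
  set d : ℕ → ℝ := fun k => 1 / ((k : ℝ) + 1) with hd
  have hd0 : ∀ k, 0 < d k := fun k => by positivity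
  have hdl : Tendsto d atTop (𝓝 0) := tendsto_one_div_add_atTop_nhds_zero_nat
  have hL : 0 ≤ L := (abs_nonneg _).trans (hpL 0 0)
  have hs' := fun e => (tsupport_fderiv_apply_subset χ e).trans hs
  have hχ' := fun e => (contDiff_fderiv_apply hχ e).continuous
  have hfm : ∀ (f : ℝ → ℝ), Measurable f →
      AEStronglyMeasurable (fun z => f (E z)) (volume.restrict W) := fun f hf =>
    (hf.comp_aemeasurable hEm.aemeasurable).aestronglyMeasurable
  have mreg : ∀ k, AEStronglyMeasurable (fun z => regInv (d k) (E z) * E z)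
      (volume.restrict W) := fun k =>
    hfm (fun t => regInv (d k) t * t) ((contDiff_regInv (hd0 k)).continuous.measurable.mul
      measurable_id)
  have mreg' : ∀ k, AEStronglyMeasurable (fun z => deriv (regInv (d k)) (E z) * E z ^ 2)
      (volume.restrict W) := fun k =>
    hfm (fun t => deriv (regInv (d k)) t * t ^ 2)
      ((measurable_deriv _).mul (measurable_id.pow_const 2))
  have lhs : Tendsto (fun k => ∫ z in W, (fderiv ℝ χ z 1 * ∑ c, w c z * (p c z
          - 4 * (regInv (d k) (E z) * E z) * (a z / E z * p c z - b z / E z * q c z))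
        + fderiv ℝ χ z Complex.I * ∑ c, w c z * (q c z + 4 * (regInv (d k) (E z) * E z)
          * (b z / E z * p c z + a z / E z * q c z)))) atTop
      (𝓝 (∫ z in W, (fderiv ℝ χ z 1 * ∑ c, w c z * (p c z
          - 4 * 1 * (a z / E z * p c z - b z / E z * q c z))
        + fderiv ℝ χ z Complex.I * ∑ c, w c z * (q c z + 4 * 1
          * (b z / E z * p c z + a z / E z * q c z))))) := by
    -- The bound 3L is L for the gradient plus 4(1/4 + 1/4)L for the term with the quadratic form.
    refine tendsto_integral_of_dominated_convergence (fun z =>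
      |fderiv ℝ χ z 1 * (∑ c, |w c z|)| * (3 * L)
        + |fderiv ℝ χ z Complex.I * (∑ c, |w c z|)| * (3 * L)) ?_ ?_ ?_ ?_
    · intro k
      refine ((hχ' 1).aestronglyMeasurable.mul ?_).add ((hχ' _).aestronglyMeasurable.mul ?_)
      · exact Finset.aestronglyMeasurable_fun_sum _ fun c _ =>
          (hwc c).aestronglyMeasurable.mul ((hpm c).sub (((mreg k).const_mul 4).mul
            ((hαm.mul (hpm c)).sub (hβm.mul (hqm c)))))
      · exact Finset.aestronglyMeasurable_fun_sum _ fun c _ =>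
          (hwc c).aestronglyMeasurable.mul ((hqm c).add (((mreg k).const_mul 4).mul
            ((hβm.mul (hpm c)).add (hαm.mul (hqm c)))))
    · have hcs : ∀ e, Integrable fun z => fderiv ℝ χ z e * ∑ c, |w c z| := fun e =>
        ((hχ' e).mul (continuous_finsetSum _ fun c _ =>
          (hwc c).abs)).integrable_of_hasCompactSupport
          (hasCompactSupport_fderiv_apply hc e).mul_right
      exact (((hcs 1).abs.mul_const _).add ((hcs Complex.I).abs.mul_const _)).integrableOn
    · intro k
      filter_upwards [hα] with z hz
      have hr := abs_regInv_mul_le (hd0 k) (E z)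
      have b1 : ∀ {x y : ℝ}, |x| ≤ 1 / 4 → |y| ≤ L → |x * y| ≤ 1 / 4 * L := fun hx hy => by
        rw [abs_mul]; exact mul_le_mul hx hy (abs_nonneg _) (by norm_num)
      have b2 : ∀ {x : ℝ}, |x| ≤ L / 2 → |4 * (regInv (d k) (E z) * E z) * x| ≤ 2 * L := by
        intro x hx
        rw [abs_mul, abs_mul, abs_of_pos (by norm_num : (0 : ℝ) < 4)]
        have := mul_le_mul hr hx (abs_nonneg _) zero_le_one
        linarith
      have b3 : ∀ (v : ℝ) (f : Fin 3 → ℝ), (∀ c, |f c| ≤ 3 * L) →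
          ‖v * ∑ c, w c z * f c‖ ≤ |v * (∑ c, |w c z|)| * (3 * L) := by
        intro v f hf
        rw [Real.norm_eq_abs, abs_mul, abs_mul, mul_assoc]
        refine mul_le_mul_of_nonneg_left ?_ (abs_nonneg _)
        rw [abs_of_nonneg (Finset.sum_nonneg fun c _ => abs_nonneg (w c z)), Finset.sum_mul]
        refine (Finset.abs_sum_le_sum_abs _ _).trans (Finset.sum_le_sum fun c _ => ?_)
        rw [abs_mul]
        exact mul_le_mul_of_nonneg_left (hf c) (abs_nonneg _)
      refine (norm_add_le _ _).trans (add_le_add (b3 _ _ fun c => ?_) (b3 _ _ fun c => ?_))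
      · have := b2 (x := a z / E z * p c z - b z / E z * q c z)
          ((abs_sub _ _).trans (by linarith [b1 hz.1 (hpL c z), b1 hz.2 (hqL c z)]))
        exact (abs_sub _ _).trans (by linarith [hpL c z])
      · have := b2 (x := b z / E z * p c z + a z / E z * q c z)
          ((abs_add_le _ _).trans (by linarith [b1 hz.2 (hpL c z), b1 hz.1 (hqL c z)]))
        exact (abs_add_le _ _).trans (by linarith [hqL c z])
    · filter_upwards [hpos] with z hz
      have ht := tendsto_regInv_mul hz.ne' hdl
      refine (Tendsto.const_mul _ (tendsto_finsetSum _ fun c _ => ?_)).add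
        (Tendsto.const_mul _ (tendsto_finsetSum _ fun c _ => ?_))
      · exact (((ht.const_mul 4).mul_const _).const_sub _).const_mul _
      · exact (((ht.const_mul 4).mul_const _).const_add _).const_mul _
  have hχE : IntegrableOn (fun z => χ z * (2 * E z)) W :=
    (integrable_mul_of_tsupport_subset hχ.continuous hc hs (hEi.const_mul 2)).integrableOn
  have hwi : ∀ c {f : ℂ → ℝ}, IntegrableOn f W → IntegrableOn (fun z => χ z * (w c z * f z)) W :=
    fun c f hf => (integrable_mul_of_tsupport_subset hχ.continuous hc hs
      ((hw₁ c).integrable_mul hW hf)).integrableOn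
  have rhs : Tendsto (fun k => ∫ z in W, (χ z * (2 * E z) + χ z * ∑ c, w c z * (b₁₁ c z + b₂₂ c z
          + (regInv (d k) (E z) * E z) * A c z
          + (deriv (regInv (d k)) (E z) * E z ^ 2) * B c z))) atTop
      (𝓝 (∫ z in W, χ z * (2 * E z))) := by
    refine tendsto_integral_of_dominated_convergence (fun z => |χ z * (2 * E z)|
      + ∑ c, |χ z * (w c z * (|b₁₁ c z + b₂₂ c z| + |A c z| + |B c z|))|) ?_ ?_ ?_ ?_
    · intro k
      refine hχE.1.add (hχ.continuous.aestronglyMeasurable.mul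
        (Finset.aestronglyMeasurable_fun_sum _ fun c _ => (hwc c).aestronglyMeasurable.mul ?_))
      exact (((h₁₁ c).integrable.1.add (h₂₂ c).integrable.1).add ((mreg k).mul (hAi c).1)).add
        ((mreg' k).mul (hBi c).1)
    · refine hχE.abs.add (integrable_finsetSum _ fun c _ => (hwi c ?_).abs)
      exact (((h₁₁ c).integrable.add (h₂₂ c).integrable).abs.add (hAi c).abs).add (hBi c).abs
    · intro k
      refine Eventually.of_forall fun z => ?_
      have hr := abs_regInv_mul_le (hd0 k) (E z)
      have hr' := abs_deriv_regInv_mul_le (hd0 k) (E z)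
      refine (norm_add_le _ _).trans (add_le_add le_rfl ?_)
      rw [Finset.mul_sum]
      refine (norm_sum_le _ _).trans (Finset.sum_le_sum fun c _ => ?_)
      rw [Real.norm_eq_abs, abs_mul, abs_mul, abs_mul (χ z), abs_mul (w c z)]
      refine mul_le_mul_of_nonneg_left (mul_le_mul_of_nonneg_left ?_ (abs_nonneg _))
        (abs_nonneg _)
      rw [abs_of_nonneg (by positivity : 0 ≤ |b₁₁ c z + b₂₂ c z| + |A c z| + |B c z|)]
      refine (abs_add_le _ _).trans (add_le_add ((abs_add_le _ _).trans (add_le_add le_rfl ?_)) ?_)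
      · rw [abs_mul]; exact mul_le_of_le_one_left (abs_nonneg _) hr
      · rw [abs_mul]; exact mul_le_of_le_one_left (abs_nonneg _) hr'
    · filter_upwards [hpos, hdiv] with z hz hz2
      have ht := tendsto_regInv_mul hz.ne' hdl
      have ht' := tendsto_deriv_regInv_mul hz.ne' hd0 hdl
      have h1 : Tendsto (fun k => χ z * (2 * E z) + χ z * ∑ c, w c z * (b₁₁ c z + b₂₂ c z
          + (regInv (d k) (E z) * E z) * A c z
          + (deriv (regInv (d k)) (E z) * E z ^ 2) * B c z)) atTop
          (𝓝 (χ z * (2 * E z) + χ z * ∑ c, w c z * (b₁₁ c z + b₂₂ c z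
          + 1 * A c z + (-1) * B c z))) := by
        refine Tendsto.const_add _ (Tendsto.const_mul _ (tendsto_finsetSum _ fun c _ => ?_))
        exact (((ht.mul_const _).const_add _).add (ht'.mul_const _)).const_mul _
      -- With the limits 1 and -1 inserted the bracket is the divergence equation `hdiv`, so only 2E
      -- survives.
      have h2 : ∀ c, b₁₁ c z + b₂₂ c z + 1 * A c z + (-1) * B c z = 0 := by
        intro c
        rw [← hz2 c]
        have h0 := hz.ne'
        simp only [hA, hB, Fin.sum_univ_three]
        field_simp
        ring
      simpa only [h2, mul_zero, Finset.sum_const_zero, add_zero] using h1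
  have kr : ∀ k, ∫ z in W, (fderiv ℝ χ z 1 * ∑ c, w c z * (p c z
          - 4 * (regInv (d k) (E z) * E z) * (a z / E z * p c z - b z / E z * q c z))
        + fderiv ℝ χ z Complex.I * ∑ c, w c z * (q c z + 4 * (regInv (d k) (E z) * E z)
          * (b z / E z * p c z + a z / E z * q c z)))
      = - ∫ z in W, (χ z * (2 * E z) + χ z * ∑ c, w c z * (b₁₁ c z + b₂₂ c z
          + (regInv (d k) (E z) * E z) * A c z
          + (deriv (regInv (d k)) (E z) * E z ^ 2) * B c z)) := by
    intro k
    rw [setIntegral_eq_integral_of_forall_compl_eq_zero,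
      setIntegral_eq_integral_of_forall_compl_eq_zero, reg (d k) (hd0 k)]
    · intro z hz
      rw [image_eq_zero_of_notMem_tsupport (fun h => hz (hs h))]; simp
    · intro z hz
      have h0 : ∀ e, fderiv ℝ χ z e = 0 := fun e => image_eq_zero_of_notMem_tsupport
        (f := fun w => fderiv ℝ χ w e) fun h => hz (hs' e h)
      simp [h0]
  simp_rw [kr] at lhs
  have fin := tendsto_nhds_unique lhs rhs.neg
  rw [setIntegral_eq_integral_of_forall_compl_eq_zero,
    setIntegral_eq_integral_of_forall_compl_eq_zero] at fin
  · rw [← fin]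
    refine integral_congr_ae (Eventually.of_forall fun z => ?_)
    simp only
    congr 2
    · refine Finset.sum_congr rfl fun c _ => ?_
      ring
    · refine Finset.sum_congr rfl fun c _ => ?_
      ring
  · intro z hz
    rw [image_eq_zero_of_notMem_tsupport (fun h => hz (hs h))]; simp
  · intro z hz
    have h0 : ∀ e, fderiv ℝ χ z e = 0 := fun e => image_eq_zero_of_notMem_tsupport
      (f := fun w => fderiv ℝ χ w e) fun h => hz (hs' e h)
    simp [h0]

/-- The flux identity for a conformal surface which satisfies `H = Re ⟨Q, h⁰⟩` with
`Q = (a + i b) dz²`. -/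
theorem IsConformalSurface.integral_flux {V : Set ℂ} {w n n₁ n₂ : Fin 3 → ℂ → ℝ}
    (h : IsConformalSurface V w n n₁ n₂) (hbd : Bornology.IsBounded V) {a b a₁ b₁ E : ℂ → ℝ}
    (ha₁ : HasApproxDeriv V 1 a a₁) (hb₁ : HasApproxDeriv V 1 b b₁)
    (ha₂ : HasApproxDeriv V Complex.I a (fun z => -b₁ z)) (hb₂ : HasApproxDeriv V Complex.I b a₁)
    (hE : ∀ z, E z = ∑ c, fderiv ℝ (w c) z 1 * fderiv ℝ (w c) z 1)
    (hell : ∀ᵐ z ∂(volume.restrict V), 16 * (a z ^ 2 + b z ^ 2) < E z ^ 2)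
    (heq : ∀ᵐ z ∂(volume.restrict V),
      (-∑ c, n₁ c z * fderiv ℝ (w c) z 1 + -∑ c, n₂ c z * fderiv ℝ (w c) z Complex.I) / (2 * E z)
      = 4 / E z ^ 2 * (a z * ((-∑ c, n₁ c z * fderiv ℝ (w c) z 1
            - -∑ c, n₂ c z * fderiv ℝ (w c) z Complex.I) / 2)
        - b z * ((-∑ c, n₁ c z * fderiv ℝ (w c) z Complex.I
            + -∑ c, n₂ c z * fderiv ℝ (w c) z 1) / 2)))
    {χ : ℂ → ℝ} (hχ : ContDiff ℝ ∞ χ) (hc : HasCompactSupport χ) (hs : tsupport χ ⊆ V) :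
    ∫ z, (fderiv ℝ χ z 1 * ∑ c, w c z * (fderiv ℝ (w c) z 1
          - 4 * (a z * fderiv ℝ (w c) z 1 - b z * fderiv ℝ (w c) z Complex.I) / E z)
        + fderiv ℝ χ z Complex.I * ∑ c, w c z * (fderiv ℝ (w c) z Complex.I
          + 4 * (b z * fderiv ℝ (w c) z 1 + a z * fderiv ℝ (w c) z Complex.I) / E z))
      = - ∫ z, χ z * (2 * E z) := by
  obtain ⟨L, hL⟩ := h.lipschitz
  -- Regularity is local, so the argument runs on a neighbourhood `W` of the support of the test
  -- function.
  obtain ⟨W, hW, hKW, hWV, b₁₁, b₂₁, b₁₂, b₂₂, h₁₁, h₂₁, h₁₂, h₂₂⟩ :=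
    h.exists_second_deriv hc.isCompact hs
  have h' := h.mono hW hWV
  have hrel := h'.ae_relations h₁₁ h₂₁ h₁₂ h₂₂
  have hconf := h'.conformal
  have hpos := h'.pos
  simp only [← hE] at hconf hpos
  refine integral_flux_of_divergence hW h'.volume_ne_top (L := L) (fun c => (hL c).continuous)
    (fun c => (hasApproxDeriv_of_lipschitz (hL c) (hbd.subset hWV) 1).1)
    (fun c => (hasApproxDeriv_of_lipschitz (hL c) (hbd.subset hWV) Complex.I).1)
    h₁₁ h₂₁ h₁₂ h₂₂ (ha₁.mono hWV) (hb₁.mono hWV) (ha₂.mono hWV) (hb₂.mono hWV)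
    (fun c z => by simpa using abs_fderiv_apply_le_of_lipschitz (hL c) z 1)
    (fun c z => by simpa using abs_fderiv_apply_le_of_lipschitz (hL c) z Complex.I)
    hE hpos hconf h'.orthogonal (ae_restrict_of_ae_restrict_of_subset hWV hell) ?_ hχ hc hKW
  filter_upwards [hrel, hconf, hpos, h'.orthogonal, h'.normal₁, h'.normal₂, h'.rotate₁,
    ae_restrict_of_ae_restrict_of_subset hWV heq] with z hr z1 z2 z3 z4 z5 z6 z7 c
  obtain ⟨s0, s1, s2, s3, s4, s5, s6, s7, s8⟩ := hr
  exact divergence_term_eq_zero (p := fun c => fderiv ℝ (w c) z 1)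
    (q := fun c => fderiv ℝ (w c) z Complex.I) (n := fun c => n c z) (n₁ := fun c => n₁ c z)
    (n₂ := fun c => n₂ c z) (b₁₁ := fun c => b₁₁ c z) (b₂₁ := fun c => b₂₁ c z)
    (b₁₂ := fun c => b₁₂ c z) (b₂₂ := fun c => b₂₂ c z)
    (hE z) z1 z2 z3 z4 z5 z6 s0 s1 s2 s3 s4 s5 s6 s7 s8 z7 c

end CCM


/-! ### Pointwise geometry of a conformal parametrisation. -/

namespace CCM

open Filter Topology

/-- The flux of a parametrised surface `u` with quadratic form `f dz²`, paired with the
differential of the function `η`. -/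
noncomputable def fluxDensity (u : ℂ → Space) (f : ℂ → ℂ) (η : ℂ → ℝ) (z : ℂ) : ℝ :=
  (inner ℝ (u z) (fderiv ℝ u z 1) * fderiv ℝ η z 1
      + inner ℝ (u z) (fderiv ℝ u z Complex.I) * fderiv ℝ η z Complex.I)
    - 4 / conformalFactor u z
      * ((f z).re * (inner ℝ (u z) (fderiv ℝ u z 1) * fderiv ℝ η z 1
          - inner ℝ (u z) (fderiv ℝ u z Complex.I) * fderiv ℝ η z Complex.I)
        - (f z).im * (inner ℝ (u z) (fderiv ℝ u z 1) * fderiv ℝ η z Complex.I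
          + inner ℝ (u z) (fderiv ℝ u z Complex.I) * fderiv ℝ η z 1))

theorem inner_eq_sum (a b : Space) : inner ℝ a b = ∑ c, a c * b c := by
  simp [PiLp.inner_apply, mul_comm]

theorem cross_apply_eq (a b : Space) (c : Fin 3) :
    cross a b c = a (c + 1) * b (c + 2) - a (c + 2) * b (c + 1) := by
  fin_cases c <;> simp [cross, crossProduct]

theorem norm_cross_sq (a b : Space) :
    ‖cross a b‖ ^ 2 = (∑ c, a c * a c) * (∑ c, b c * b c) - (∑ c, a c * b c) ^ 2 := by
  rw [EuclideanSpace.real_norm_sq_eq]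
  simp only [cross_apply_eq, Fin.sum_univ_three, Fin.isValue, Fin.reduceAdd, zero_add]
  ring

theorem norm_unitNormal_le (e₁ e₂ : ℂ) (u : ℂ → Space) (z : ℂ) : ‖unitNormal e₁ e₂ u z‖ ≤ 1 := by
  rw [unitNormal, norm_smul, norm_inv, norm_norm]
  exact inv_mul_le_one

theorem conformalFactor_eq_sum (u : ℂ → Space) (z : ℂ) :
    conformalFactor u z = ∑ c, fderiv ℝ u z 1 c * fderiv ℝ u z 1 c := by
  rw [conformalFactor, EuclideanSpace.real_norm_sq_eq]
  simp only [sq]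

theorem conformalAt_relations {u : ℂ → Space} {z : ℂ} (h : ConformalAt u z) :
    0 < conformalFactor u z ∧
      ∑ c, fderiv ℝ u z Complex.I c * fderiv ℝ u z Complex.I c = conformalFactor u z ∧
      ∑ c, fderiv ℝ u z 1 c * fderiv ℝ u z Complex.I c = 0 := by
  obtain ⟨f', hf, k, hk, li, rfl⟩ := h
  simp only [conformalFactor, ← inner_eq_sum, hf.fderiv]
  simp only [smul_apply, LinearIsometry.coe_toContinuousLinearMap,
    inner_smul_left, inner_smul_right, li.inner_map_map, norm_smul, li.norm_map]
  refine ⟨by simpa using sq_pos_of_ne_zero (by simpa using hk), ?_, ?_⟩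
  · simp [sq]
  · simp [Complex.inner]

theorem norm_cross_of_conformalAt {u : ℂ → Space} {z : ℂ} (h : ConformalAt u z) :
    ‖cross (fderiv ℝ u z 1) (fderiv ℝ u z Complex.I)‖ = conformalFactor u z := by
  obtain ⟨h1, h2, h3⟩ := conformalAt_relations h
  refine (pow_left_inj₀ (norm_nonneg _) h1.le two_ne_zero).1 ?_
  rw [norm_cross_sq, h2, h3, ← conformalFactor_eq_sum]
  ring

theorem unitNormal_apply_of_conformalAt {u : ℂ → Space} {z : ℂ} (h : ConformalAt u z) (c : Fin 3) :
    unitNormal 1 Complex.I u z c = (conformalFactor u z)⁻¹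
      * (fderiv ℝ u z 1 (c + 1) * fderiv ℝ u z Complex.I (c + 2)
        - fderiv ℝ u z 1 (c + 2) * fderiv ℝ u z Complex.I (c + 1)) := by
  rw [unitNormal, norm_cross_of_conformalAt h, PiLp.smul_apply, cross_apply_eq, smul_eq_mul]

/-- With n = (p × q)/E, the triple product gives n × p = q and n × q = -p, because |p|² = |q|² = E
and p · q = 0. -/
theorem unitNormal_relations {u : ℂ → Space} {z : ℂ} (h : ConformalAt u z) :
    ∑ c, unitNormal 1 Complex.I u z c * fderiv ℝ u z 1 c = 0 ∧
      ∑ c, unitNormal 1 Complex.I u z c * fderiv ℝ u z Complex.I c = 0 ∧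
      (∀ c, fderiv ℝ u z Complex.I c
        = unitNormal 1 Complex.I u z (c + 1) * fderiv ℝ u z 1 (c + 2)
          - unitNormal 1 Complex.I u z (c + 2) * fderiv ℝ u z 1 (c + 1)) ∧
      ∀ c, - fderiv ℝ u z 1 c
        = unitNormal 1 Complex.I u z (c + 1) * fderiv ℝ u z Complex.I (c + 2)
          - unitNormal 1 Complex.I u z (c + 2) * fderiv ℝ u z Complex.I (c + 1) := by
  obtain ⟨h1, h2, h3⟩ := conformalAt_relations h
  have h0 := conformalFactor_eq_sum u z
  simp only [unitNormal_apply_of_conformalAt h]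
  generalize conformalFactor u z = E at *
  generalize fderiv ℝ u z 1 = p at *
  generalize fderiv ℝ u z Complex.I = q at *
  simp only [Fin.sum_univ_three] at h0 h2 h3 ⊢
  refine ⟨?_, ?_, fun c => ?_, fun c => ?_⟩
  · simp only [Fin.isValue, Fin.reduceAdd, zero_add]; ring
  · simp only [Fin.isValue, Fin.reduceAdd, zero_add]; ring
  · have hE := h1.ne'
    fin_cases c <;> simp only [Fin.isValue, Fin.reduceAdd, zero_add, Fin.zero_eta, Fin.mk_one,
      Fin.reduceFinMk] <;> field_simp
    · linear_combination q 0 * h0 + p 0 * h3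
    · linear_combination q 1 * h0 + p 1 * h3
    · linear_combination q 2 * h0 + p 2 * h3
  · have hE := h1.ne'
    fin_cases c <;> simp only [Fin.isValue, Fin.reduceAdd, zero_add, Fin.zero_eta, Fin.mk_one,
      Fin.reduceFinMk] <;> field_simp
    · linear_combination p 0 * h2 - q 0 * h3
    · linear_combination p 1 * h2 - q 1 * h3
    · linear_combination p 2 * h2 - q 2 * h3

theorem fderiv_coord {u : ℂ → Space} {w : ℂ → ℝ} {z : ℂ} {c : Fin 3} (hu : DifferentiableAt ℝ u z)
    (hw : w =ᶠ[𝓝 z] fun y => u y c) (v : ℂ) : fderiv ℝ w z v = fderiv ℝ u z v c := by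
  rw [hw.fderiv_eq]
  have := (EuclideanSpace.proj (𝕜 := ℝ) c).hasFDerivAt.comp z hu.hasFDerivAt
  exact congrArg (fun L => L v) this.fderiv

end CCM


/-! ### The flux identity in a conformal chart. -/

namespace CCM

open Filter Topology

variable {U V : Set ℂ}

/-- The mollification arguments want functions that are Lipschitz on the whole plane. Near a compact
set each coordinate is Lipschitz, hence extends; on the open set `V` nothing changes, derivatives
included. -/
theorem exists_lipschitz_extension {u : ℂ → Space} (hu : LocallyLipschitzOn U u)
    (hV : IsCompact (closure V)) (hVU : closure V ⊆ U) :
    ∃ w : Fin 3 → ℂ → ℝ, (∃ L : NNReal, ∀ c, LipschitzWith L (w c)) ∧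
      ∀ z ∈ V, ∀ c, w c z = u z c := by
  obtain ⟨L, hL⟩ := (hu.mono hVU).exists_lipschitzOnWith_of_compact hV
  have h1 : ∀ c : Fin 3, ∃ g : ℂ → ℝ, LipschitzWith L g ∧
      Set.EqOn (fun z => u z c) g (closure V) := fun c => by
    refine LipschitzOnWith.extend_real (LipschitzOnWith.of_dist_le_mul fun x hx y hy => ?_)
    refine le_trans ?_ (hL.dist_le_mul x hx y hy)
    rw [dist_eq_norm, dist_eq_norm]
    exact PiLp.norm_apply_le (u x - u y) c
  choose w hw1 hw2 using h1
  exact ⟨w, ⟨L, hw1⟩, fun z hz c => (hw2 c (subset_closure hz)).symm⟩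

theorem weak_coord (hvol : volume V ≠ ⊤) {m : ℂ → Space} {m' : ℂ → ℂ →L[ℝ] Space}
    (hm : MemLp m 2 (volume.restrict V)) (hm' : MemLp m' 2 (volume.restrict V)) {v : ℂ}
    {χ : ℂ → ℝ} (hχ : ContDiff ℝ ∞ χ) (hc : HasCompactSupport χ) (hs : tsupport χ ⊆ V)
    (h : ∫ z, (fderiv ℝ χ z v) • m z = - ∫ z, χ z • m' z v) (c : Fin 3) :
    ∫ z, fderiv ℝ χ z v * m z c = - ∫ z, χ z * m' z v c := by
  have : IsFiniteMeasure (volume.restrict V) := ⟨by simpa using hvol.lt_top⟩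
  have hi : ∀ {θ : ℂ → ℝ} {g : ℂ → Space}, Continuous θ → HasCompactSupport θ → tsupport θ ⊆ V →
      IntegrableOn g V → Integrable fun z => θ z • g z := by
    intro θ g h1 h2 h3 h4
    obtain ⟨M, hM⟩ := h2.exists_bound_of_continuous h1
    have h5 : IntegrableOn (fun z => θ z • g z) (tsupport θ) :=
      (h4.mono_set h3).bdd_smul M h1.aestronglyMeasurable (Eventually.of_forall hM)
    refine (integrableOn_iff_integrable_of_support_subset fun z hz => ?_).1 h5
    by_contra hz'
    exact hz (by simp [image_eq_zero_of_notMem_tsupport hz'])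
  have hm1 : IntegrableOn m V := hm.integrable one_le_two
  have hm2 : IntegrableOn (fun z => m' z v) V :=
    ContinuousLinearMap.integrable_comp (ContinuousLinearMap.apply ℝ Space v)
      (hm'.integrable one_le_two)
  have h1 := (EuclideanSpace.proj (𝕜 := ℝ) c).integral_comp_comm
    (hi (contDiff_fderiv_apply hχ v).continuous (hasCompactSupport_fderiv_apply hc v)
      ((tsupport_fderiv_apply_subset χ v).trans hs) hm1)
  have h2 := (EuclideanSpace.proj (𝕜 := ℝ) c).integral_comp_comm (hi hχ.continuous hc hs hm2)
  rw [h, map_neg, ← h2] at h1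
  simpa using h1

theorem isConformalSurface_of_conformalAt {u : ℂ → Space} (hV : IsOpen V)
    (hVc : IsCompact (closure V)) (hVU : closure V ⊆ U)
    (hconf : ∀ᵐ z ∂(volume.restrict V), ConformalAt u z) {n' : ℂ → ℂ →L[ℝ] Space}
    (hn : HasW12LocDerivOn U (unitNormal 1 Complex.I u) n') {w : Fin 3 → ℂ → ℝ}
    (hL : ∃ L : NNReal, ∀ c, LipschitzWith L (w c)) (hw : ∀ z ∈ V, ∀ c, w c z = u z c) :
    IsConformalSurface V w (fun c z => unitNormal 1 Complex.I u z c) (fun c z => n' z 1 c)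
      (fun c z => n' z Complex.I c) := by
  have hvol : volume V ≠ ⊤ := ((measure_mono subset_closure).trans_lt hVc.measure_lt_top).ne
  have hle : volume.restrict V ≤ volume.restrict (closure V) :=
    Measure.restrict_mono subset_closure le_rfl
  have hm : MemLp (unitNormal 1 Complex.I u) 2 (volume.restrict V) :=
    (hn.memL2 _ hVc hVU).mono_measure hle
  have hm' : MemLp n' 2 (volume.restrict V) := (hn.memL2_deriv _ hVc hVU).mono_measure hle
  have hco : ∀ᵐ z ∂(volume.restrict V), ConformalAt u z ∧
      ∀ c v, fderiv ℝ (w c) z v = fderiv ℝ u z v c := by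
    filter_upwards [hconf, ae_restrict_mem hV.measurableSet] with z h1 h2
    refine ⟨h1, fun c v => fderiv_coord h1.differentiableAt ?_ v⟩
    filter_upwards [hV.mem_nhds h2] with y hy using hw y hy c
  have hmem : ∀ (v : ℂ) (c : Fin 3), MemLp (fun z => n' z v c) 2 (volume.restrict V) := fun v c =>
    ((EuclideanSpace.proj (𝕜 := ℝ) c).comp (ContinuousLinearMap.apply ℝ Space v)).comp_memLp' hm'
  have hweak : ∀ (v : ℂ) (c : Fin 3) (χ : ℂ → ℝ), ContDiff ℝ ∞ χ → HasCompactSupport χ →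
      tsupport χ ⊆ V → ∫ z, fderiv ℝ χ z v * unitNormal 1 Complex.I u z c
        = - ∫ z, χ z * n' z v c := fun v c χ hχ hc hs =>
    weak_coord hvol hm hm' hχ hc hs
      (hn.isWeakFDeriv.2.2 χ hχ hc (hs.trans (subset_closure.trans hVU)) v) c
  refine ⟨hV, hvol, hL, fun c => ?_, fun c z => ?_, hmem 1, hmem Complex.I, hweak 1,
    hweak Complex.I, ?_, ?_, ?_, ?_, ?_, ?_, ?_⟩
  · exact ((EuclideanSpace.proj (𝕜 := ℝ) c).comp_memLp' hm).1
  · exact (PiLp.norm_apply_le _ c).trans (norm_unitNormal_le _ _ u z)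
  all_goals
    filter_upwards [hco] with z hz
    obtain ⟨h1, h2⟩ := hz
    obtain ⟨r1, r2, r3⟩ := conformalAt_relations h1
    obtain ⟨s1, s2, s3, s4⟩ := unitNormal_relations h1
    simp only [h2]
  · rwa [← conformalFactor_eq_sum]
  · rw [r2, conformalFactor_eq_sum]
  · exact r3
  · exact s1
  · exact s2
  · exact s3
  · exact s4

/-- The Cauchy–Riemann equations, from ∂₂f = i f'. This is where holomorphy of the quadratic form
enters. -/
theorem hasApproxDeriv_re_im {f : ℂ → ℂ} (hU : IsOpen U) (hf : DifferentiableOn ℂ f U)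
    (hV : IsOpen V) (hVc : IsCompact (closure V)) (hVU : closure V ⊆ U) :
    HasApproxDeriv V 1 (fun z => (f z).re) (fun z => (deriv f z).re) ∧
    HasApproxDeriv V 1 (fun z => (f z).im) (fun z => (deriv f z).im) ∧
    HasApproxDeriv V Complex.I (fun z => (f z).re) (fun z => -(deriv f z).im) ∧
    HasApproxDeriv V Complex.I (fun z => (f z).im) (fun z => (deriv f z).re) := by
  have hfs : ContDiffOn ℝ ∞ f U := (hf.contDiffOn hU).restrict_scalars ℝ
  have key : ∀ (l : ℂ →L[ℝ] ℝ) (e : ℂ),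
      HasApproxDeriv V e (fun z => l (f z)) (fun z => l (deriv f z * e)) := by
    intro l e
    have h1 : ContDiffOn ℝ ∞ (fun z => l (f z)) U := l.contDiff.comp_contDiffOn hfs
    obtain ⟨C, hC⟩ := hVc.exists_bound_of_continuousOn (h1.continuousOn.mono hVU)
    have h2 : ContinuousOn (fun z => fderiv ℝ (fun z => l (f z)) z e) (closure V) :=
      ((h1.continuousOn_fderiv_of_isOpen hU (by simp)).mono hVU).clm_apply continuousOn_const
    refine (HasApproxDeriv.of_contDiffOn (h1.mono (subset_closure.trans hVU))
      (fun z hz => hC z (subset_closure hz))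
      ((h2.integrableOn_compact hVc).mono_set subset_closure)).congr
      (Eventually.of_forall fun z => rfl) ?_
    filter_upwards [ae_restrict_mem hV.measurableSet] with z hz
    have h3 := ((hf.differentiableAt (hU.mem_nhds (hVU (subset_closure hz)))).hasDerivAt
      ).hasFDerivAt.restrictScalars ℝ
    have h4 := (l.hasFDerivAt.comp z h3).fderiv
    have h5 := congrArg (fun L => L e) h4
    simp only [Function.comp_def] at h5
    rw [h5]
    simp [mul_comm]
  refine ⟨?_, ?_, ?_, ?_⟩
  · simpa using key Complex.reCLM 1
  · simpa using key Complex.imCLM 1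
  · simpa using key Complex.reCLM Complex.I
  · simpa using key Complex.imCLM Complex.I

theorem re_conj_mul (c : ℂ) (x y : ℝ) :
    (conj c * (((x : ℂ) - Complex.I * (y : ℂ)) / 2)).re = c.re * (x / 2) - c.im * (y / 2) := by
  have h : ((x : ℂ) - Complex.I * (y : ℂ)) / 2 = ((x / 2 : ℝ) : ℂ) - Complex.I * ((y / 2 : ℝ) : ℂ) := by
    push_cast
    ring
  rw [h]
  simp

/-- The flux identity in a conformal chart. -/
theorem integral_fluxDensity (hU : IsOpen U) {u : ℂ → Space} (hu : LocallyLipschitzOn U u)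
    (hconf : ∀ᵐ z ∂(volume.restrict U), ConformalAt u z) {f : ℂ → ℂ} (hf : DifferentiableOn ℂ f U)
    {n' : ℂ → ℂ →L[ℝ] Space} (hn : HasW12LocDerivOn U (unitNormal 1 Complex.I u) n')
    (heq : ∀ᵐ z ∂(volume.restrict U), meanCurvature u n' z
      = rePairing (conformalFactor u z) (f z) (weingartenCoeff u n' z))
    (hell : ∀ᵐ z ∂(volume.restrict U), 2 * formNorm (conformalFactor u z) (f z) < 1)
    {χ : ℂ → ℝ} (hχ : ContDiff ℝ ∞ χ) (hc : HasCompactSupport χ) (hs : tsupport χ ⊆ U) :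
    ∫ z, fluxDensity u f χ z = - ∫ z, χ z * (2 * conformalFactor u z) := by
  -- Relative compactness in `U` turns the local Lipschitz and L² bounds into uniform ones on `V`.
  obtain ⟨K, hK, hK1, hK2⟩ := exists_compact_between hc.isCompact hU hs
  set V := interior K
  have hVK : closure V ⊆ K := closure_minimal interior_subset hK.isClosed
  have hVc : IsCompact (closure V) := hK.of_isClosed_subset isClosed_closure hVK
  have hVU : closure V ⊆ U := hVK.trans hK2
  have hV : IsOpen V := isOpen_interior
  have hVU' : V ⊆ U := subset_closure.trans hVU
  obtain ⟨w, hL, hw⟩ := exists_lipschitz_extension hu hVc hVU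
  have hconf' := ae_restrict_of_ae_restrict_of_subset hVU' hconf
  have hS := isConformalSurface_of_conformalAt hV hVc hVU hconf' hn hL hw
  obtain ⟨ha₁, hb₁, ha₂, hb₂⟩ := hasApproxDeriv_re_im hU hf hV hVc hVU
  have hco : ∀ᵐ z ∂(volume.restrict V), ConformalAt u z ∧
      (∑ c, fderiv ℝ (w c) z 1 * fderiv ℝ (w c) z 1 = conformalFactor u z) ∧
      (∀ c, w c z = u z c) ∧ ∀ c v, fderiv ℝ (w c) z v = fderiv ℝ u z v c := by
    filter_upwards [hconf', ae_restrict_mem hV.measurableSet] with z h1 h2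
    have h3 : ∀ c v, fderiv ℝ (w c) z v = fderiv ℝ u z v c := fun c v => by
      refine fderiv_coord h1.differentiableAt ?_ v
      filter_upwards [hV.mem_nhds h2] with y hy using hw y hy c
    exact ⟨h1, by simp only [h3, conformalFactor_eq_sum], hw z h2, h3⟩
  have h0 : ∀ z ∉ V, χ z = 0 ∧ ∀ v, fderiv ℝ χ z v = 0 := fun z hz =>
    ⟨image_eq_zero_of_notMem_tsupport fun h => hz (hK1 h), fun v =>
      image_eq_zero_of_notMem_tsupport (f := fun z => fderiv ℝ χ z v)
        fun h => hz (hK1 (tsupport_fderiv_apply_subset χ v h))⟩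
  have hmain := hS.integral_flux (hVc.isBounded.subset subset_closure) ha₁ hb₁ ha₂ hb₂
    (fun z => rfl) ?_ ?_ hχ hc hK1
  · refine (integral_congr_ae ?_).trans (hmain.trans (congrArg Neg.neg (integral_congr_ae ?_)))
    · filter_upwards [(ae_restrict_iff' hV.measurableSet).1 hco] with z hz
      by_cases hzV : z ∈ V
      · obtain ⟨-, h2, h3, h4⟩ := hz hzV
        rw [h2]
        simp only [h3, h4, fluxDensity, inner_eq_sum, Fin.sum_univ_three]
        ring
      · simp [fluxDensity, (h0 z hzV).2]
    · filter_upwards [(ae_restrict_iff' hV.measurableSet).1 hco] with z hz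
      by_cases hzV : z ∈ V
      · rw [(hz hzV).2.1]
      · simp [(h0 z hzV).1]
  · filter_upwards [hco, ae_restrict_of_ae_restrict_of_subset hVU' hell] with z hz h1
    have hE := (conformalAt_relations hz.1).1
    simp only [hz.2.1]
    rw [formNorm, rePairing] at h1
    have h2 : Real.sqrt (4 / conformalFactor u z ^ 2 * (conj (f z) * f z).re) < 1 / 2 := by linarith
    rw [Real.sqrt_lt' (by norm_num), div_mul_eq_mul_div, div_lt_iff₀ (by positivity)] at h2
    simp only [Complex.mul_re, Complex.conj_re, Complex.conj_im] at h2
    nlinarith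
  · filter_upwards [hco, ae_restrict_of_ae_restrict_of_subset hVU' heq] with z hz h1
    simp only [hz.2.1]
    simp only [hz.2.2.2]
    simp only [meanCurvature, rePairing, weingartenCoeff, secondForm, inner_eq_sum] at h1
    rw [h1, re_conj_mul]

end CCM


/-! ### Invariance and integrability of the flux. -/

namespace CCM

open Filter Topology

theorem abs_det_fderiv_of_differentiableAt {F : ℂ → ℂ} {z : ℂ} (hF : DifferentiableAt ℂ F z) :
    |(fderiv ℝ F z).det| = Complex.normSq (deriv F z) := by
  have h1 := hF.hasDerivAt.hasFDerivAt.restrictScalars ℝ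
  rw [h1.fderiv]
  have h2 : LinearMap.det ((ContinuousLinearMap.toSpanSingleton ℂ (deriv F z)).restrictScalars ℝ
      : ℂ →ₗ[ℝ] ℂ) = Complex.normSq (deriv F z) := by
    have h3 := LinearMap.det_restrictScalars (R := ℝ)
      (f := (ContinuousLinearMap.toSpanSingleton ℂ (deriv F z) : ℂ →ₗ[ℂ] ℂ))
    rw [Algebra.norm_complex_apply] at h3
    simpa using h3
  exact (congrArg abs h2).trans (abs_of_nonneg (Complex.normSq_nonneg _))

theorem fderiv_comp_of_holomorphic {E : Type*} [NormedAddCommGroup E] [NormedSpace ℝ E]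
    {u v : ℂ → E} {F : ℂ → ℂ} {z : ℂ} (hF : DifferentiableAt ℂ F z)
    (hv : DifferentiableAt ℝ v (F z)) (h : u =ᶠ[𝓝 z] fun y => v (F y)) :
    fderiv ℝ u z 1 = (deriv F z).re • fderiv ℝ v (F z) 1
        + (deriv F z).im • fderiv ℝ v (F z) Complex.I ∧
      fderiv ℝ u z Complex.I = -((deriv F z).im • fderiv ℝ v (F z) 1)
        + (deriv F z).re • fderiv ℝ v (F z) Complex.I := by
  have h1 := (hv.hasFDerivAt.comp z (hF.hasDerivAt.hasFDerivAt.restrictScalars ℝ)).fderiv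
  rw [h.fderiv_eq]
  have h2 : ∀ a : ℂ, fderiv ℝ (fun y => v (F y)) z a = fderiv ℝ v (F z) (a * deriv F z) := fun a => by
    have := congrArg (fun L => L a) h1
    simpa [Function.comp_def] using this
  rw [h2, h2]
  generalize deriv F z = c
  constructor
  · rw [← map_smul, ← map_smul, ← map_add]
    congr 1
    apply Complex.ext <;> simp
  · rw [← map_smul, ← map_smul, ← map_neg, ← map_add]
    congr 1
    apply Complex.ext <;> simp

/-- The flux, as a density, does not depend on the conformal chart. -/
theorem fluxDensity_comp {u v : ℂ → Space} {f g : ℂ → ℂ} {η θ : ℂ → ℝ} {F : ℂ → ℂ} {z : ℂ}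
    (hF : DifferentiableAt ℂ F z) (hF0 : deriv F z ≠ 0) (hv : ConformalAt v (F z))
    (huv : u =ᶠ[𝓝 z] fun y => v (F y)) (hθ : DifferentiableAt ℝ θ (F z))
    (hηθ : η =ᶠ[𝓝 z] fun y => θ (F y)) (hfg : f z = g (F z) * deriv F z ^ 2) :
    fluxDensity u f η z = Complex.normSq (deriv F z) * fluxDensity v g θ (F z) := by
  obtain ⟨u1, u2⟩ := fderiv_comp_of_holomorphic hF hv.differentiableAt huv
  obtain ⟨e1, e2⟩ := fderiv_comp_of_holomorphic hF hθ hηθ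
  obtain ⟨c1, c2, c3⟩ := conformalAt_relations hv
  have hc : 0 < Complex.normSq (deriv F z) := Complex.normSq_pos.2 hF0
  have hE : conformalFactor u z = Complex.normSq (deriv F z) * conformalFactor v (F z) := by
    have h0 := conformalFactor_eq_sum v (F z)
    rw [conformalFactor_eq_sum, u1, Complex.normSq_apply]
    simp only [Fin.sum_univ_three, PiLp.add_apply, PiLp.smul_apply, smul_eq_mul] at c2 c3 h0 ⊢
    linear_combination (-(deriv F z).re ^ 2) * h0 + (deriv F z).im ^ 2 * c2
      + 2 * (deriv F z).re * (deriv F z).im * c3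
  have hu0 : u z = v (F z) := huv.eq_of_nhds
  -- With α = 2⟨u, ∂_z u⟩ and β = 2 ∂_z η, the flux is Re(α β̄) - (4/E) Re(f · conj(αβ)). Here α and
  -- β acquire F', f acquires F'² and E acquires |F'|², so both terms acquire |F'|².
  simp only [fluxDensity, hE, u1, u2, e1, e2, hfg, hu0, inner_add_right, inner_neg_right,
    inner_smul_right, smul_eq_mul, sq, Complex.mul_re, Complex.mul_im]
  rw [Complex.normSq_apply] at hc ⊢
  generalize (deriv F z).re = x at *
  generalize (deriv F z).im = y at *
  generalize conformalFactor v (F z) = E at *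
  have hc0 : x ^ 2 + y ^ 2 ≠ 0 := by nlinarith
  field_simp
  ring

variable {U K : Set ℂ} {u : ℂ → Space} {f : ℂ → ℂ}

theorem memLp_top_inner_fderiv (hU : IsOpen U) (hu : LocallyLipschitzOn U u) (hK : IsCompact K)
    (hKU : K ⊆ U) (v : ℂ) :
    MemLp (fun z => inner ℝ (u z) (fderiv ℝ u z v)) ⊤ (volume.restrict K) ∧
      MemLp (fun z => fderiv ℝ u z v) ⊤ (volume.restrict K) := by
  obtain ⟨K', hK', hKK', hKU'⟩ := exists_compact_between hK hU hKU
  obtain ⟨L, hL⟩ := (hu.mono hKU').exists_lipschitzOnWith_of_compact hK'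
  have hcont : ContinuousOn u K := (hL.mono (hKK'.trans interior_subset)).continuousOn
  obtain ⟨M, hM⟩ := hK.exists_bound_of_continuousOn hcont
  have hb : ∀ z ∈ K, ‖fderiv ℝ u z v‖ ≤ L * ‖v‖ := fun z hz =>
    (ContinuousLinearMap.le_opNorm _ _).trans (mul_le_mul_of_nonneg_right
      (norm_fderiv_le_of_lipschitzOn ℝ (mem_interior_iff_mem_nhds.1 (hKK' hz)) hL) (norm_nonneg v))
  have hm : AEStronglyMeasurable (fun z => fderiv ℝ u z v) (volume.restrict K) :=
    (measurable_fderiv_apply_const ℝ u v).aestronglyMeasurable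
  refine ⟨memLp_top_of_bound ((hcont.aestronglyMeasurable hK.measurableSet).inner hm)
    (M * (L * ‖v‖)) ?_, memLp_top_of_bound hm (L * ‖v‖) ?_⟩
  · filter_upwards [ae_restrict_mem hK.measurableSet] with z hz
    exact (norm_inner_le_norm _ _).trans
      (mul_le_mul (hM z hz) (hb z hz) (norm_nonneg _) ((norm_nonneg _).trans (hM z hz)))
  · filter_upwards [ae_restrict_mem hK.measurableSet] with z hz using hb z hz

theorem memLp_top_conformalFactor (hU : IsOpen U) (hu : LocallyLipschitzOn U u) (hK : IsCompact K)
    (hKU : K ⊆ U) : MemLp (conformalFactor u) ⊤ (volume.restrict K) := by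
  have h := (memLp_top_inner_fderiv hU hu hK hKU 1).2.norm
  refine (h.mul (p := ⊤) (q := ⊤) (r := ⊤) h).ae_eq (Eventually.of_forall fun z => ?_)
  simp [conformalFactor, sq]

/-- Ellipticity bounds both functions by 1, since it says 4|f| < E. This makes the flux locally
bounded. -/
theorem memLp_top_div_conformalFactor (hU : IsOpen U) (hf : DifferentiableOn ℂ f U)
    (hconf : ∀ᵐ z ∂(volume.restrict U), ConformalAt u z)
    (hell : ∀ᵐ z ∂(volume.restrict U), 2 * formNorm (conformalFactor u z) (f z) < 1)
    (hu : LocallyLipschitzOn U u) (hK : IsCompact K) (hKU : K ⊆ U) :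
    MemLp (fun z => 4 / conformalFactor u z * (f z).re) ⊤ (volume.restrict K) ∧
      MemLp (fun z => 4 / conformalFactor u z * (f z).im) ⊤ (volume.restrict K) := by
  have hmE : AEMeasurable (conformalFactor u) (volume.restrict K) :=
    (memLp_top_conformalFactor hU hu hK hKU).1.aemeasurable
  have hmf : AEMeasurable f (volume.restrict K) :=
    (hf.continuousOn.mono hKU).aemeasurable hK.measurableSet
  have hb : ∀ᵐ z ∂(volume.restrict K), |4 / conformalFactor u z * (f z).re| ≤ 1 ∧
      |4 / conformalFactor u z * (f z).im| ≤ 1 := by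
    filter_upwards [ae_restrict_of_ae_restrict_of_subset hKU hconf,
      ae_restrict_of_ae_restrict_of_subset hKU hell] with z h1 h2
    have hE := (conformalAt_relations h1).1
    rw [formNorm, rePairing] at h2
    have h3 : Real.sqrt (4 / conformalFactor u z ^ 2 * (conj (f z) * f z).re) < 1 / 2 := by
      linarith
    rw [Real.sqrt_lt' (by norm_num), div_mul_eq_mul_div, div_lt_iff₀ (by positivity)] at h3
    simp only [Complex.mul_re, Complex.conj_re, Complex.conj_im] at h3
    constructor
    all_goals
      rw [div_mul_eq_mul_div, abs_div, abs_of_pos hE, div_le_one hE]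
      refine abs_le_of_sq_le_sq ?_ hE.le
      nlinarith [sq_nonneg (f z).re, sq_nonneg (f z).im]
  constructor
  · refine memLp_top_of_bound (((hmE.const_div 4).mul
      (Complex.measurable_re.comp_aemeasurable hmf)).aestronglyMeasurable) 1 ?_
    filter_upwards [hb] with z hz using hz.1
  · refine memLp_top_of_bound (((hmE.const_div 4).mul
      (Complex.measurable_im.comp_aemeasurable hmf)).aestronglyMeasurable) 1 ?_
    filter_upwards [hb] with z hz using hz.2

/-- Vanishing off a compact set is required of the product, because in the application it may come
from `θ` or from `η`. -/
theorem integrableOn_mul_fluxDensity (hU : IsOpen U) (hu : LocallyLipschitzOn U u)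
    (hconf : ∀ᵐ z ∂(volume.restrict U), ConformalAt u z) (hf : DifferentiableOn ℂ f U)
    (hell : ∀ᵐ z ∂(volume.restrict U), 2 * formNorm (conformalFactor u z) (f z) < 1)
    {θ η : ℂ → ℝ} (hθ : ContinuousOn θ U) (hη : ContDiffOn ℝ ∞ η U) (hK : IsCompact K)
    (hKU : K ⊆ U) (h0 : ∀ z ∈ U, z ∉ K → θ z * fluxDensity u f η z = 0) :
    IntegrableOn (fun z => θ z * fluxDensity u f η z) U := by
  have : IsFiniteMeasure (volume.restrict K) := ⟨by simpa using hK.measure_lt_top⟩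
  have hcont : ∀ {g : ℂ → ℝ}, ContinuousOn g U → MemLp g ⊤ (volume.restrict K) := fun {g} hg => by
    obtain ⟨M, hM⟩ := hK.exists_bound_of_continuousOn (hg.mono hKU)
    refine memLp_top_of_bound ((hg.mono hKU).aestronglyMeasurable hK.measurableSet) M ?_
    filter_upwards [ae_restrict_mem hK.measurableSet] with z hz using hM z hz
  have hmul : ∀ {g h : ℂ → ℝ}, MemLp g ⊤ (volume.restrict K) → MemLp h ⊤ (volume.restrict K) →
      MemLp (fun z => g z * h z) ⊤ (volume.restrict K) := fun hg hh =>
    hh.mul (p := ⊤) (q := ⊤) (r := ⊤) hg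
  have hd : ∀ e : ℂ, MemLp (fun z => fderiv ℝ η z e) ⊤ (volume.restrict K) := fun e =>
    hcont ((hη.continuousOn_fderiv_of_isOpen hU (by simp)).clm_apply continuousOn_const)
  have s := fun v => (memLp_top_inner_fderiv hU hu hK hKU v).1
  obtain ⟨r1, r2⟩ := memLp_top_div_conformalFactor hU hf hconf hell hu hK hKU
  have hmain := hmul (hcont hθ) (((hmul (s 1) (hd 1)).add (hmul (s Complex.I) (hd Complex.I))).sub
    ((hmul r1 ((hmul (s 1) (hd 1)).sub (hmul (s Complex.I) (hd Complex.I)))).sub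
      (hmul r2 ((hmul (s 1) (hd Complex.I)).add (hmul (s Complex.I) (hd 1))))))
  have hK1 : IntegrableOn (fun z => θ z * fluxDensity u f η z) K := by
    refine (hmain.integrable le_top).congr (Eventually.of_forall fun z => ?_)
    simp only [fluxDensity, Pi.add_apply, Pi.sub_apply]
    ring
  exact hK1.of_forall_sdiff_eq_zero hU.measurableSet fun z hz => h0 z hz.1 hz.2

end CCM


/-! ### Charts, partitions of unity and Lipschitz bounds on the surface. -/

namespace CCM

open Filter Topology

section Charts

variable {S : Type*} [TopologicalSpace S] [ChartedSpace ℂ S]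

theorem differentiableOn_transition [IsManifold 𝓘(ℂ) 1 S] {φ ψ : OpenPartialHomeomorph S ℂ}
    (hφ : φ ∈ atlas ℂ S) (hψ : ψ ∈ atlas ℂ S) :
    DifferentiableOn ℂ (φ.symm.trans ψ) (φ.symm.trans ψ).source := by
  have h := (contDiffGroupoid 1 𝓘(ℂ)).compatible hφ hψ
  rw [contDiffGroupoid, mem_groupoid_of_pregroupoid] at h
  have h1 := h.1
  simp only [contDiffPregroupoid, modelWithCornersSelf_coe, modelWithCornersSelf_coe_symm,
    Function.comp_id, Function.id_comp, Set.preimage_id, Set.range_id, Set.inter_univ] at h1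
  exact h1.differentiableOn one_ne_zero

/-- Complex differentiable transition maps are automatically smooth; the real smooth structure
provides partitions of unity. -/
theorem isManifold_real [IsManifold 𝓘(ℂ) 1 S] : IsManifold 𝓘(ℝ, ℂ) ∞ S := by
  refine isManifold_of_contDiffOn _ _ _ fun e e' he he' => ?_
  simp only [modelWithCornersSelf_coe, modelWithCornersSelf_coe_symm,
    Function.comp_id, Function.id_comp, Set.preimage_id, Set.range_id, Set.inter_univ]
  exact ((differentiableOn_transition he he').contDiffOn
    (e.symm.trans e').open_source).restrict_scalars ℝ

theorem deriv_transition_ne_zero [IsManifold 𝓘(ℂ) 1 S] {φ ψ : OpenPartialHomeomorph S ℂ}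
    (hφ : φ ∈ atlas ℂ S) (hψ : ψ ∈ atlas ℂ S) {z : ℂ} (hz : z ∈ (φ.symm.trans ψ).source) :
    deriv (φ.symm.trans ψ) z ≠ 0 := by
  set F := φ.symm.trans ψ
  have hF := (differentiableOn_transition hφ hψ).differentiableAt (F.open_source.mem_nhds hz)
  have hsym : F.symm = ψ.symm.trans φ := by
    simp [F, OpenPartialHomeomorph.trans_symm_eq_symm_trans_symm]
  have hG : DifferentiableAt ℂ F.symm (F z) := by
    have h1 := differentiableOn_transition hψ hφ
    rw [← hsym] at h1
    exact h1.differentiableAt (F.symm.open_source.mem_nhds (F.map_source hz))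
  intro h0
  have h2 := hG.hasDerivAt.comp z hF.hasDerivAt
  have h3 : (F.symm ∘ F) =ᶠ[𝓝 z] id := F.eventually_left_inverse hz
  have h4 := h2.congr_of_eventuallyEq h3.symm
  rw [h0, mul_zero] at h4
  exact zero_ne_one (h4.unique (hasDerivAt_id z))

/-- Compactness yields a finite index set, so sums and integrals commute without further care.
Smoothness is recorded in every chart because each function is later read in the charts of the
others. -/
theorem exists_partition_of_unity [T2Space S] [CompactSpace S] [IsManifold 𝓘(ℂ) 1 S] :
    ∃ (T : Finset S) (χ : T → S → ℝ), (∀ i x, 0 ≤ χ i x) ∧ (∀ x, ∑ i, χ i x = 1) ∧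
      (∀ i, tsupport (χ i) ⊆ (chartAt ℂ (i : S)).source) ∧
      ∀ i, ∀ ψ ∈ atlas ℂ S, ContDiffOn ℝ ∞ (fun z => χ i (ψ.symm z)) ψ.target := by
  have := isManifold_real (S := S)
  obtain ⟨T, hT⟩ := CompactSpace.elim_nhds_subcover (fun x : S => (chartAt ℂ x).source)
    fun x => chart_source_mem_nhds ℂ x
  obtain ⟨f, hf⟩ := SmoothPartitionOfUnity.exists_isSubordinate 𝓘(ℝ, ℂ) (isClosed_univ (X := S))
    (fun i : T => (chartAt ℂ (i : S)).source) (fun i => (chartAt ℂ (i : S)).open_source)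
    (fun x _ => by
      have : x ∈ ⋃ y ∈ T, (chartAt ℂ y).source := by rw [hT]; trivial
      simp only [Set.mem_iUnion] at this ⊢
      obtain ⟨y, hy, hxy⟩ := this
      exact ⟨⟨y, hy⟩, hxy⟩)
  refine ⟨T, fun i => f i, fun i x => f.nonneg i x, fun x => ?_, hf, fun i ψ hψ => ?_⟩
  · rw [← finsum_eq_sum_of_fintype]
    exact f.sum_eq_one (Set.mem_univ x)
  · have h1 : ContMDiffOn 𝓘(ℝ, ℂ) 𝓘(ℝ, ℂ) ∞ ψ.symm ψ.target :=
      contMDiffOn_symm_of_mem_maximalAtlas (IsManifold.subset_maximalAtlas hψ)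
    exact ((f i).contMDiff.comp_contMDiffOn h1).contDiffOn

end Charts

/-- The local expression of a function with support in the domain of a chart, extended by zero. -/
theorem exists_chart_extension {S : Type*} [TopologicalSpace S] [CompactSpace S]
    {φ : OpenPartialHomeomorph S ℂ} {χ : S → ℝ}
    (hs : tsupport χ ⊆ φ.source) (hχ : ContDiffOn ℝ ∞ (fun z => χ (φ.symm z)) φ.target) :
    ∃ η : ℂ → ℝ, ContDiff ℝ ∞ η ∧ HasCompactSupport η ∧ tsupport η ⊆ φ.target ∧
      ∀ z ∈ φ.target, η z = χ (φ.symm z) := by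
  -- Compactness makes this image closed in the whole plane, which is what gives smoothness of the
  -- zero extension at the boundary of the chart target.
  have hK : IsCompact (φ '' tsupport χ) :=
    (isClosed_tsupport χ).isCompact.image_of_continuousOn (φ.continuousOn.mono hs)
  have hKt : φ '' tsupport χ ⊆ φ.target := by
    rintro _ ⟨x, hx, rfl⟩
    exact φ.map_source (hs hx)
  have h0 : ∀ z ∉ φ '' tsupport χ, φ.target.indicator (fun z => χ (φ.symm z)) z = 0 :=
    fun z hz => by
      by_cases hzt : z ∈ φ.target
      · rw [Set.indicator_of_mem hzt]
        refine image_eq_zero_of_notMem_tsupport fun h => hz ⟨_, h, φ.right_inv hzt⟩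
      · rw [Set.indicator_of_notMem hzt]
  have hts : tsupport (φ.target.indicator fun z => χ (φ.symm z)) ⊆ φ '' tsupport χ :=
    closure_minimal (fun z hz => by
      by_contra h
      exact hz (h0 z h)) hK.isClosed
  refine ⟨φ.target.indicator fun z => χ (φ.symm z), ?_,
    hK.of_isClosed_subset (isClosed_tsupport _) hts, hts.trans hKt,
    fun z hz => Set.indicator_of_mem hz _⟩
  rw [contDiff_iff_contDiffAt]
  intro z
  by_cases hz : z ∈ φ.target
  · refine (hχ.contDiffAt (φ.open_target.mem_nhds hz)).congr_of_eventuallyEq ?_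
    filter_upwards [φ.open_target.mem_nhds hz] with y hy using Set.indicator_of_mem hy _
  · refine (contDiffAt_const (c := (0 : ℝ))).congr_of_eventuallyEq ?_
    filter_upwards [hK.isClosed.isOpen_compl.mem_nhds fun h => hz (hKt h)] with y hy using h0 y hy

theorem fderiv_comp_symm_eq_zero {S : Type*} [TopologicalSpace S]
    {φ : OpenPartialHomeomorph S ℂ} {η : S → ℝ} {z : ℂ}
    (hz : z ∈ φ.target) (hη : φ.symm z ∉ tsupport η) : fderiv ℝ (fun y => η (φ.symm y)) z = 0 := by
  have h1 : (fun y => η (φ.symm y)) =ᶠ[𝓝 z] fun _ => 0 := by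
    filter_upwards [(φ.symm.continuousAt hz).preimage_mem_nhds
      ((isClosed_tsupport η).isOpen_compl.mem_nhds hη)] with y hy
    exact image_eq_zero_of_notMem_tsupport hy
  rw [h1.fderiv_eq]
  simp

theorem conformalAt_of_eventuallyEq {u v : ℂ → Space} {z : ℂ} (h : ConformalAt u z)
    (huv : v =ᶠ[𝓝 z] u) : ConformalAt v z := by
  obtain ⟨f', h1, h2⟩ := h
  exact ⟨f', h1.congr_of_eventuallyEq huv, h2⟩

/-- Near each point the map factors through a smooth reference chart e as (Φ ∘ e⁻¹) ∘ (e ∘ φ⁻¹);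
both factors are locally Lipschitz. -/
theorem locallyLipschitzOn_comp_chart_symm {S : Type*} [TopologicalSpace S] [ChartedSpace Plane S]
    [ChartedSpace ℂ S] {Φ : S → Space} (hΦ : IsWeakImmersion Φ)
    (hc : IsInducedConformalStructure Φ) {φ : OpenPartialHomeomorph S ℂ} (hφ : φ ∈ atlas ℂ S) :
    LocallyLipschitzOn φ.target (Φ ∘ φ.symm) := by
  intro z hz
  set e := chartAt Plane (φ.symm z)
  have he : e ∈ atlas Plane S := chart_mem_atlas _ _
  have hzs : z ∈ (φ.symm.trans e).source := by
    simp [hz, e]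
  obtain ⟨K₁, t₁, ht₁, hL₁⟩ := (hc.lipschitz e he φ hφ).2 hzs
  have hez : (φ.symm.trans e) z ∈ e.target := e.map_source (mem_chart_source _ _)
  obtain ⟨K₂, t₂, ht₂, hL₂⟩ := hΦ.lipschitz e he hez
  rw [e.open_target.nhdsWithin_eq hez] at ht₂
  rw [(φ.symm.trans e).open_source.nhdsWithin_eq hzs] at ht₁
  rw [φ.open_target.nhdsWithin_eq hz]
  have hcont : ContinuousAt (φ.symm.trans e) z := (φ.symm.trans e).continuousAt hzs
  refine ⟨K₂ * K₁, (t₁ ∩ (φ.symm.trans e) ⁻¹' t₂) ∩ (φ.symm.trans e).source,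
    inter_mem (inter_mem ht₁ (hcont.preimage_mem_nhds ht₂))
      ((φ.symm.trans e).open_source.mem_nhds hzs), ?_⟩
  have h1 : LipschitzOnWith (K₂ * K₁) ((Φ ∘ e.symm) ∘ (φ.symm.trans e))
      ((t₁ ∩ (φ.symm.trans e) ⁻¹' t₂) ∩ (φ.symm.trans e).source) :=
    hL₂.comp (hL₁.mono fun y hy => hy.1.1) fun y hy => hy.1.2
  intro x hx y hy
  have h2 : ∀ y ∈ (φ.symm.trans e).source,
      ((Φ ∘ e.symm) ∘ (φ.symm.trans e)) y = (Φ ∘ φ.symm) y := fun y hy => by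
    simp only [Function.comp_apply, OpenPartialHomeomorph.coe_trans]
    rw [e.left_inv (by simpa using (by simpa using hy : _ ∧ _).2)]
  have h3 := h1 hx hy
  rwa [h2 x hx.2, h2 y hy.2] at h3

end CCM


/-! ### Summing the flux over the closed surface. -/

namespace CCM

open Filter Topology

theorem image_transition_source {S : Type*} [TopologicalSpace S]
    (φ ψ : OpenPartialHomeomorph S ℂ) :
    (φ.symm.trans ψ) '' (φ.symm.trans ψ).source = (ψ.symm.trans φ).source := by
  rw [OpenPartialHomeomorph.image_source_eq_target]
  ext z
  simp

section Global

variable {S : Type*} [TopologicalSpace S] [ChartedSpace ℂ S] {Φ : S → Space}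
  {Q : HolomorphicQuadraticForm S}

/-- The flux of `Φ` in the chart `φ`, paired with the differential of `η`. -/
noncomputable def chartFlux (Φ : S → Space) (Q : HolomorphicQuadraticForm S)
    (φ : OpenPartialHomeomorph S ℂ) (η : S → ℝ) (z : ℂ) : ℝ :=
  fluxDensity (Φ ∘ φ.symm) (Q.coeff φ) (fun y => η (φ.symm y)) z

theorem chartFlux_eq_zero {φ : OpenPartialHomeomorph S ℂ} {η : S → ℝ} {z : ℂ}
    (hz : z ∈ φ.target) (hη : φ.symm z ∉ tsupport η) : chartFlux Φ Q φ η z = 0 := by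
  simp [chartFlux, fluxDensity, fderiv_comp_symm_eq_zero hz hη]

/-- The flux is linear in the differential of its last argument, and the differentials of a
partition of unity add up to zero. -/
theorem sum_chartFlux {ι : Type*} [Fintype ι] {φ : OpenPartialHomeomorph S ℂ} {χ : ι → S → ℝ}
    (hχ : ∀ i, ContDiffOn ℝ ∞ (fun z => χ i (φ.symm z)) φ.target) (h1 : ∀ x, ∑ i, χ i x = 1)
    {z : ℂ} (hz : z ∈ φ.target) : ∑ i, chartFlux Φ Q φ (χ i) z = 0 := by
  have hd : ∑ i, fderiv ℝ (fun y => χ i (φ.symm y)) z = 0 := by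
    rw [← fderiv_fun_sum fun i _ => ((hχ i).contDiffAt (φ.open_target.mem_nhds hz)).differentiableAt
      (by simp)]
    simp [h1]
  have hd' : ∀ v, ∑ i, fderiv ℝ (fun y => χ i (φ.symm y)) z v = 0 := fun v => by
    rw [← sum_apply, hd, zero_apply]
  simp only [chartFlux, fluxDensity, Finset.sum_sub_distrib, Finset.sum_add_distrib,
    ← Finset.mul_sum, hd']
  simp

/-- The support conditions confine both integrands to the overlap of the charts, where the Jacobian
of the holomorphic transition is exactly the factor by which the flux density changes. -/
theorem setIntegral_mul_chartFlux_comm [IsManifold 𝓘(ℂ) 1 S] {φ ψ : OpenPartialHomeomorph S ℂ}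
    (hφ : φ ∈ atlas ℂ S) (hψ : ψ ∈ atlas ℂ S)
    (hconf : ∀ᵐ z ∂(volume.restrict φ.target), ConformalAt (Φ ∘ φ.symm) z) {θ η : S → ℝ}
    (hη : ContDiffOn ℝ ∞ (fun z => η (ψ.symm z)) ψ.target) (hθs : tsupport θ ⊆ ψ.source)
    (hηs : tsupport η ⊆ φ.source) :
    ∫ z in φ.target, θ (φ.symm z) * chartFlux Φ Q φ η z
      = ∫ z in ψ.target, θ (ψ.symm z) * chartFlux Φ Q ψ η z := by
  set F := φ.symm.trans ψ with hFdef
  have hFs : F.source ⊆ φ.target := fun z hz => by simpa using hz.1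
  have hFt : (ψ.symm.trans φ).source ⊆ ψ.target := fun z hz => by simpa using hz.1
  have hL : ∫ z in φ.target, θ (φ.symm z) * chartFlux Φ Q φ η z
      = ∫ z in F.source, θ (φ.symm z) * chartFlux Φ Q φ η z := by
    refine setIntegral_eq_of_subset_of_forall_sdiff_eq_zero φ.open_target.measurableSet hFs
      fun z hz => ?_
    have h0 : θ (φ.symm z) = 0 := by
      refine image_eq_zero_of_notMem_tsupport fun h => ?_
      exact hz.2 (by simpa [F] using ⟨hz.1, hθs h⟩)
    simp only [h0, zero_mul]
  have hR : ∫ z in ψ.target, θ (ψ.symm z) * chartFlux Φ Q ψ η z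
      = ∫ z in (ψ.symm.trans φ).source, θ (ψ.symm z) * chartFlux Φ Q ψ η z := by
    refine setIntegral_eq_of_subset_of_forall_sdiff_eq_zero ψ.open_target.measurableSet hFt
      fun z hz => ?_
    rw [chartFlux_eq_zero hz.1, mul_zero]
    intro h
    exact hz.2 (by simpa using ⟨hz.1, hηs h⟩)
  have hdiff : ∀ z ∈ F.source, DifferentiableAt ℂ F z := fun z hz =>
    (differentiableOn_transition hφ hψ).differentiableAt (F.open_source.mem_nhds hz)
  rw [hL, hR, ← image_transition_source φ ψ, ← hFdef, integral_image_eq_integral_abs_det_fderiv_smul volume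
    F.open_source.measurableSet
    (fun z hz => ((hdiff z hz).restrictScalars ℝ).hasFDerivAt.hasFDerivWithinAt) F.injOn]
  refine setIntegral_congr_ae F.open_source.measurableSet ?_
  filter_upwards [(ae_restrict_iff' φ.open_target.measurableSet).1 hconf] with z hc hz
  have hzψ : F z ∈ (ψ.symm.trans φ).source := by
    rw [← image_transition_source φ ψ]
    exact ⟨z, hz, rfl⟩
  have hzt : F z ∈ ψ.target := hFt hzψ
  have hleft : ∀ y ∈ F.source, ψ.symm (F y) = φ.symm y := fun y hy => by
    have : φ.symm y ∈ ψ.source := by simpa using hy.2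
    simp [F, ψ.left_inv this]
  have hback : (ψ.symm.trans φ) (F z) = z := by
    simp only [OpenPartialHomeomorph.coe_trans, Function.comp_apply, hleft z hz,
      φ.right_inv (hFs hz)]
  -- Conformality in the chart ψ is deduced from that in φ by composing with a conformal transition,
  -- so no null set has to be transported between charts.
  have hcv : ConformalAt (Φ ∘ ψ.symm) (F z) := by
    have h1 : ConformalAt (ψ.symm.trans φ) (F z) :=
      ((differentiableOn_transition hψ hφ).differentiableAt
        ((ψ.symm.trans φ).open_source.mem_nhds hzψ)).conformalAt
        (deriv_transition_ne_zero hψ hφ hzψ)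
    have h2 : ConformalAt (Φ ∘ φ.symm) ((ψ.symm.trans φ) (F z)) := by
      rw [hback]
      exact hc (hFs hz)
    refine conformalAt_of_eventuallyEq (h2.comp _ h1) ?_
    filter_upwards [(ψ.symm.trans φ).open_source.mem_nhds hzψ] with y hy
    have : ψ.symm y ∈ φ.source := by simpa using hy.2
    simp [φ.left_inv this]
  have hev : ∀ᶠ y in 𝓝 z, φ.symm y = ψ.symm (F y) := by
    filter_upwards [F.open_source.mem_nhds hz] with y hy using (hleft y hy).symm
  rw [abs_det_fderiv_of_differentiableAt (hdiff z hz), hleft z hz, chartFlux,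
    fluxDensity_comp (u := Φ ∘ φ.symm) (v := Φ ∘ ψ.symm) (g := Q.coeff ψ)
      (θ := fun y => η (ψ.symm y)) (hdiff z hz) (deriv_transition_ne_zero hφ hψ hz) hcv
      (hev.mono fun y hy => congrArg Φ hy)
      ((hη.contDiffAt (ψ.open_target.mem_nhds hzt)).differentiableAt (by simp))
      (hev.mono fun y hy => congrArg η hy) (Q.transform φ hφ ψ hψ z hz), chartFlux, smul_eq_mul]
  ring

/-- A compact surface with a strictly elliptic solution is empty: summing the flux identities over a
partition of unity shows that its area vanishes. -/
theorem isEmpty_of_flux [T2Space S] [CompactSpace S] [IsManifold 𝓘(ℂ) 1 S]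
    (hLip : ∀ φ ∈ atlas ℂ S, LocallyLipschitzOn φ.target (Φ ∘ φ.symm))
    (hconf : ∀ φ ∈ atlas ℂ S, ∀ᵐ z ∂(volume.restrict φ.target), ConformalAt (Φ ∘ φ.symm) z)
    (hsol : SolvesEquation Φ Q) (hell : StrictlyElliptic Φ Q) : IsEmpty S := by
  obtain ⟨T, χ, hχ0, hχ1, hχs, hχ⟩ := exists_partition_of_unity (S := S)
  set φ : T → OpenPartialHomeomorph S ℂ := fun i => chartAt ℂ (i : S)
  have hφ : ∀ i, φ i ∈ atlas ℂ S := fun i => chart_mem_atlas _ _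
  have hK : ∀ i, IsCompact (φ i '' tsupport (χ i)) ∧ φ i '' tsupport (χ i) ⊆ (φ i).target :=
    fun i => by
    refine ⟨(isClosed_tsupport _).isCompact.image_of_continuousOn ((φ i).continuousOn.mono
      (hχs i)), ?_⟩
    rintro _ ⟨x, hx, rfl⟩
    exact (φ i).map_source (hχs i hx)
  have hnot : ∀ i, ∀ z ∈ (φ i).target, z ∉ φ i '' tsupport (χ i) →
      (φ i).symm z ∉ tsupport (χ i) := fun i z hz hzK h => hzK ⟨_, h, (φ i).right_inv hz⟩
  have hint : ∀ i j k, (k = i ∨ k = j) → IntegrableOn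
      (fun z => χ i ((φ k).symm z) * chartFlux Φ Q (φ k) (χ j) z) (φ k).target := by
    intro i j k hk
    refine integrableOn_mul_fluxDensity (φ k).open_target (hLip _ (hφ k)) (hconf _ (hφ k))
      (Q.holomorphic _ (hφ k)) (hell _ (hφ k)) (hχ i _ (hφ k)).continuousOn (hχ j _ (hφ k))
      (hK k).1 (hK k).2 fun z hz hzK => ?_
    have h1 := hnot k z hz hzK
    rcases hk with rfl | rfl
    · rw [image_eq_zero_of_notMem_tsupport h1, zero_mul]
    · rw [← chartFlux, chartFlux_eq_zero hz h1, mul_zero]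
  have hE : ∀ i, ∀ᵐ z ∂(volume.restrict (φ i).target),
      0 < conformalFactor (Φ ∘ (φ i).symm) z := fun i => by
    filter_upwards [hconf _ (hφ i)] with z hz using (conformalAt_relations hz).1
  have hflux : ∀ i, ∫ z in (φ i).target, chartFlux Φ Q (φ i) (χ i) z
      = - ∫ z in (φ i).target, χ i ((φ i).symm z) * (2 * conformalFactor (Φ ∘ (φ i).symm) z) := by
    intro i
    obtain ⟨η, h1, h2, h3, h4⟩ := exists_chart_extension (hχs i) (hχ i _ (hφ i))
    obtain ⟨n', h5, h6⟩ := hsol _ (hφ i)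
    have h7 := integral_fluxDensity (φ i).open_target (hLip _ (hφ i)) (hconf _ (hφ i))
      (Q.holomorphic _ (hφ i)) h5 h6 (hell _ (hφ i)) h1 h2 h3
    have h8 : ∀ z ∈ (φ i).target, η =ᶠ[𝓝 z] fun y => χ i ((φ i).symm y) := fun z hz => by
      filter_upwards [(φ i).open_target.mem_nhds hz] with y hy using h4 y hy
    have h9 : ∀ z ∉ (φ i).target, fluxDensity (Φ ∘ (φ i).symm) (Q.coeff (φ i)) η z = 0 :=
      fun z hz => by
      have h9 : ∀ v, fderiv ℝ η z v = 0 := fun v =>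
        image_eq_zero_of_notMem_tsupport (f := fun z => fderiv ℝ η z v)
          fun h => hz (h3 (tsupport_fderiv_apply_subset η v h))
      simp [fluxDensity, h9]
    have h10 : ∀ z ∉ (φ i).target, η z * (2 * conformalFactor (Φ ∘ (φ i).symm) z) = 0 :=
      fun z hz => by
      rw [image_eq_zero_of_notMem_tsupport fun h => hz (h3 h), zero_mul]
    rw [← setIntegral_eq_integral_of_forall_compl_eq_zero h9,
      ← setIntegral_eq_integral_of_forall_compl_eq_zero h10] at h7
    refine Eq.trans (setIntegral_congr_fun (φ i).open_target.measurableSet fun z hz => ?_)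
      (h7.trans (congrArg Neg.neg (setIntegral_congr_fun (φ i).open_target.measurableSet
        fun z hz => ?_)))
    · simp only [chartFlux, fluxDensity, (h8 z hz).fderiv_eq]
    · simp only [h4 z hz]
      rfl
  -- The divergence theorem on the closed surface: insert 1 = Σ χ_j, move the (i, j) term to chart
  -- j, and sum over i first, where the fluxes of the χ_i cancel.
  have hsum : ∑ i, ∫ z in (φ i).target, chartFlux Φ Q (φ i) (χ i) z = 0 := by
    have h1 : ∀ i, ∫ z in (φ i).target, chartFlux Φ Q (φ i) (χ i) z
        = ∑ j, ∫ z in (φ j).target, χ j ((φ j).symm z) * chartFlux Φ Q (φ j) (χ i) z := by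
      intro i
      rw [← Finset.sum_congr rfl fun j _ => setIntegral_mul_chartFlux_comm (hφ i) (hφ j)
        (hconf _ (hφ i)) (hχ i _ (hφ j)) (hχs j) (hχs i),
        ← integral_finsetSum _ fun j _ => hint j i i (Or.inr rfl)]
      simp only [← Finset.sum_mul, hχ1, one_mul]
    rw [Finset.sum_congr rfl fun i _ => h1 i, Finset.sum_comm]
    refine Finset.sum_eq_zero fun j _ => ?_
    rw [← integral_finsetSum _ fun i _ => hint j i j (Or.inl rfl)]
    refine setIntegral_eq_zero_of_forall_eq_zero fun z hz => ?_
    rw [← Finset.mul_sum, sum_chartFlux (fun i => hχ i _ (hφ j)) hχ1 hz, mul_zero]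
  have hnn : ∀ i, 0 ≤ᵐ[volume.restrict (φ i).target] fun z =>
      χ i ((φ i).symm z) * (2 * conformalFactor (Φ ∘ (φ i).symm) z) := fun i => by
    filter_upwards [hE i] with z hz using mul_nonneg (hχ0 _ _) (by positivity)
  have hzero : ∀ i, ∫ z in (φ i).target,
      χ i ((φ i).symm z) * (2 * conformalFactor (Φ ∘ (φ i).symm) z) = 0 := by
    simp only [hflux, Finset.sum_neg_distrib, neg_eq_zero] at hsum
    intro i
    exact (Finset.sum_eq_zero_iff_of_nonneg fun j _ => integral_nonneg_of_ae (hnn j)).1 hsum i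
      (Finset.mem_univ i)
  have hχzero : ∀ i x, χ i x = 0 := by
    intro i x
    by_cases hx : x ∈ tsupport (χ i)
    swap
    · exact image_eq_zero_of_notMem_tsupport hx
    have hi : IntegrableOn (fun z => χ i ((φ i).symm z)
        * (2 * conformalFactor (Φ ∘ (φ i).symm) z)) (φ i).target := by
      have : IsFiniteMeasure (volume.restrict (φ i '' tsupport (χ i))) :=
        ⟨by simpa using (hK i).1.measure_lt_top⟩
      have h1 := memLp_top_conformalFactor (φ i).open_target (hLip _ (hφ i)) (hK i).1 (hK i).2
      have hcont := (hχ i _ (hφ i)).continuousOn.mono (hK i).2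
      obtain ⟨M, hM⟩ := (hK i).1.exists_bound_of_continuousOn hcont
      have h2 : IntegrableOn (fun z => χ i ((φ i).symm z)
          * (2 * conformalFactor (Φ ∘ (φ i).symm) z)) (φ i '' tsupport (χ i)) := by
        refine Integrable.bdd_mul (c := M) ((h1.integrable le_top).const_mul 2)
          (hcont.aestronglyMeasurable (hK i).1.measurableSet) ?_
        filter_upwards [ae_restrict_mem (hK i).1.measurableSet] with z hz using hM z hz
      refine h2.of_forall_sdiff_eq_zero (φ i).open_target.measurableSet fun z hz => ?_
      rw [image_eq_zero_of_notMem_tsupport (hnot i z hz.1 hz.2), zero_mul]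
    have h1 := (integral_eq_zero_iff_of_nonneg_ae (hnn i) hi).1 (hzero i)
    have h2 : (fun z => χ i ((φ i).symm z)) =ᵐ[volume.restrict (φ i).target] fun _ => 0 := by
      filter_upwards [h1, hE i] with z h3 h4
      rcases mul_eq_zero.1 h3 with h | h
      · exact h
      · linarith
    -- E is positive almost everywhere, so χ_i vanishes almost everywhere in its chart, and by
    -- continuity everywhere there. This contradicts Σ χ_i = 1 at any point.
    have h3 := Measure.eqOn_open_of_ae_eq h2 (φ i).open_target (hχ i _ (hφ i)).continuousOn
      continuousOn_const ((φ i).map_source (hχs i hx))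
    simpa [(φ i).left_inv (hχs i hx)] using h3
  refine ⟨fun x => ?_⟩
  have := hχ1 x
  simp [hχzero] at this

end Global

end CCM

/-- There is no strictly elliptic conformally constrained minimal (weak) immersion of a nonempty
compact surface (without boundary) into `ℝ³`. -/
theorem propositionI1 {S : Type*} [TopologicalSpace S] [T2Space S] [CompactSpace S] [Nonempty S]
    [ChartedSpace CCM.Plane S] [IsManifold 𝓘(ℝ, CCM.Plane) ∞ S] :
    ¬ ∃ Φ : S → CCM.Space, CCM.IsStrictlyEllipticCCMinimal Φ := by
  rintro ⟨Φ, hΦ, _, _, hc, Q, hsol, hell⟩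
  have := CCM.isEmpty_of_flux (fun φ hφ => CCM.locallyLipschitzOn_comp_chart_symm hΦ hc hφ)
    hc.conformal hsol hell
  exact not_isEmpty_of_nonempty S this
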